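/- **Lemma (initial state preparation).** Let $N\ge d\ge 1$ be integers and $n=\lceil\log_2 N\rceil$ (so $N=2^n$ if $N$ is a power of two); label oscillators by $0,\dots,N-1$, written in $n$ bits. Consider $N$ coupled oscillators with masses $0<m_j\le m_{\max}$, a symmetric matrix of spring constants $0\le\kappa_{jk}\le\kappa_{\max}$ with at most $d$ nonzero entries in each row, initial velocities $\dot x(0)\in\mathbb R^N$ and initial displacements $x(0)\in\mathbb R^N$, with norms $\alpha=\|\dot x(0)\|$, $\beta=\|x(0)\|$ and energy $$E=\tfrac12\sum_j m_j\dot x_j(0)^2+\tfrac12\Big(\sum_j\kappa_{jj}x_j(0)^2+\sum_{j<k}\kappa_{jk}(x_j(0)-x_k(0))^2\Big)>0 .$$ Put $E_{\max}=\frac{m_{\max}}2\alpha^2+\frac{\kappa_{\max}}2\beta^2$, and let $|\psi(0)\rangle$ be the state of $2n+1$ qubits $$|\psi(0)\rangle=\frac1{\sqrt{2E}}\Big[\sum_j\sqrt{m_j}\,\dot x_j(0)|0\rangle|j\rangle|0\rangle+i\sum_j\sqrt{\kappa_{jj}}\,x_j(0)|1\rangle|j\rangle|j\rangle+i\sum_{j<k}\sqrt{\kappa_{jk}}\,(x_j(0)-x_k(0))|1\rangle|j\rangle|k\rangle\Big].$$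 *Access.* A unitary $\mathcal U$ on $n+1$ qubits satisfies $\alpha\,\mathcal U|0\rangle|0\rangle=|0\rangle\sum_j\dot x_j(0)|j\rangle$ and $\beta\,\mathcal U|1\rangle|0\rangle=|1\rangle\sum_jx_j(0)|j\rangle$. An oracle $\mathcal S$ performs unitarily the maps $|j,\ell\rangle\mapsto|j,a(j,\ell)\rangle$ for $0\le\ell<d$, where $a(j,\cdot)$ is injective with values in $\{0,\dots,N-1\}$ and its values include all columns of nonzero entries of row $j$ of $\kappa$; and, for every number of bits $r$, $|j,k,z\rangle\mapsto|j,k,z\oplus\bar\kappa_{jk}\rangle$ and $|j,z\rangle\mapsto|j,z\oplus\bar m_j\rangle$ for $z\in\{0,1\}^r$, where $\bar\kappa_{jk}$ and $\bar m_j$ are the first $r$ digits of a binary expansion $\kappa_{jk}=\kappa_{\max}[.c_{jk,1}c_{jk,2}\dots]$ and $m_j=m_{\max}[.b_{j,1}b_{j,2}\dots]$. Each application of one of these maps or of its inverse is one use of $\mathcal S$. On inputs not listed, $\mathcal U$ and $\mathcal S$ are arbitrary unitaries. *Claim.* There is a universal constant $C>0$ such that for all $N,d,m_{\max},\kappa_{\max},\alpha,\beta,E$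 and $\varepsilon>0$ there is a quantum circuit, depending only on these known quantities, that makes at most $C\,Q_{\rm ini}$ uses in total of $\mathcal U$, $\mathcal S$ and their inverses, where $$Q_{\rm ini}=\sqrt{E_{\max}d/E},$$ and uses at most $$C\,Q_{\rm ini}\Big[\log^2\!\Big(2+\frac{N E_{\max}}{E\,\varepsilon}\Big)+\log N\Big]$$ arbitrary two-qubit gates, such that for every system of oscillators with these parameters and every $\mathcal U$, $\mathcal S$ giving access to it as above, the circuit maps the all-zero state to a state within Euclidean distance $\varepsilon$ of $|\psi(0)\rangle$ (with all ancilla qubits in $|0\rangle$). -/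

import Mathlib

open scoped Matrix

noncomputable section

/-! ## Qubit registers

The computational basis of a register whose qubits are labelled by `ι` is `ι → Fin 2`, so bitwise
exclusive or is addition.  State vectors are functions on the basis; norms are Euclidean.
-/

/-- The computational basis vector `|s⟩`. -/
def ket {ι : Type} [Fintype ι] [DecidableEq ι] (s : ι → Fin 2) : (ι → Fin 2) → ℂ := Pi.single s 1

/-- The unitary operators on a register with qubits labelled by `ι`. -/
abbrev RegUnitary (ι : Type) [Fintype ι] [DecidableEq ι] : Type :=
  Matrix.unitaryGroup (ι → Fin 2) ℂ

/-- The `n` lowest binary digits of `j`; for `j < 2 ^ n` this encodes `j` in `n` qubits. -/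
def bits (n j : ℕ) : Fin n → Fin 2 := fun i => Fin.ofNat 2 (j / 2 ^ (i : ℕ))

/-- The operator `V ⊗ 1` on the wires `Fin w`, where `V` acts on the wires selected by `e` and the
identity acts on all other wires. -/
def onWires {ι : Type} {w : ℕ} (e : ι ↪ Fin w)
    (V : Matrix (ι → Fin 2) (ι → Fin 2) ℂ) : Matrix (Fin w → Fin 2) (Fin w → Fin 2) ℂ :=
  open Classical in
  Matrix.of fun s t => if ∀ i, i ∉ Set.range e → s i = t i then V (s ∘ e) (t ∘ e) else 0

/-- The state `ψ` on the wires selected by `e`, and `|0⟩` on every other wire. -/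
def padZero {ι : Type} {w : ℕ} (e : ι ↪ Fin w) (ψ : (ι → Fin 2) → ℂ) : (Fin w → Fin 2) → ℂ :=
  open Classical in
  fun s => if ∀ i, i ∉ Set.range e → s i = 0 then ψ (s ∘ e) else 0

/-! ## Coupled oscillators -/

/-- `N` coupled oscillators: spring constants, masses, and the initial data. -/
structure OscillatorSystem (N : ℕ) where
  /-- `κ j k` couples the oscillators `j` and `k`; `κ j j` couples `j` to the wall. -/
  κ : Matrix (Fin N) (Fin N) ℝ
  /-- the masses, i.e. the diagonal of the mass matrix -/
  m : Fin N → ℝ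
  /-- the initial displacements -/
  x : EuclideanSpace ℝ (Fin N)
  /-- the initial velocities -/
  v : EuclideanSpace ℝ (Fin N)
  κ_symm : κ.IsSymm
  κ_nonneg : ∀ j k, 0 ≤ κ j k
  m_pos : ∀ j, 0 < m j

namespace OscillatorSystem

variable {N : ℕ}

/-- The total (kinetic plus potential) energy. -/
def energy (S : OscillatorSystem N) : ℝ :=
  1 / 2 * ∑ j, S.m j * S.v j ^ 2 +
    1 / 2 * (∑ j, S.κ j j * S.x j ^ 2 +
      ∑ j, ∑ k ∈ Finset.Ioi j, S.κ j k * (S.x j - S.x k) ^ 2)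

/-- The system is compatible with the parameters known to the algorithm: the row sparsity `d`, the
bounds on masses and spring constants, the norms `α` of the velocity vector and `β` of the
displacement vector, and the energy `E`. -/
structure HasParams (S : OscillatorSystem N) (d : ℕ) (mMax κMax α β E : ℝ) : Prop where
  sparse : ∀ j, (Finset.univ.filter fun k => S.κ j k ≠ 0).card ≤ d
  m_le : ∀ j, S.m j ≤ mMax
  κ_le : ∀ j k, S.κ j k ≤ κMax
  norm_v : ‖S.v‖ = α
  norm_x : ‖S.x‖ = β
  energy_eq : S.energy = E

/-- The state `ψ(0)` on `2 n + 1` qubits (a flag and two index registers): the component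
`√(m j) (v j)` of the first block sits at `|0⟩|j⟩|0⟩`, and the component of `i μ(0)` belonging to
the pair `j ≤ k` sits at `|1⟩|j⟩|k⟩`. -/
def initialState (S : OscillatorSystem N) (n : ℕ) : ((Unit ⊕ Fin n ⊕ Fin n) → Fin 2) → ℂ :=
  ((1 / √(2 * S.energy) : ℝ) : ℂ) •
    (∑ j : Fin N, ((√(S.m j) * S.v j : ℝ) : ℂ) •
        ket (Sum.elim (fun _ => 0) (Sum.elim (bits n j) (fun _ => 0))) +
      Complex.I • ∑ j : Fin N, ((√(S.κ j j) * S.x j : ℝ) : ℂ) •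
        ket (Sum.elim (fun _ => 1) (Sum.elim (bits n j) (bits n j))) +
      Complex.I • ∑ j : Fin N, ∑ k ∈ Finset.Ioi j, ((√(S.κ j k) * (S.x j - S.x k) : ℝ) : ℂ) •
        ket (Sum.elim (fun _ => 1) (Sum.elim (bits n j) (bits n k))))

end OscillatorSystem

/-! ## Oracles -/

/-- The black boxes: the preparation unitary `prep`, and the three kinds of queries to the oracle
for masses and springs (neighbours, spring constants to `r` bits, masses to `r` bits).  These are
arbitrary unitaries; what they compute is stated in `OracleData.Describes`. -/
structure OracleData (n : ℕ) where
  prep : RegUnitary (Unit ⊕ Fin n)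
  neighbor : RegUnitary (Fin n ⊕ Fin n)
  spring : (r : ℕ) → RegUnitary ((Fin n ⊕ Fin n) ⊕ Fin r)
  mass : (r : ℕ) → RegUnitary (Fin n ⊕ Fin r)

/-- The black boxes give access to the system `S`.  Nothing is assumed about their action on inputs
that are not listed. -/
structure OracleData.Describes {n N : ℕ} (O : OracleData n) (S : OscillatorSystem N)
    (d : ℕ) (mMax κMax : ℝ) : Prop where
  /-- `α |0⟩|0⟩ ↦ |0⟩ ∑ j, (v j) |j⟩`, where `α = ‖v‖` -/
  prep_v : ((‖S.v‖ : ℝ) : ℂ) • (O.prep.1 *ᵥ ket (Sum.elim (fun _ => 0) fun _ => 0)) =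
    ∑ j : Fin N, ((S.v j : ℝ) : ℂ) • ket (Sum.elim (fun _ => 0) (bits n j))
  /-- `β |1⟩|0⟩ ↦ |1⟩ ∑ j, (x j) |j⟩`, where `β = ‖x‖` -/
  prep_x : ((‖S.x‖ : ℝ) : ℂ) • (O.prep.1 *ᵥ ket (Sum.elim (fun _ => 1) fun _ => 0)) =
    ∑ j : Fin N, ((S.x j : ℝ) : ℂ) • ket (Sum.elim (fun _ => 1) (bits n j))
  /-- `|j⟩|ℓ⟩ ↦ |j⟩|a j ℓ⟩`, where `a j` lists the columns of the nonzero entries of row `j`, padded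
  to length `d` by further columns -/
  neighbor_spec : ∃ a : Fin N → Fin d → Fin N,
    (∀ j, Function.Injective (a j)) ∧ (∀ j k, S.κ j k ≠ 0 → ∃ ℓ, a j ℓ = k) ∧
    ∀ (j : Fin N) (ℓ : Fin d), O.neighbor.1 *ᵥ ket (Sum.elim (bits n j) (bits n ℓ)) =
      ket (Sum.elim (bits n j) (bits n (a j ℓ)))
  /-- `|j⟩|k⟩|z⟩ ↦ |j⟩|k⟩|z ⊕ c⟩`, where `c` holds the first `r` digits of a binary expansion of
  `κ j k / κMax` -/
  spring_spec : ∃ c : Fin N → Fin N → ℕ → Fin 2,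
    (∀ j k, S.κ j k = κMax * Real.ofDigits (c j k)) ∧
    ∀ (r : ℕ) (j k : Fin N) (z : Fin r → Fin 2),
      (O.spring r).1 *ᵥ ket (Sum.elim (Sum.elim (bits n j) (bits n k)) z) =
        ket (Sum.elim (Sum.elim (bits n j) (bits n k)) (z + fun i : Fin r => c j k i))
  /-- `|j⟩|z⟩ ↦ |j⟩|z ⊕ b⟩`, where `b` holds the first `r` digits of a binary expansion of
  `m j / mMax` -/
  mass_spec : ∃ b : Fin N → ℕ → Fin 2,
    (∀ j, S.m j = mMax * Real.ofDigits (b j)) ∧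
    ∀ (r : ℕ) (j : Fin N) (z : Fin r → Fin 2),
      (O.mass r).1 *ᵥ ket (Sum.elim (bits n j) z) =
        ket (Sum.elim (bits n j) (z + fun i : Fin r => b j i))

/-! ## Circuits -/

/-- An instruction of a circuit on `w` wires: an arbitrary two-qubit gate, or one use of a black box
(of its inverse if `inv` is `true`) on the selected wires. -/
inductive QInstr (n w : ℕ) : Type
  | gate (V : RegUnitary (Fin 2)) (e : Fin 2 ↪ Fin w)
  | prep (inv : Bool) (e : (Unit ⊕ Fin n) ↪ Fin w)
  | neighbor (inv : Bool) (e : (Fin n ⊕ Fin n) ↪ Fin w)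
  | spring (inv : Bool) (r : ℕ) (e : ((Fin n ⊕ Fin n) ⊕ Fin r) ↪ Fin w)
  | mass (inv : Bool) (r : ℕ) (e : (Fin n ⊕ Fin r) ↪ Fin w)

namespace QInstr

variable {n w : ℕ}

/-- `V`, or its inverse. -/
def orient {ι : Type} [Fintype ι] [DecidableEq ι] (inv : Bool) (V : RegUnitary ι) :
    Matrix (ι → Fin 2) (ι → Fin 2) ℂ :=
  if inv then V.1ᴴ else V.1

/-- The operator that an instruction performs, given the black boxes. -/
def toMatrix (O : OracleData n) : QInstr n w → Matrix (Fin w → Fin 2) (Fin w → Fin 2) ℂ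
  | gate V e => onWires e V
  | prep inv e => onWires e (orient inv O.prep)
  | neighbor inv e => onWires e (orient inv O.neighbor)
  | spring inv r e => onWires e (orient inv (O.spring r))
  | mass inv r e => onWires e (orient inv (O.mass r))

/-- Whether the instruction is a two-qubit gate, as opposed to the use of a black box. -/
def isGate : QInstr n w → Bool
  | gate _ _ => true
  | _ => false

end QInstr

/-- A circuit: a list of instructions, performed from left to right. -/
abbrev QCircuit (n w : ℕ) : Type := List (QInstr n w)

namespace QCircuit

variable {n w : ℕ}

/-- The number of uses of black boxes and their inverses. -/
def queries (c : QCircuit n w) : ℕ := c.countP fun g => !g.isGate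

/-- The number of two-qubit gates. -/
def gates (c : QCircuit n w) : ℕ := c.countP fun g => g.isGate

/-- The state that the circuit produces from `|0…0⟩`, given the black boxes. -/
def output (O : OracleData n) (c : QCircuit n w) : (Fin w → Fin 2) → ℂ :=
  c.foldl (fun ψ g => g.toMatrix O *ᵥ ψ) (ket 0)

end QCircuit

/-- The energy of `N` uncoupled oscillators whose masses are all `mMax` and whose spring constants
are all `κMax`, with velocity vector of norm `α` and displacement vector of norm `β`. -/
def maxEnergy (mMax κMax α β : ℝ) : ℝ := mMax / 2 * α ^ 2 + κMax / 2 * β ^ 2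

end

noncomputable section

set_option linter.unusedSectionVars false

/-! ## Operators on finite sets of wires -/

/-- State vectors on the wires `W`. -/
abbrev QState (W : Type) : Type := (W → Fin 2) → ℂ

/-- Operators on the wires `W`. -/
abbrev QOp (W : Type) : Type := Matrix (W → Fin 2) (W → Fin 2) ℂ

section Wires

variable {ι κ W W' : Type}

/-- The operator `V ⊗ 1` on the wires `W`, where `V` acts on the wires selected by `e`. -/
def onW (e : ι ↪ W) (V : QOp ι) : QOp W :=
  open Classical in
  Matrix.of fun s t => if ∀ i, i ∉ Set.range e → s i = t i then V (s ∘ e) (t ∘ e) else 0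

/-- The state `φ` on the wires selected by `e`, and the bits of `s` on every other wire. -/
def insertState (e : ι ↪ W) (s : W → Fin 2) : QState ι →ₗ[ℂ] QState W :=
  open Classical in
  { toFun := fun φ u => if ∀ i, i ∉ Set.range e → u i = s i then φ (u ∘ e) else 0
    map_add' := by intro φ ψ; ext u; simp only [Pi.add_apply]; split_ifs <;> simp
    map_smul' := by intro c φ; ext u; simp }

theorem insertState_apply (e : ι ↪ W) (s : W → Fin 2) (φ : QState ι) (u : W → Fin 2)
    (h : ∀ i, i ∉ Set.range e → u i = s i) : insertState e s φ u = φ (u ∘ e) := by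
  simp only [insertState, LinearMap.coe_mk, AddHom.coe_mk]; rw [if_pos h]

theorem insertState_apply_zero (e : ι ↪ W) (s : W → Fin 2) (φ : QState ι) (u : W → Fin 2)
    (h : ¬ ∀ i, i ∉ Set.range e → u i = s i) : insertState e s φ u = 0 := by
  simp only [insertState, LinearMap.coe_mk, AddHom.coe_mk]; rw [if_neg h]

theorem insertState_congr (e : ι ↪ W) {s t : W → Fin 2}
    (h : ∀ i, i ∉ Set.range e → s i = t i) : insertState e s = insertState e t := by
  refine LinearMap.ext fun φ => funext fun u => ?_
  by_cases hu : ∀ i, i ∉ Set.range e → u i = s i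
  · rw [insertState_apply _ _ _ _ hu,
      insertState_apply _ _ _ _ fun i hi => (hu i hi).trans (h i hi)]
  · rw [insertState_apply_zero _ _ _ _ hu,
      insertState_apply_zero _ _ _ _ fun h' => hu fun i hi => (h' i hi).trans (h i hi).symm]

variable [Fintype ι] [DecidableEq ι] [Fintype κ] [DecidableEq κ]
  [Fintype W] [DecidableEq W] [Fintype W'] [DecidableEq W']

theorem mulVec_ket_apply (V : QOp W) (s u : W → Fin 2) : (V *ᵥ ket s) u = V u s := by
  simp [ket]

theorem ext_ket {A B : QOp W} (h : ∀ s, A *ᵥ ket s = B *ᵥ ket s) : A = B := by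
  ext s t
  rw [← mulVec_ket_apply A, h, mulVec_ket_apply]

theorem ket_apply (s u : W → Fin 2) : ket s u = if u = s then 1 else 0 := by
  simp [ket, Pi.single_apply]

theorem extend_comp (e : ι ↪ W) (u : ι → Fin 2) (s : W → Fin 2) :
    Function.extend e u s ∘ e = u := by
  ext i; simp [e.injective.extend_apply]

theorem extend_off (e : ι ↪ W) (u : ι → Fin 2) (s : W → Fin 2) (i : W)
    (hi : i ∉ Set.range e) : Function.extend e u s i = s i :=
  Function.extend_apply' _ _ _ (by simpa using hi)

theorem eq_extend (e : ι ↪ W) {u : ι → Fin 2} {s t : W → Fin 2} (ht : t ∘ e = u)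
    (hoff : ∀ i, i ∉ Set.range e → t i = s i) : t = Function.extend e u s := by
  ext i
  by_cases hi : i ∈ Set.range e
  · obtain ⟨j, rfl⟩ := hi
    rw [e.injective.extend_apply, ← ht]; rfl
  · rw [extend_off _ _ _ _ hi, hoff i hi]

theorem insertState_ket (e : ι ↪ W) (s : W → Fin 2) (u : ι → Fin 2) :
    insertState e s (ket u) = ket (Function.extend e u s) := by
  ext v
  by_cases hv : ∀ i, i ∉ Set.range e → v i = s i
  · rw [insertState_apply _ _ _ _ hv, ket_apply, ket_apply]
    congr 1
    apply propext
    constructor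
    · intro h; exact eq_extend e h hv
    · rintro rfl; exact extend_comp e u s
  · rw [insertState_apply_zero _ _ _ _ hv, ket_apply, if_neg]
    rintro rfl
    exact hv (extend_off e u s)

theorem onWires_eq_onW {w : ℕ} (e : ι ↪ Fin w) (V : QOp ι) : onWires e V = onW e V := by
  ext s t
  simp only [onWires, onW, Matrix.of_apply]
  congr

theorem onW_mulVec_ket (e : ι ↪ W) (V : QOp ι) (s : W → Fin 2) :
    onW e V *ᵥ ket s = insertState e s (V *ᵥ ket (s ∘ e)) := by
  ext u
  rw [mulVec_ket_apply]
  by_cases hu : ∀ i, i ∉ Set.range e → u i = s i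
  · rw [insertState_apply _ _ _ _ hu, mulVec_ket_apply]
    simp only [onW, Matrix.of_apply]; rw [if_pos hu]
  · rw [insertState_apply_zero _ _ _ _ hu]
    simp only [onW, Matrix.of_apply]; rw [if_neg hu]

theorem state_eq_sum (φ : QState ι) : φ = ∑ u, φ u • ket u := by
  ext v
  simp [Finset.sum_apply, ket_apply]

theorem onW_mulVec_insertState (e : ι ↪ W) (V : QOp ι) (s : W → Fin 2) (φ : QState ι) :
    onW e V *ᵥ insertState e s φ = insertState e s (V *ᵥ φ) := by
  have key : ∀ u, onW e V *ᵥ insertState e s (ket u) = insertState e s (V *ᵥ ket u) := by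
    intro u
    rw [insertState_ket, onW_mulVec_ket, extend_comp, insertState_congr e (extend_off e u s)]
  rw [state_eq_sum φ]
  simp only [map_sum, map_smul, Matrix.mulVec_sum, Matrix.mulVec_smul, key]

theorem onW_mul (e : ι ↪ W) (V V' : QOp ι) : onW e (V * V') = onW e V * onW e V' := by
  apply ext_ket
  intro s
  rw [← Matrix.mulVec_mulVec, onW_mulVec_ket, onW_mulVec_ket, onW_mulVec_insertState,
    Matrix.mulVec_mulVec]

theorem insertState_ket_self (e : ι ↪ W) (s : W → Fin 2) :
    insertState e s (ket (s ∘ e)) = ket s := by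
  rw [insertState_ket, ← eq_extend e rfl fun _ _ => rfl]

theorem onW_one (e : ι ↪ W) : onW e (1 : QOp ι) = 1 := by
  apply ext_ket
  intro s
  rw [onW_mulVec_ket, Matrix.one_mulVec, Matrix.one_mulVec, insertState_ket_self]

theorem onW_conjTranspose (e : ι ↪ W) (V : QOp ι) : onW e Vᴴ = (onW e V)ᴴ := by
  ext s t
  simp only [onW, Matrix.of_apply, Matrix.conjTranspose_apply]
  by_cases h : ∀ i, i ∉ Set.range e → s i = t i
  · rw [if_pos h, if_pos fun i hi => (h i hi).symm]
  · rw [if_neg h, if_neg fun h' => h fun i hi => (h' i hi).symm, star_zero]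

theorem onW_onW (e : ι ↪ W) (f : κ ↪ ι) (V : QOp κ) : onW e (onW f V) = onW (f.trans e) V := by
  apply ext_ket
  intro s
  rw [onW_mulVec_ket, onW_mulVec_ket, onW_mulVec_ket]
  generalize hφ : V *ᵥ ket ((s ∘ e) ∘ f) = φ
  have : V *ᵥ ket (s ∘ (f.trans e)) = φ := hφ
  rw [this]
  rw [state_eq_sum φ]
  simp only [map_sum, map_smul, insertState_ket]
  refine Finset.sum_congr rfl fun u _ => ?_
  congr 2
  apply eq_extend (f.trans e)
  · funext k
    simp [e.injective.extend_apply, f.injective.extend_apply]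
  · intro i hi
    by_cases h : i ∈ Set.range e
    · obtain ⟨j, rfl⟩ := h
      rw [e.injective.extend_apply]
      rw [extend_off]
      · rfl
      · rintro ⟨k, rfl⟩; exact hi ⟨k, rfl⟩
    · rw [extend_off _ _ _ _ h]

theorem onW_ket (e : ι ↪ W) {V : QOp ι} {a b : ι → Fin 2} {s t : W → Fin 2}
    (h : V *ᵥ ket a = ket b) (hs : s ∘ e = a) (ht : t ∘ e = b)
    (hoff : ∀ i, i ∉ Set.range e → s i = t i) : onW e V *ᵥ ket s = ket t := by
  rw [onW_mulVec_ket, hs, h, insertState_ket, ← eq_extend e ht fun i hi => (hoff i hi).symm]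

theorem onW_mem_unitary (e : ι ↪ W) {V : QOp ι} (hV : V ∈ Matrix.unitaryGroup (ι → Fin 2) ℂ) :
    onW e V ∈ Matrix.unitaryGroup (W → Fin 2) ℂ := by
  rw [Matrix.mem_unitaryGroup_iff, Matrix.star_eq_conjTranspose] at *
  rw [← onW_conjTranspose, ← onW_mul, hV, onW_one]

theorem conjTranspose_mulVec_of_unitary {U : QOp W} (hU : U ∈ Matrix.unitaryGroup (W → Fin 2) ℂ)
    {φ ψ : QState W} (h : U *ᵥ φ = ψ) : Uᴴ *ᵥ ψ = φ := by
  rw [Matrix.mem_unitaryGroup_iff', Matrix.star_eq_conjTranspose] at hU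
  rw [← h, Matrix.mulVec_mulVec, hU, Matrix.one_mulVec]

end Wires

/-! ## Circuits on finite sets of wires -/

/-- Instructions of a circuit on the wires `W`. -/
inductive Instr (n : ℕ) (W : Type) : Type
  | gate (V : RegUnitary (Fin 2)) (e : Fin 2 ↪ W)
  | prep (inv : Bool) (e : (Unit ⊕ Fin n) ↪ W)
  | neighbor (inv : Bool) (e : (Fin n ⊕ Fin n) ↪ W)
  | spring (inv : Bool) (r : ℕ) (e : ((Fin n ⊕ Fin n) ⊕ Fin r) ↪ W)
  | mass (inv : Bool) (r : ℕ) (e : (Fin n ⊕ Fin r) ↪ W)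

namespace Instr

variable {n : ℕ} {W W' : Type}

/-- Whether the instruction is a two-qubit gate. -/
def isGate : Instr n W → Bool
  | gate _ _ => true
  | _ => false

/-- The operator performed by an instruction. -/
def op (O : OracleData n) : Instr n W → QOp W
  | gate V e => onW e V
  | prep inv e => onW e (QInstr.orient inv O.prep)
  | neighbor inv e => onW e (QInstr.orient inv O.neighbor)
  | spring inv r e => onW e (QInstr.orient inv (O.spring r))
  | mass inv r e => onW e (QInstr.orient inv (O.mass r))

/-- The instruction on further wires. -/
def lift (f : W ↪ W') : Instr n W → Instr n W'
  | gate V e => gate V (e.trans f)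
  | prep inv e => prep inv (e.trans f)
  | neighbor inv e => neighbor inv (e.trans f)
  | spring inv r e => spring inv r (e.trans f)
  | mass inv r e => mass inv r (e.trans f)

/-- The inverse instruction. -/
def adj : Instr n W → Instr n W
  | gate V e => gate V⁻¹ e
  | prep inv e => prep (!inv) e
  | neighbor inv e => neighbor (!inv) e
  | spring inv r e => spring (!inv) r e
  | mass inv r e => mass (!inv) r e

/-- The instruction as an instruction on numbered wires. -/
def toQInstr {w : ℕ} : Instr n (Fin w) → QInstr n w
  | gate V e => .gate V e
  | prep inv e => .prep inv e
  | neighbor inv e => .neighbor inv e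
  | spring inv r e => .spring inv r e
  | mass inv r e => .mass inv r e

theorem isGate_lift (f : W ↪ W') (i : Instr n W) : (i.lift f).isGate = i.isGate := by
  cases i <;> rfl

theorem isGate_adj (i : Instr n W) : i.adj.isGate = i.isGate := by
  cases i <;> rfl

theorem isGate_toQInstr {w : ℕ} (i : Instr n (Fin w)) : i.toQInstr.isGate = i.isGate := by
  cases i <;> rfl

theorem toMatrix_toQInstr {w : ℕ} (O : OracleData n) (i : Instr n (Fin w)) :
    i.toQInstr.toMatrix O = i.op O := by
  cases i <;> exact onWires_eq_onW _ _

theorem orient_not {ι : Type} [Fintype ι] [DecidableEq ι] (inv : Bool) (V : RegUnitary ι) :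
    QInstr.orient (!inv) V = (QInstr.orient inv V)ᴴ := by
  cases inv <;> simp [QInstr.orient]

theorem orient_mem {ι : Type} [Fintype ι] [DecidableEq ι] (inv : Bool) (V : RegUnitary ι) :
    QInstr.orient inv V ∈ Matrix.unitaryGroup (ι → Fin 2) ℂ := by
  cases inv
  · exact V.2
  · exact (V⁻¹).2

variable [Fintype W] [DecidableEq W] [Fintype W'] [DecidableEq W']

theorem op_lift (O : OracleData n) (f : W ↪ W') (i : Instr n W) :
    (i.lift f).op O = onW f (i.op O) := by
  cases i <;> simp only [lift, op, onW_onW]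

theorem op_adj (O : OracleData n) (i : Instr n W) : i.adj.op O = (i.op O)ᴴ := by
  cases i
  · simp only [adj, op, ← onW_conjTranspose]; rfl
  all_goals simp only [adj, op, orient_not, onW_conjTranspose]

theorem op_mem_unitary (O : OracleData n) (i : Instr n W) :
    i.op O ∈ Matrix.unitaryGroup (W → Fin 2) ℂ := by
  cases i
  · exact onW_mem_unitary _ (Subtype.property _)
  all_goals exact onW_mem_unitary _ (orient_mem _ _)

end Instr

section Circuits

variable {n : ℕ} {W W' : Type} [Fintype W] [DecidableEq W] [Fintype W'] [DecidableEq W']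

/-- The operator performed by a list of instructions, from left to right. -/
def runOp (O : OracleData n) : List (Instr n W) → QOp W
  | [] => 1
  | i :: l => runOp O l * i.op O

theorem runOp_append (O : OracleData n) (l l' : List (Instr n W)) :
    runOp O (l ++ l') = runOp O l' * runOp O l := by
  induction l with
  | nil => simp [runOp]
  | cons i l ih => simp [runOp, ih, mul_assoc]

theorem runOp_lift (O : OracleData n) (f : W ↪ W') (l : List (Instr n W)) :
    runOp O (l.map (Instr.lift f)) = onW f (runOp O l) := by
  induction l with
  | nil => simp [runOp, onW_one]
  | cons i l ih => simp [runOp, ih, onW_mul, Instr.op_lift]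

theorem runOp_adj (O : OracleData n) (l : List (Instr n W)) :
    runOp O (l.map Instr.adj).reverse = (runOp O l)ᴴ := by
  induction l with
  | nil => simp [runOp]
  | cons i l ih => simp [runOp, runOp_append, ih, Instr.op_adj]

theorem runOp_mem_unitary (O : OracleData n) (l : List (Instr n W)) :
    runOp O l ∈ Matrix.unitaryGroup (W → Fin 2) ℂ := by
  induction l with
  | nil => exact one_mem _
  | cons i l ih => exact mul_mem ih (i.op_mem_unitary O)

/-- `F` is performed exactly by a circuit with at most `q` queries and `g` gates. -/
def Impl (q g : ℕ) (F : OracleData n → QOp W) : Prop :=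
  ∃ l : List (Instr n W), l.countP (fun i => !i.isGate) ≤ q ∧ l.countP (fun i => i.isGate) ≤ g ∧
    ∀ O, runOp O l = F O

theorem Impl.instr (i : Instr n W) :
    Impl (if i.isGate then 0 else 1) (if i.isGate then 1 else 0) fun O => i.op O :=
  ⟨[i], by cases h : i.isGate <;> simp [h], by cases h : i.isGate <;> simp [h],
    fun O => by simp [runOp]⟩

theorem Impl.one : Impl (n := n) (W := W) 0 0 fun _ => 1 := ⟨[], by simp, by simp, fun _ => rfl⟩

theorem Impl.mul {q g q' g' : ℕ} {F F' : OracleData n → QOp W} (h : Impl q g F)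
    (h' : Impl q' g' F') : Impl (q + q') (g + g') fun O => F O * F' O := by
  obtain ⟨l, hq, hg, hl⟩ := h
  obtain ⟨l', hq', hg', hl'⟩ := h'
  refine ⟨l' ++ l, ?_, ?_, fun O => by rw [runOp_append, hl, hl']⟩
  · rw [List.countP_append]; omega
  · rw [List.countP_append]; omega

theorem Impl.lift {q g : ℕ} {F : OracleData n → QOp W} (h : Impl q g F) (f : W ↪ W') :
    Impl q g fun O => onW f (F O) := by
  obtain ⟨l, hq, hg, hl⟩ := h
  refine ⟨l.map (Instr.lift f), ?_, ?_, fun O => by rw [runOp_lift, hl]⟩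
  · rw [List.countP_map]; simpa [Function.comp_def, Instr.isGate_lift] using hq
  · rw [List.countP_map]; simpa [Function.comp_def, Instr.isGate_lift] using hg

theorem Impl.adj {q g : ℕ} {F : OracleData n → QOp W} (h : Impl q g F) :
    Impl q g fun O => (F O)ᴴ := by
  obtain ⟨l, hq, hg, hl⟩ := h
  refine ⟨(l.map Instr.adj).reverse, ?_, ?_, fun O => by rw [runOp_adj, hl]⟩
  · rw [List.countP_reverse, List.countP_map]
    simpa [Function.comp_def, Instr.isGate_adj] using hq
  · rw [List.countP_reverse, List.countP_map]
    simpa [Function.comp_def, Instr.isGate_adj] using hg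

theorem Impl.mem_unitary {q g : ℕ} {F : OracleData n → QOp W} (h : Impl q g F)
    (O : OracleData n) : F O ∈ Matrix.unitaryGroup (W → Fin 2) ℂ := by
  obtain ⟨l, -, -, hl⟩ := h
  rw [← hl]; exact runOp_mem_unitary O l

theorem Impl.exists_circuit {w q g : ℕ} {F : OracleData n → QOp (Fin w)} (h : Impl q g F) :
    ∃ c : QCircuit n w, c.queries ≤ q ∧ c.gates ≤ g ∧ ∀ O, c.output O = F O *ᵥ ket 0 := by
  obtain ⟨l, hq, hg, hl⟩ := h
  refine ⟨l.map Instr.toQInstr, ?_, ?_, fun O => ?_⟩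
  · rw [QCircuit.queries, List.countP_map]
    simpa [Function.comp_def, Instr.isGate_toQInstr] using hq
  · rw [QCircuit.gates, List.countP_map]
    simpa [Function.comp_def, Instr.isGate_toQInstr] using hg
  · rw [← hl, QCircuit.output]
    generalize ket (ι := Fin w) 0 = φ
    clear hq hg hl
    induction l generalizing φ with
    | nil => simp [runOp]
    | cons i l ih =>
      simp only [List.map_cons, List.foldl_cons, Instr.toMatrix_toQInstr, runOp]
      rw [ih, Matrix.mulVec_mulVec]

end Circuits

/-! ## Circuits with ancillas that start and end in zero -/

section Blocks

variable {n : ℕ} {M M' A B : Type} [Fintype M] [DecidableEq M] [Fintype M'] [DecidableEq M']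
  [Fintype A] [DecidableEq A] [Fintype B] [DecidableEq B]

/-- The block of `F` in which the wires `A` start and end in zero. -/
def blk (F : QOp (M ⊕ A)) : QOp M := Matrix.of fun s t => F (Sum.elim s 0) (Sum.elim t 0)

theorem sumElim_injective : Function.Injective fun s : M → Fin 2 => (Sum.elim s 0 : M ⊕ A → Fin 2) :=
  fun s t h => by ext i; exact congrArg Fin.val (congrFun h (Sum.inl i))

theorem blk_mul (P : QOp (M ⊕ A)) (Q : QOp (M ⊕ B)) :
    blk (onW ((Function.Embedding.refl M).sumMap Function.Embedding.inl) P *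
      onW ((Function.Embedding.refl M).sumMap (Function.Embedding.inr (α := A) (β := B))) Q) =
    blk P * blk Q := by
  ext s t
  simp only [blk, Matrix.of_apply, Matrix.mul_apply]
  symm
  apply Finset.sum_of_injOn (fun v => Sum.elim v (0 : A ⊕ B → Fin 2))
  · exact sumElim_injective.injOn
  · intro x _; simp
  · intro u _ hu
    have : (∃ a, u (Sum.inr (Sum.inl a)) ≠ 0) ∨ (∃ b, u (Sum.inr (Sum.inr b)) ≠ 0) := by
      by_contra! h
      apply hu
      refine ⟨u ∘ Sum.inl, by simp, ?_⟩
      ext i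
      rcases i with i | i | i
      · rfl
      · simp [h.1]
      · simp [h.2]
    rcases this with ⟨a, ha⟩ | ⟨b, hb⟩
    · have : onW ((Function.Embedding.refl M).sumMap (Function.Embedding.inr (α := A) (β := B))) Q u
          (Sum.elim t 0) = 0 := by
        simp only [onW, Matrix.of_apply]
        apply if_neg
        intro h
        refine ha (h (Sum.inr (Sum.inl a)) ?_)
        rintro ⟨i | i, hi⟩ <;> simp at hi
      rw [this, mul_zero]
    · have : onW ((Function.Embedding.refl M).sumMap (Function.Embedding.inl (α := A) (β := B))) P
          (Sum.elim s 0) u = 0 := by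
        simp only [onW, Matrix.of_apply]
        apply if_neg
        intro h
        refine hb (h (Sum.inr (Sum.inr b)) ?_).symm
        rintro ⟨i | i, hi⟩ <;> simp at hi
      rw [this, zero_mul]
  · intro v _
    simp only [onW, Matrix.of_apply]
    rw [if_pos, if_pos]
    · congr 2 <;> (ext i; rcases i with i | i <;> rfl)
    · rintro (i | i | i) hi
      · exact absurd ⟨Sum.inl i, rfl⟩ hi
      · rfl
      · exact absurd ⟨Sum.inr i, rfl⟩ hi
    · rintro (i | i | i) hi
      · exact absurd ⟨Sum.inl i, rfl⟩ hi
      · exact absurd ⟨Sum.inr i, rfl⟩ hi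
      · rfl

/-- `F` is performed, up to ancillas that start in zero and are projected onto zero at the end, by
a circuit with at most `q` queries, and at most `g` gates and ancillas. -/
def BlockImpl (q g : ℕ) (F : OracleData n → QOp M) : Prop :=
  ∃ (A : Type) (_ : Fintype A) (_ : DecidableEq A) (G : OracleData n → QOp (M ⊕ A)),
    Fintype.card A ≤ g ∧ Impl q g G ∧ ∀ O, blk (G O) = F O

theorem Impl.mono {q g q' g' : ℕ} {F : OracleData n → QOp M} (h : Impl q g F)
    (hq : q ≤ q') (hg : g ≤ g') : Impl q' g' F := by
  obtain ⟨l, h1, h2, h3⟩ := h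
  exact ⟨l, h1.trans hq, h2.trans hg, h3⟩

theorem BlockImpl.mono {q g q' g' : ℕ} {F : OracleData n → QOp M} (h : BlockImpl q g F)
    (hq : q ≤ q') (hg : g ≤ g') : BlockImpl q' g' F := by
  obtain ⟨A, _, _, G, hA, hG, hF⟩ := h
  exact ⟨A, _, _, G, hA.trans hg, hG.mono hq hg, hF⟩

theorem BlockImpl.congr {q g : ℕ} {F F' : OracleData n → QOp M} (h : BlockImpl q g F)
    (hF : ∀ O, F O = F' O) : BlockImpl q g F' := by
  rwa [← funext hF]

theorem BlockImpl.mul {q g q' g' : ℕ} {F F' : OracleData n → QOp M} (h : BlockImpl q g F)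
    (h' : BlockImpl q' g' F') : BlockImpl (q + q') (g + g') fun O => F O * F' O := by
  obtain ⟨A, _, _, G, hA, hG, hF⟩ := h
  obtain ⟨A', _, _, G', hA', hG', hF'⟩ := h'
  refine ⟨A ⊕ A', inferInstance, inferInstance, _, ?_,
    (hG.lift ((Function.Embedding.refl M).sumMap Function.Embedding.inl)).mul
      (hG'.lift ((Function.Embedding.refl M).sumMap Function.Embedding.inr)), fun O => ?_⟩
  · rw [Fintype.card_sum]; omega
  · rw [blk_mul, hF, hF']

theorem blk_conjTranspose (P : QOp (M ⊕ A)) : blk Pᴴ = (blk P)ᴴ := rfl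

theorem BlockImpl.adj {q g : ℕ} {F : OracleData n → QOp M} (h : BlockImpl q g F) :
    BlockImpl q g fun O => (F O)ᴴ := by
  obtain ⟨A, _, _, G, hA, hG, hF⟩ := h
  exact ⟨A, _, _, _, hA, hG.adj, fun O => by rw [blk_conjTranspose, hF]⟩

theorem blk_lift (P : QOp (M ⊕ A)) (e : M ↪ M') :
    blk (onW (e.sumMap (Function.Embedding.refl A)) P) = onW e (blk P) := by
  ext s t
  simp only [blk, Matrix.of_apply, onW]
  have h1 : ∀ s : M' → Fin 2, (Sum.elim s (0 : A → Fin 2)) ∘ (e.sumMap (Function.Embedding.refl A))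
      = Sum.elim (s ∘ e) 0 := by
    intro s; ext i; rcases i with i | i <;> rfl
  rw [h1, h1]
  congr 1
  apply propext
  constructor
  · intro h i hi
    refine h (Sum.inl i) ?_
    rintro ⟨j | j, hj⟩
    · exact hi ⟨j, by simpa using hj⟩
    · simp at hj
  · rintro h (i | i) hi
    · refine h i ?_
      rintro ⟨j, rfl⟩
      exact hi ⟨Sum.inl j, rfl⟩
    · exact absurd ⟨Sum.inr i, rfl⟩ hi

theorem BlockImpl.lift {q g : ℕ} {F : OracleData n → QOp M} (h : BlockImpl q g F) (e : M ↪ M') :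
    BlockImpl q g fun O => onW e (F O) := by
  obtain ⟨A, _, _, G, hA, hG, hF⟩ := h
  exact ⟨A, _, _, _, hA, hG.lift _, fun O => by rw [blk_lift, hF]⟩

theorem BlockImpl.contract {q g : ℕ} {F : OracleData n → QOp (M ⊕ B)} (h : BlockImpl q g F) :
    BlockImpl q (g + Fintype.card B) fun O => blk (F O) := by
  obtain ⟨A, _, _, G, hA, hG, hF⟩ := h
  refine ⟨B ⊕ A, inferInstance, inferInstance, _, ?_,
    (hG.lift (Equiv.sumAssoc M B A).toEmbedding).mono le_rfl (Nat.le_add_right _ _), fun O => ?_⟩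
  · rw [Fintype.card_sum]; omega
  · simp only [← hF]
    ext s t
    simp only [blk, Matrix.of_apply, onW]
    rw [if_pos]
    · congr 1 <;> (ext i; rcases i with (i | i) | i <;> rfl)
    · intro i hi
      exact absurd ((Equiv.sumAssoc M B A).surjective i) hi

theorem Impl.block {q g : ℕ} {F : OracleData n → QOp M} (h : Impl q g F) : BlockImpl q g F := by
  refine ⟨Empty, inferInstance, inferInstance, _, by simp, h.lift Function.Embedding.inl,
    fun O => ?_⟩
  ext s t
  simp only [blk, Matrix.of_apply, onW]
  rw [if_pos]
  · rfl
  · rintro (i | i) hi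
    · exact absurd ⟨i, rfl⟩ hi
    · exact i.elim

theorem BlockImpl.one : BlockImpl (n := n) (M := M) 0 0 fun _ => 1 := Impl.one.block

theorem BlockImpl.gate (V : QOp (Fin 2)) (hV : V ∈ Matrix.unitaryGroup (Fin 2 → Fin 2) ℂ)
    (e : Fin 2 ↪ M) : BlockImpl (n := n) 0 1 fun _ => onW e V :=
  (Impl.instr (Instr.gate ⟨V, hV⟩ e)).block

theorem blk_mulVec_ket (F : QOp (M ⊕ A)) (s : M → Fin 2) :
    blk F *ᵥ ket s = fun u => (F *ᵥ ket (Sum.elim s 0)) (Sum.elim u 0) := by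
  ext u
  rw [mulVec_ket_apply, mulVec_ket_apply]; rfl

end Blocks

/-! ## Elementary gates -/

section Gates

variable {n : ℕ} {W W' A : Type} [Fintype W] [DecidableEq W] [Fintype W'] [DecidableEq W']
  [Fintype A] [DecidableEq A]

/-- A single wire. -/
def wire (w : W) : Unit ↪ W := ⟨fun _ => w, fun _ _ _ => rfl⟩

/-- Two different wires. -/
def twoWires {i j : W} (h : i ≠ j) : Fin 2 ↪ W :=
  ⟨![i, j], by
    intro a b
    fin_cases a <;> fin_cases b <;> simp [h, h.symm]⟩

@[simp] theorem twoWires_zero {i j : W} (h : i ≠ j) : twoWires h 0 = i := rfl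
@[simp] theorem twoWires_one {i j : W} (h : i ≠ j) : twoWires h 1 = j := rfl

theorem range_twoWires {i j : W} (h : i ≠ j) (w : W) (hw : w ∉ Set.range (twoWires h)) :
    w ≠ i ∧ w ≠ j :=
  ⟨fun h' => hw ⟨0, h'.symm⟩, fun h' => hw ⟨1, h'.symm⟩⟩

/-- The one-qubit gate `V` on the wire `w`. -/
def on1 (w : W) (V : Matrix (Fin 2) (Fin 2) ℂ) : QOp W :=
  onW (wire w) (V.submatrix (Equiv.funUnique Unit (Fin 2)) (Equiv.funUnique Unit (Fin 2)))

theorem on1_mulVec_ket (w : W) (V : Matrix (Fin 2) (Fin 2) ℂ) (s : W → Fin 2) :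
    on1 w V *ᵥ ket s = ∑ b, V b (s w) • ket (Function.update s w b) := by
  have h : (V.submatrix (Equiv.funUnique Unit (Fin 2)) (Equiv.funUnique Unit (Fin 2)))
      *ᵥ ket (s ∘ wire w) = ∑ b, V b (s w) • ket (fun _ => b) := by
    ext u
    rw [mulVec_ket_apply]
    simp only [Matrix.submatrix_apply, Finset.sum_apply, Pi.smul_apply, ket_apply, smul_eq_mul,
      mul_ite, mul_one, mul_zero]
    rw [Finset.sum_eq_single (u ())]
    · rw [if_pos (by ext x; rfl)]; rfl
    · intro b _ hb
      rw [if_neg]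
      rintro rfl; exact hb rfl
    · simp
  rw [on1, onW_mulVec_ket, h, map_sum]
  refine Finset.sum_congr rfl fun b _ => ?_
  rw [map_smul, insertState_ket]
  congr 2
  symm
  apply eq_extend
  · funext x; exact Function.update_self w b s
  · intro i hi
    rw [Function.update_of_ne]
    rintro rfl; exact hi ⟨(), rfl⟩

theorem blk_onW_inl {ι : Type} (e : ι ↪ W) (P : QOp ι) :
    blk (onW (e.trans (Function.Embedding.inl (β := A))) P) = onW e P := by
  ext s t
  simp only [blk, Matrix.of_apply, onW]
  congr 1
  apply propext
  constructor
  · intro h i hi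
    refine h (Sum.inl i) ?_
    rintro ⟨j, hj⟩
    exact hi ⟨j, by simpa using hj⟩
  · rintro h (i | i) hi
    · refine h i ?_
      rintro ⟨j, rfl⟩
      exact hi ⟨j, rfl⟩
    · rfl

theorem BlockImpl.on1 {V : Matrix (Fin 2) (Fin 2) ℂ} (hV : V * Vᴴ = 1) (w : W) :
    BlockImpl (n := n) 0 1 fun _ => on1 w V := by
  have h0 : V.submatrix (Equiv.funUnique Unit (Fin 2)) (Equiv.funUnique Unit (Fin 2)) ∈
      Matrix.unitaryGroup (Unit → Fin 2) ℂ := by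
    rw [Matrix.mem_unitaryGroup_iff, Matrix.star_eq_conjTranspose, Matrix.conjTranspose_submatrix,
      Matrix.submatrix_mul_equiv, hV, Matrix.submatrix_one_equiv]
  have h1 := (Impl.instr (n := n) (Instr.gate ⟨_, onW_mem_unitary (wire (0 : Fin 2)) h0⟩
    (twoWires (i := Sum.inl w) (j := Sum.inr ()) (by simp))))
  refine ⟨Unit, inferInstance, inferInstance, _, by simp, h1, fun O => ?_⟩
  simp only [Instr.op, onW_onW]
  exact blk_onW_inl (A := Unit) (wire w) _

/-- The operation that adds the bit `g` to the wire `t`. -/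
def xorOp (t : W) (g : (W → Fin 2) → Fin 2) : QOp W :=
  Matrix.of fun u s => if u = Function.update s t (s t + g s) then 1 else 0

theorem xorOp_ket (t : W) (g : (W → Fin 2) → Fin 2) (s : W → Fin 2) :
    xorOp t g *ᵥ ket s = ket (Function.update s t (s t + g s)) := by
  ext u
  rw [mulVec_ket_apply, ket_apply]; rfl

theorem fin_two_add_self (a : Fin 2) : a + a = 0 := by
  fin_cases a <;> rfl

theorem xorOp_mul_self {t : W} {g : (W → Fin 2) → Fin 2}
    (hg : ∀ s b, g (Function.update s t b) = g s) : xorOp t g * xorOp t g = 1 := by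
  apply ext_ket
  intro s
  rw [← Matrix.mulVec_mulVec, xorOp_ket, xorOp_ket, Matrix.one_mulVec, hg]
  simp [add_assoc, fin_two_add_self]

theorem xorOp_conjTranspose {t : W} {g : (W → Fin 2) → Fin 2}
    (hg : ∀ s b, g (Function.update s t b) = g s) : (xorOp t g)ᴴ = xorOp t g := by
  ext u s
  have key : ∀ a b : W → Fin 2, a = Function.update b t (b t + g b) →
      b = Function.update a t (a t + g a) := by
    rintro a b rfl
    simp [hg, add_assoc, fin_two_add_self]
  simp only [xorOp, Matrix.conjTranspose_apply, Matrix.of_apply]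
  by_cases h : u = Function.update s t (s t + g s)
  · rw [if_pos h, if_pos (key _ _ h), star_one]
  · rw [if_neg h, if_neg fun h' => h (key _ _ h'), star_zero]

theorem xorOp_mem_unitary {t : W} {g : (W → Fin 2) → Fin 2}
    (hg : ∀ s b, g (Function.update s t b) = g s) :
    xorOp t g ∈ Matrix.unitaryGroup (W → Fin 2) ℂ := by
  rw [Matrix.mem_unitaryGroup_iff, Matrix.star_eq_conjTranspose, xorOp_conjTranspose hg,
    xorOp_mul_self hg]

theorem xorOp_add {t : W} (g h : (W → Fin 2) → Fin 2)
    (hg : ∀ s b, g (Function.update s t b) = g s) :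
    xorOp t g * xorOp t h = xorOp t fun s => h s + g s := by
  apply ext_ket
  intro s
  rw [← Matrix.mulVec_mulVec, xorOp_ket, xorOp_ket, xorOp_ket, hg]
  simp [add_assoc]

theorem BlockImpl.cnot {i t : W} (h : i ≠ t) :
    BlockImpl (n := n) 0 1 fun _ => xorOp t fun s => s i := by
  have hu : xorOp (1 : Fin 2) (fun s => s 0) ∈ Matrix.unitaryGroup (Fin 2 → Fin 2) ℂ :=
    xorOp_mem_unitary (by intro s b; simp)
  refine (BlockImpl.gate _ hu (twoWires h)).congr fun _ => ext_ket fun s => ?_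
  rw [xorOp_ket]
  refine onW_ket (twoWires h) (xorOp_ket _ _ _) rfl ?_ ?_
  · ext a
    fin_cases a
    · simp [Function.update_of_ne h]
    · simp
  · intro w hw
    rw [Function.update_of_ne (range_twoWires h w hw).2]

theorem diagonal_mulVec_ket (D : (W → Fin 2) → ℂ) (s : W → Fin 2) :
    Matrix.diagonal D *ᵥ ket s = D s • ket s := by
  ext u
  rw [mulVec_ket_apply]
  by_cases h : u = s
  · subst h; simp [ket_apply]
  · simp [h, ket_apply]

theorem BlockImpl.phase₂ {i j : W} (h : i ≠ j) {c : Fin 2 → Fin 2 → ℂ}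
    (hc : ∀ a b, c a b * star (c a b) = 1) :
    BlockImpl (n := n) 0 1 fun _ => Matrix.diagonal fun s : W → Fin 2 => c (s i) (s j) := by
  have hu : Matrix.diagonal (fun s : Fin 2 → Fin 2 => c (s 0) (s 1)) ∈
      Matrix.unitaryGroup (Fin 2 → Fin 2) ℂ := by
    rw [Matrix.mem_unitaryGroup_iff, Matrix.star_eq_conjTranspose, Matrix.diagonal_conjTranspose,
      Matrix.diagonal_mul_diagonal, ← Matrix.diagonal_one]
    congr 1
    ext s
    exact hc _ _
  refine (BlockImpl.gate _ hu (twoWires h)).congr fun _ => ext_ket fun s => ?_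
  rw [onW_mulVec_ket, diagonal_mulVec_ket, diagonal_mulVec_ket, map_smul, insertState_ket_self]
  rfl

/-- The Hadamard matrix. -/
def hadM : Matrix (Fin 2) (Fin 2) ℂ := ((1 / √2 : ℝ) : ℂ) • !![1, 1; 1, -1]

theorem sqrt_two_inv_sq : ((1 / √2 : ℝ) : ℂ) * ((1 / √2 : ℝ) : ℂ) = 1 / 2 := by
  rw [← Complex.ofReal_mul, div_mul_div_comm, Real.mul_self_sqrt (by norm_num)]
  norm_num

theorem hadM_mul_self : hadM * hadM = 1 := by
  rw [hadM, Matrix.smul_mul, Matrix.mul_smul, smul_smul, sqrt_two_inv_sq]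
  ext i j
  fin_cases i <;> fin_cases j <;> simp <;> norm_num

theorem hadM_conjTranspose : hadMᴴ = hadM := by
  ext i j
  fin_cases i <;> fin_cases j <;> simp [hadM, Matrix.conjTranspose_apply]

theorem BlockImpl.had (w : W) : BlockImpl (n := n) 0 1 fun _ => _root_.on1 w hadM :=
  BlockImpl.on1 (by rw [hadM_conjTranspose, hadM_mul_self]) w

/-- The sign flip of the states in which three wires are one. -/
def ccz (i j t : W) : QOp W :=
  Matrix.diagonal fun s => if s i = 1 ∧ s j = 1 ∧ s t = 1 then -1 else 1

theorem BlockImpl.ccz {i j t : W} (hij : i ≠ j) (hit : i ≠ t) (hjt : j ≠ t) :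
    BlockImpl (n := n) 0 5 fun _ => ccz i j t := by
  let c : Fin 2 → Fin 2 → ℂ := fun a b => if a = 1 ∧ b = 1 then Complex.I else 1
  let c' : Fin 2 → Fin 2 → ℂ := fun a b => if a = 1 ∧ b = 1 then -Complex.I else 1
  have hc : ∀ a b, c a b * star (c a b) = 1 := by
    intro a b; by_cases h : a = 1 ∧ b = 1 <;> simp [c, h]
  have hc' : ∀ a b, c' a b * star (c' a b) = 1 := by
    intro a b; by_cases h : a = 1 ∧ b = 1 <;> simp [c', h]
  refine (((((BlockImpl.phase₂ (n := n) hit hc).mul (BlockImpl.phase₂ hjt hc)).mul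
    (BlockImpl.cnot hij)).mul (BlockImpl.phase₂ hjt hc')).mul (BlockImpl.cnot hij)).congr
    fun _ => ext_ket fun s => ?_
  simp only [← Matrix.mulVec_mulVec, xorOp_ket, diagonal_mulVec_ket, Matrix.mulVec_smul, smul_smul,
    _root_.ccz]
  have h1 : ∀ b b', Function.update (Function.update s j b) j b' = Function.update s j b' := by
    intros; simp
  simp only [h1, Function.update_self, Function.update_of_ne hij, Function.update_of_ne hjt.symm,
    add_assoc, fin_two_add_self, add_zero, Function.update_eq_self]
  congr 1
  generalize s i = a, s j = b, s t = d
  fin_cases a <;> fin_cases b <;> fin_cases d <;> simp [c, c']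

theorem BlockImpl.toffoli {i j t : W} (hij : i ≠ j) (hit : i ≠ t) (hjt : j ≠ t) :
    BlockImpl (n := n) 0 7 fun _ => xorOp t fun s => s i * s j := by
  refine ((((BlockImpl.had (n := n) t).mul (BlockImpl.ccz hij hit hjt)).mul
    (BlockImpl.had t))).congr fun _ => ext_ket fun s => ?_
  simp only [← Matrix.mulVec_mulVec, xorOp_ket, on1_mulVec_ket, Fin.sum_univ_two,
    Matrix.mulVec_add, Matrix.mulVec_smul, _root_.ccz, diagonal_mulVec_ket, Function.update_self,
    Function.update_of_ne hit, Function.update_of_ne hjt, Function.update_idem]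
  have h2 := sqrt_two_inv_sq
  generalize hz : ((1 / √2 : ℝ) : ℂ) = z at h2
  have hz' : ∀ v : QState W, z • z • v = (1 / 2 : ℂ) • v := fun v => by rw [smul_smul, h2]
  generalize s i = a, s j = b, s t = d
  fin_cases a <;> fin_cases b <;> fin_cases d <;>
    simp [hadM, -one_div, hz, ← smul_add, smul_neg, ← sub_eq_add_neg, ← smul_sub, hz'] <;> module

end Gates

/-! ## Boolean functions -/

section Boolean

variable {n : ℕ} {X B W A : Type} [Fintype W] [DecidableEq W] [Fintype X] [DecidableEq X]
  [Fintype B] [DecidableEq B] [Fintype A] [DecidableEq A]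

/-- A Boolean function of bits. -/
abbrev BitFun (X : Type) : Type := (X → Fin 2) → Bool

/-- A Boolean as a bit. -/
def toBit (b : Bool) : Fin 2 := if b then 1 else 0

/-- A bit as a Boolean. -/
def ofBit (b : Fin 2) : Bool := decide (b = 1)

@[simp] theorem toBit_ofBit (b : Fin 2) : toBit (ofBit b) = b := by
  fin_cases b <;> rfl

@[simp] theorem ofBit_toBit (b : Bool) : ofBit (toBit b) = b := by
  cases b <;> rfl

/-- `f` is an input bit or listed in `l`. -/
def Avail (l : List (BitFun X)) (f : BitFun X) : Prop := (∃ i, f = fun x => ofBit (x i)) ∨ f ∈ l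

/-- Straight-line programs: lists of Boolean functions, last one first, each of which is a constant
or computed from two available ones. -/
inductive SLP : List (BitFun X) → Prop
  | nil : SLP []
  | const (c : Bool) {l : List (BitFun X)} : SLP l → SLP ((fun _ => c) :: l)
  | cons (φ : Bool → Bool → Bool) {l : List (BitFun X)} {f g : BitFun X} :
      SLP l → Avail l f → Avail l g → SLP ((fun x => φ (f x) (g x)) :: l)

theorem BlockImpl.xorScaled (c : Fin 2) {t : W} {g : (W → Fin 2) → Fin 2} {k : ℕ}
    (h : BlockImpl (n := n) 0 k fun _ => xorOp t g) :
    BlockImpl (n := n) 0 k fun _ => xorOp t fun s => c * g s := by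
  fin_cases c
  · refine ((BlockImpl.one (n := n)).mono le_rfl (Nat.zero_le _)).congr fun _ => ?_
    apply ext_ket; intro s
    rw [xorOp_ket, Matrix.one_mulVec]
    simp
  · exact h.congr fun _ => by simp

theorem BlockImpl.not (t : W) : BlockImpl (n := n) 0 1 fun _ => xorOp t fun _ => 1 := by
  have h : (!![0, 1; 1, 0] : Matrix (Fin 2) (Fin 2) ℂ) * !![0, 1; 1, 0]ᴴ = 1 := by
    ext i j
    fin_cases i <;> fin_cases j <;> simp [Matrix.mul_apply, Matrix.conjTranspose_apply]
  refine (BlockImpl.on1 (n := n) h t).congr fun _ => ext_ket fun s => ?_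
  rw [xorOp_ket, on1_mulVec_ket, Fin.sum_univ_two]
  generalize s t = a
  fin_cases a <;> simp

theorem bit_poly (φ : Fin 2 → Fin 2 → Fin 2) (a b : Fin 2) :
    φ a b = φ 0 0 * 1 + (φ 0 0 + φ 1 0) * a + (φ 0 0 + φ 0 1) * b +
      (φ 0 0 + φ 1 0 + φ 0 1 + φ 1 1) * (a * b) := by
  generalize h0 : φ 0 0 = p, h1 : φ 0 1 = q, h2 : φ 1 0 = r, h3 : φ 1 1 = s
  fin_cases a <;> fin_cases b <;> simp [h0, h1, h2, h3] <;> revert p q r s <;> decide +revert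

theorem BlockImpl.xor₂ (φ : Fin 2 → Fin 2 → Fin 2) {i j t : W} (hi : i ≠ t) (hj : j ≠ t) :
    BlockImpl (n := n) 0 10 fun _ => xorOp t fun s => φ (s i) (s j) := by
  have h4 : BlockImpl (n := n) 0 7 fun _ => xorOp t fun s => s i * s j := by
    by_cases hij : i = j
    · subst hij
      refine ((BlockImpl.cnot (n := n) hi).mono le_rfl (by norm_num)).congr fun _ => ?_
      congr 1; ext s : 1
      generalize s i = a
      fin_cases a <;> rfl
    · exact BlockImpl.toffoli hij hi hj
  refine (((((BlockImpl.not (n := n) t).xorScaled (φ 0 0)).mul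
    ((BlockImpl.cnot hi).xorScaled (φ 0 0 + φ 1 0))).mul
    ((BlockImpl.cnot hj).xorScaled (φ 0 0 + φ 0 1))).mul
    (h4.xorScaled (φ 0 0 + φ 1 0 + φ 0 1 + φ 1 1))).congr fun _ => ?_
  rw [xorOp_add, xorOp_add, xorOp_add]
  · congr 1; ext s : 1
    refine Eq.trans ?_ (bit_poly φ (s i) (s j)).symm
    abel
  all_goals intro s b; simp [Function.update_of_ne hi, Function.update_of_ne hj]

theorem xorOp_ket_zero {t : W} {g : (W → Fin 2) → Fin 2} {s : W → Fin 2} (h : s t = 0) :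
    xorOp t g *ᵥ ket s = ket (Function.update s t (g s)) := by
  rw [xorOp_ket, h, zero_add]

/-- The wires `p` receive the values of the functions of the list `l` at the inputs on the wires
`e`. -/
def Computes (l : List (BitFun X)) (e : X ↪ W) (p : Fin l.length ↪ W) (F : QOp W) : Prop :=
  ∀ s, (∀ j, s (p j) = 0) → ∃ t, F *ᵥ ket s = ket t ∧ (∀ w, w ∉ Set.range p → t w = s w) ∧
    ∀ j, t (p j) = toBit (l.get j (s ∘ e))

theorem Avail.exists_wire {l : List (BitFun X)} {f : BitFun X} (h : Avail l f) (e : X ↪ W)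
    (p : Fin l.length ↪ W) (hd : ∀ i j, e i ≠ p j) :
    ∃ i : W, (i ∈ Set.range e ∨ i ∈ Set.range p) ∧ ∀ s t : W → Fin 2,
      (∀ w, w ∉ Set.range p → t w = s w) → (∀ j, t (p j) = toBit (l.get j (s ∘ e))) →
      t i = toBit (f (s ∘ e)) := by
  rcases h with ⟨i, rfl⟩ | h
  · refine ⟨e i, Or.inl ⟨i, rfl⟩, fun s t h1 _ => ?_⟩
    rw [h1, toBit_ofBit]
    · rfl
    · rintro ⟨j, hj⟩; exact hd i j hj.symm
  · obtain ⟨j, rfl⟩ := List.get_of_mem h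
    exact ⟨p j, Or.inr ⟨j, rfl⟩, fun s t _ h2 => h2 j⟩

theorem Computes.cons {l : List (BitFun X)} {f : BitFun X} {e : X ↪ W}
    {p : Fin (f :: l).length ↪ W} {F : QOp W}
    (hF : Computes l e ((Fin.succEmb _).trans p) F) {g : (W → Fin 2) → Fin 2}
    (hg : ∀ s t : W → Fin 2, (∀ j, s (p j) = 0) →
      (∀ w, w ∉ Set.range ((Fin.succEmb _).trans p) → t w = s w) →
      (∀ j, t (p (Fin.succ j)) = toBit (l.get j (s ∘ e))) → g t = toBit (f (s ∘ e))) :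
    Computes (f :: l) e p (xorOp (p 0) g * F) := by
  intro s hs
  obtain ⟨t, h1, h2, h3⟩ := hF s fun j => hs _
  have h0 : p 0 ∉ Set.range ((Fin.succEmb l.length).trans p) := by
    rintro ⟨j, hj⟩
    exact absurd (p.injective hj) (Fin.succ_ne_zero j)
  refine ⟨Function.update t (p 0) (g t), ?_, ?_, ?_⟩
  · rw [← Matrix.mulVec_mulVec, h1, xorOp_ket_zero]
    rw [h2 _ h0, hs]
  · intro w hw
    rw [Function.update_of_ne, h2]
    · rintro ⟨j, rfl⟩; exact hw ⟨_, rfl⟩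
    · rintro rfl; exact hw ⟨_, rfl⟩
  · intro j
    refine Fin.cases ?_ (fun j => ?_) j
    · rw [Function.update_self]
      exact hg s t hs h2 h3
    · rw [Function.update_of_ne]
      · exact h3 j
      · exact fun h => absurd (p.injective h) (Fin.succ_ne_zero j)

theorem SLP.compile {l : List (BitFun X)} (h : SLP l) (e : X ↪ W) (p : Fin l.length ↪ W)
    (hd : ∀ i j, e i ≠ p j) :
    ∃ F : QOp W, BlockImpl (n := n) 0 (10 * l.length) (fun _ => F) ∧
      F ∈ Matrix.unitaryGroup (W → Fin 2) ℂ ∧ Computes l e p F := by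
  induction h with
  | nil =>
    exact ⟨1, BlockImpl.one, one_mem _, fun s _ => ⟨s, Matrix.one_mulVec _, fun _ _ => rfl,
      fun j => j.elim0⟩⟩
  | @const c l hl ih =>
    obtain ⟨F, h1, h2, h3⟩ := ih ((Fin.succEmb _).trans p) fun i j => hd _ _
    refine ⟨xorOp (p 0) (fun _ => toBit c) * F, ?_, mul_mem (xorOp_mem_unitary fun _ _ => rfl) h2,
      h3.cons fun _ _ _ _ _ => rfl⟩
    have := (((BlockImpl.not (n := n) (p 0)).xorScaled (toBit c)).mul h1).mono le_rfl
      (show 1 + 10 * l.length ≤ 10 * (l.length + 1) by omega)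
    simpa using this
  | @cons φ l f g hl hf hg ih =>
    have hd' : ∀ i j, e i ≠ (Fin.succEmb l.length).trans p j := fun i j => hd _ _
    obtain ⟨F, h1, h2, h3⟩ := ih ((Fin.succEmb _).trans p) hd'
    obtain ⟨i, hi, hi'⟩ := hf.exists_wire e _ hd'
    obtain ⟨j, hj, hj'⟩ := hg.exists_wire e _ hd'
    have hne : ∀ w, w ∈ Set.range e ∨ w ∈ Set.range ((Fin.succEmb l.length).trans p) →
        w ≠ p 0 := by
      rintro w (⟨a, rfl⟩ | ⟨a, rfl⟩)
      · exact hd a 0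
      · exact fun h => absurd (p.injective h) (Fin.succ_ne_zero a)
    have hi0 := hne i hi
    have hj0 := hne j hj
    refine ⟨xorOp (p 0) (fun s => toBit (φ (ofBit (s i)) (ofBit (s j)))) * F, ?_,
      mul_mem (xorOp_mem_unitary fun s b => by
        rw [Function.update_of_ne hi0, Function.update_of_ne hj0]) h2,
      h3.cons fun s t _ ht1 ht2 => ?_⟩
    · have := ((BlockImpl.xor₂ (n := n) (fun a b => toBit (φ (ofBit a) (ofBit b))) hi0 hj0).mul
        h1).mono le_rfl (show 10 + 10 * l.length ≤ 10 * (l.length + 1) by omega)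
      simpa using this
    · simp only [hi' s t ht1 ht2, hj' s t ht1 ht2, ofBit_toBit]

theorem BlockImpl.copies (S : Finset B) (tgt : B ↪ W) (src : B → W)
    (h : ∀ b b', src b ≠ tgt b') :
    ∃ C : QOp W, BlockImpl (n := n) 0 S.card (fun _ => C) ∧ ∀ s, ∃ t, C *ᵥ ket s = ket t ∧
      (∀ w, (∀ b ∈ S, w ≠ tgt b) → t w = s w) ∧
      ∀ b ∈ S, t (tgt b) = s (tgt b) + s (src b) := by
  induction S using Finset.induction_on with
  | empty => exact ⟨1, BlockImpl.one, fun s => ⟨s, Matrix.one_mulVec _, by simp, by simp⟩⟩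
  | insert b S hb ih =>
    obtain ⟨C, h1, h2⟩ := ih
    refine ⟨_, ((BlockImpl.cnot (n := n) (h b b)).mul h1).mono le_rfl ?_, fun s => ?_⟩
    · rw [Finset.card_insert_of_notMem hb]; omega
    · obtain ⟨t, h3, h4, h5⟩ := h2 s
      refine ⟨_, by rw [← Matrix.mulVec_mulVec, h3, xorOp_ket], fun w hw => ?_, fun c hc => ?_⟩
      · rw [Function.update_of_ne (hw b (Finset.mem_insert_self _ _)),
          h4 w fun c hc => hw c (Finset.mem_insert_of_mem hc)]
      · by_cases hcb : c = b
        · subst hcb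
          rw [Function.update_self, h4, h4]
          · exact fun b' _ => h _ _
          · rintro b' hb' h'
            exact hb (tgt.injective h' ▸ hb')
        · rw [Function.update_of_ne fun h' => hcb (tgt.injective h'),
            h5 c ((Finset.mem_insert.1 hc).resolve_left hcb)]

theorem blk_ket {F : QOp (W ⊕ A)} {s t : W → Fin 2}
    (h : F *ᵥ ket (Sum.elim s 0) = ket (Sum.elim t 0)) : blk F *ᵥ ket s = ket t := by
  rw [blk_mulVec_ket, h]
  ext u
  rw [ket_apply, ket_apply]
  congr 1
  exact propext (sumElim_injective (M := W) (A := A)).eq_iff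

/-- The operation that adds the values of the functions `f` of the bits `X` to the bits `B`. -/
def xorFun (f : B → BitFun X) : QOp (X ⊕ B) :=
  Matrix.of fun u s =>
    if u = Sum.elim (s ∘ Sum.inl) (fun b => s (Sum.inr b) + toBit (f b (s ∘ Sum.inl))) then 1 else 0

theorem xorFun_ket (f : B → BitFun X) (x : X → Fin 2) (y : B → Fin 2) :
    xorFun f *ᵥ ket (Sum.elim x y) = ket (Sum.elim x fun b => y b + toBit (f b x)) := by
  ext u
  rw [mulVec_ket_apply, ket_apply]; rfl

theorem sumElim_eta (s : X ⊕ B → Fin 2) : Sum.elim (s ∘ Sum.inl) (s ∘ Sum.inr) = s :=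
  Sum.elim_comp_inl_inr s

theorem BlockImpl.xorFun {l : List (BitFun X)} (hl : SLP l) {f : B → BitFun X}
    (hf : ∀ b, Avail l (f b)) :
    BlockImpl (n := n) 0 (21 * l.length + Fintype.card B) fun _ => xorFun f := by
  let e : X ↪ (X ⊕ B) ⊕ Fin l.length := Function.Embedding.inl.trans Function.Embedding.inl
  let p : Fin l.length ↪ (X ⊕ B) ⊕ Fin l.length := Function.Embedding.inr
  have hd : ∀ i j, e i ≠ p j := fun i j => by simp [e, p]
  obtain ⟨F, h1, h2, h3⟩ := hl.compile (n := n) e p hd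
  choose src hsrc hsrc' using fun b => (hf b).exists_wire e p hd
  obtain ⟨C, h4, h5⟩ := BlockImpl.copies (n := n) (Finset.univ : Finset B)
    (Function.Embedding.inr.trans Function.Embedding.inl) src (by
      intro b b' h
      rcases hsrc b with ⟨a, ha⟩ | ⟨a, ha⟩ <;> rw [h] at ha <;> simp [e, p] at ha)
  refine (((h1.adj.mul h4).mul h1).contract.mono le_rfl ?_).congr fun _ => ext_ket fun s => ?_
  · rw [Fintype.card_fin, Finset.card_univ]; omega
  · rw [← sumElim_eta s, xorFun_ket]
    generalize s ∘ Sum.inl = x, s ∘ Sum.inr = y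
    apply blk_ket
    obtain ⟨t, h6, h7, h8⟩ := h3 (Sum.elim (Sum.elim x y) 0) (by simp [p])
    obtain ⟨t', h9, h10, h11⟩ := h5 t
    obtain ⟨t'', h12, h13, h14⟩ := h3 (Sum.elim (Sum.elim x fun b => y b + toBit (f b x)) 0)
      (by simp [p])
    have hcomp : ∀ y : B → Fin 2, (Sum.elim (Sum.elim x y) (0 : Fin l.length → Fin 2)) ∘ e = x :=
      fun _ => rfl
    rw [hcomp] at h8 h14
    have : t' = t'' := by
      ext1 w
      rcases w with (i | b) | j
      · rw [h10 _ (by simp), h7 _ (by simp [p]), h13 _ (by simp [p])]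
        rfl
      · refine (h11 b (Finset.mem_univ b)).trans ?_
        rw [hsrc' b _ t h7 (by rw [hcomp]; exact h8), h13 _ (by simp [p])]
        rw [hcomp]
        simp only [Function.Embedding.trans_apply, Function.Embedding.inl_apply,
          Function.Embedding.inr_apply]
        rw [h7 _ (by simp [p])]
        simp
      · rw [h10 _ (by simp)]
        exact (h8 j).trans (h14 j).symm
    rw [← Matrix.mulVec_mulVec, ← Matrix.mulVec_mulVec, h6, h9, this]
    exact conjTranspose_mulVec_of_unitary h2 h12

end Boolean

/-! ## Diagonal blocks -/

section DiagonalBlocks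

variable {n : ℕ} {X B W : Type} [Fintype W] [DecidableEq W] [Fintype X] [DecidableEq X]
  [Fintype B] [DecidableEq B]

/-- The projection onto the inputs that `f` does not reject. -/
theorem BlockImpl.reject {l : List (BitFun X)} (hl : SLP l) {f : BitFun X} (hf : Avail l f) :
    BlockImpl (n := n) 0 (21 * l.length + 2) fun _ =>
      Matrix.diagonal fun x => if f x then 0 else 1 := by
  refine ((BlockImpl.xorFun (n := n) (B := Unit) hl (f := fun _ => f) fun _ => hf).contract.mono
    le_rfl (by simp)).congr fun _ => ext_ket fun s => ?_
  rw [blk_mulVec_ket, xorFun_ket, diagonal_mulVec_ket]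
  ext u
  rw [ket_apply, Pi.smul_apply, ket_apply]
  by_cases h : f s
  · simp only [h, if_true, zero_smul]
    rw [if_neg]
    intro h'
    have := congrFun h' (Sum.inr ())
    simp [toBit] at this
  · simp only [h, Bool.false_eq_true, if_false, smul_eq_mul, one_mul]
    congr 1
    apply propext
    rw [← (sumElim_injective (M := X) (A := Unit)).eq_iff]
    simp [toBit]
    rfl

/-- The sign flip of the inputs that `f` accepts. -/
theorem BlockImpl.phaseFlip {l : List (BitFun X)} (hl : SLP l) {f : BitFun X} (hf : Avail l f) :
    BlockImpl (n := n) 0 (42 * l.length + 4) fun _ =>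
      Matrix.diagonal fun x => if f x then -1 else 1 := by
  have hz : (!![1, 0; 0, -1] : Matrix (Fin 2) (Fin 2) ℂ) * !![1, 0; 0, -1]ᴴ = 1 := by
    ext i j
    fin_cases i <;> fin_cases j <;> simp [Matrix.mul_apply, Matrix.conjTranspose_apply]
  have hx := BlockImpl.xorFun (n := n) (B := Unit) hl (f := fun _ => f) fun _ => hf
  refine (((hx.mul (BlockImpl.on1 hz (Sum.inr ()))).mul hx).contract.mono
    le_rfl (by simp; omega)).congr fun _ => ext_ket fun s => ?_
  rw [blk_mulVec_ket, ← Matrix.mulVec_mulVec, ← Matrix.mulVec_mulVec, xorFun_ket, on1_mulVec_ket,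
    diagonal_mulVec_ket]
  have hu : ∀ y b, Function.update (Sum.elim s y : X ⊕ Unit → Fin 2) (Sum.inr ()) b =
      Sum.elim s fun _ => b := by
    intro y b; ext1 i; rcases i with i | i <;> simp
  simp only [Fin.sum_univ_two, hu, Matrix.mulVec_add, Matrix.mulVec_smul, xorFun_ket]
  ext u
  simp only [Pi.add_apply, Pi.smul_apply, ket_apply, smul_eq_mul]
  have hinj : ∀ y : Fin 2, ((Sum.elim u 0 : X ⊕ Unit → Fin 2) = Sum.elim s fun _ => y) ↔
      u = s ∧ y = 0 := by
    intro y
    constructor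
    · intro h
      exact ⟨funext fun i => congrFun h (Sum.inl i), (congrFun h (Sum.inr ())).symm⟩
    · rintro ⟨rfl, rfl⟩; rfl
  simp only [hinj]
  by_cases h : f s <;> by_cases h' : u = s <;> simp [h, h', toBit]

/-- Hadamard gates on the wires in `S`. -/
def hadOn (S : Finset W) : QOp W :=
  Matrix.of fun u s => if ∀ i, i ∉ S → u i = s i then ∏ i ∈ S, hadM (u i) (s i) else 0

theorem BlockImpl.hadOn (S : Finset W) : BlockImpl (n := n) 0 S.card fun _ => hadOn S := by
  induction S using Finset.induction_on with
  | empty =>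
    refine BlockImpl.one.congr fun _ => ?_
    ext u s
    simp [_root_.hadOn, Matrix.one_apply, funext_iff]
  | insert w S hw ih =>
    refine (ih.mul (BlockImpl.had w)).mono le_rfl (by rw [Finset.card_insert_of_notMem hw])
      |>.congr fun _ => ext_ket fun s => ?_
    rw [← Matrix.mulVec_mulVec, on1_mulVec_ket, Matrix.mulVec_sum]
    ext u
    simp only [Matrix.mulVec_smul, Finset.sum_apply, Pi.smul_apply, mulVec_ket_apply, smul_eq_mul,
      _root_.hadOn, Matrix.of_apply]
    rw [Finset.sum_eq_single (u w)]
    · rw [Finset.prod_insert hw]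
      have hp : ∏ i ∈ S, hadM (u i) (Function.update s w (u w) i) = ∏ i ∈ S, hadM (u i) (s i) :=
        Finset.prod_congr rfl fun i hi => by
          rw [Function.update_of_ne]; rintro rfl; exact hw hi
      rw [hp, mul_ite, mul_zero]
      congr 1
      apply propext
      constructor
      · intro h i hi
        rw [Finset.mem_insert, not_or] at hi
        rw [h i hi.2, Function.update_of_ne hi.1]
      · intro h i hi
        by_cases hiw : i = w
        · subst hiw; rw [Function.update_self]
        · rw [Function.update_of_ne hiw]
          exact h i (by rw [Finset.mem_insert, not_or]; exact ⟨hiw, hi⟩)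
    · intro b _ hb
      rw [if_neg, mul_zero]
      intro h
      have := h w hw
      rw [Function.update_self] at this
      exact hb this.symm
    · simp

theorem hadM_zero_right (a : Fin 2) : hadM a 0 = ((1 / √2 : ℝ) : ℂ) := by
  fin_cases a <;> simp [hadM]

theorem hadM_zero_left (a : Fin 2) : hadM 0 a = ((1 / √2 : ℝ) : ℂ) := by
  fin_cases a <;> simp [hadM]

theorem hadOn_univ_ket_zero :
    hadOn (Finset.univ : Finset W) *ᵥ ket 0 =
      ∑ z : W → Fin 2, (((1 / √2 : ℝ) : ℂ) ^ Fintype.card W) • ket z := by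
  ext u
  rw [mulVec_ket_apply]
  simp [hadOn, hadM_zero_right, ket_apply]

theorem hadOn_univ_zero_apply (z : W → Fin 2) :
    hadOn (Finset.univ : Finset W) 0 z = ((1 / √2 : ℝ) : ℂ) ^ Fintype.card W := by
  simp [hadOn, hadM_zero_left]

theorem extend_inr (x : X → Fin 2) (y z : B → Fin 2) :
    Function.extend (Function.Embedding.inr : B ↪ X ⊕ B) z (Sum.elim x y) = Sum.elim x z := by
  symm
  apply eq_extend (Function.Embedding.inr : B ↪ X ⊕ B)
  · rfl
  · rintro (i | i) hi
    · rfl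
    · exact absurd ⟨i, rfl⟩ hi

/-- The probability with which `f` does not reject, over uniformly random bits `B`. -/
theorem BlockImpl.probability {l : List (BitFun (X ⊕ B))} (hl : SLP l) {f : BitFun (X ⊕ B)}
    (hf : Avail l f) :
    BlockImpl (n := n) 0 (21 * l.length + 2 + 3 * Fintype.card B) fun _ =>
      Matrix.diagonal fun x =>
        ((Finset.univ.filter fun z : B → Fin 2 => f (Sum.elim x z) = false).card : ℂ) /
          2 ^ Fintype.card B := by
  have hh := (BlockImpl.hadOn (n := n) (Finset.univ : Finset B)).lift
    (Function.Embedding.inr : B ↪ X ⊕ B)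
  rw [Finset.card_univ] at hh
  refine (((hh.mul (BlockImpl.reject hl hf)).mul hh).contract.mono le_rfl (by omega)).congr
    fun _ => ext_ket fun s => ?_
  rw [blk_mulVec_ket, diagonal_mulVec_ket]
  simp only [← Matrix.mulVec_mulVec]
  have hs : ∀ z : B → Fin 2, (Sum.elim s z : X ⊕ B → Fin 2) ∘ (Function.Embedding.inr : B ↪ X ⊕ B)
      = z := fun _ => rfl
  rw [onW_mulVec_ket, hs, hadOn_univ_ket_zero]
  simp only [map_sum, map_smul, insertState_ket, extend_inr, Matrix.mulVec_sum, Matrix.mulVec_smul,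
    diagonal_mulVec_ket, onW_mulVec_ket, hs]
  ext u
  simp only [Finset.sum_apply, Pi.smul_apply, smul_eq_mul]
  have h1 : ∀ z : B → Fin 2, insertState (Function.Embedding.inr : B ↪ X ⊕ B) (Sum.elim s z)
      (_root_.hadOn Finset.univ *ᵥ ket z) (Sum.elim u 0) =
      if u = s then ((1 / √2 : ℝ) : ℂ) ^ Fintype.card B else 0 := by
    intro z
    split_ifs with h
    · subst h
      rw [insertState_apply]
      · rw [mulVec_ket_apply]
        exact hadOn_univ_zero_apply z
      · rintro (i | i) hi
        · rfl
        · exact absurd ⟨i, rfl⟩ hi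
    · rw [insertState_apply_zero]
      intro h'
      refine h (funext fun i => h' (Sum.inl i) ?_)
      rintro ⟨j, hj⟩; simp at hj
  simp only [h1, ket_apply]
  by_cases h : u = s
  · simp only [h, if_true, mul_one]
    have h2 : ((1 / √2 : ℝ) : ℂ) ^ Fintype.card B * ((1 / √2 : ℝ) : ℂ) ^ Fintype.card B =
        1 / 2 ^ Fintype.card B := by
      rw [← mul_pow, sqrt_two_inv_sq, div_pow, one_pow]
    generalize ((1 / √2 : ℝ) : ℂ) ^ Fintype.card B = c at h2
    rw [Finset.card_filter]
    push_cast
    rw [Finset.sum_div]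
    refine Finset.sum_congr rfl fun z _ => ?_
    rw [mul_left_comm, h2]
    by_cases hf : f (Sum.elim s z) <;> simp [hf]
  · simp [h]

theorem BlockImpl.scalar {μ : ℝ} (h0 : 0 ≤ μ) (h1 : μ ≤ 1) :
    BlockImpl (n := n) (M := W) 0 2 fun _ => (μ : ℂ) • 1 := by
  have hs : ((√(1 - μ ^ 2) : ℝ) : ℂ) * ((√(1 - μ ^ 2) : ℝ) : ℂ) = 1 - (μ : ℂ) ^ 2 := by
    rw [← Complex.ofReal_mul, Real.mul_self_sqrt (by nlinarith)]
    push_cast; ring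
  have hR : (!![(μ : ℂ), -((√(1 - μ ^ 2) : ℝ) : ℂ); ((√(1 - μ ^ 2) : ℝ) : ℂ), (μ : ℂ)]) *
      !![(μ : ℂ), -((√(1 - μ ^ 2) : ℝ) : ℂ); ((√(1 - μ ^ 2) : ℝ) : ℂ), (μ : ℂ)]ᴴ = 1 := by
    ext i j
    fin_cases i <;> fin_cases j <;>
      simp [Matrix.mul_apply, Matrix.conjTranspose_apply, -Complex.ofReal_sub, hs] <;> ring
  refine ((BlockImpl.on1 (n := n) hR (Sum.inr () : W ⊕ Unit)).contract.mono le_rfl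
    (by simp)).congr fun _ => ext_ket fun s => ?_
  rw [blk_mulVec_ket, on1_mulVec_ket, Matrix.smul_mulVec, Matrix.one_mulVec]
  have hu : ∀ b, Function.update (Sum.elim s 0 : W ⊕ Unit → Fin 2) (Sum.inr ()) b =
      Sum.elim s fun _ => b := by
    intro b; ext1 i; rcases i with i | i <;> simp
  have hinj : ∀ (u : W → Fin 2) (y : Fin 2),
      ((Sum.elim u 0 : W ⊕ Unit → Fin 2) = Sum.elim s fun _ => y) ↔ u = s ∧ y = 0 := by
    intro u y
    constructor
    · intro h
      exact ⟨funext fun i => congrFun h (Sum.inl i), (congrFun h (Sum.inr ())).symm⟩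
    · rintro ⟨rfl, rfl⟩; rfl
  ext u
  simp only [Fin.sum_univ_two, hu, Pi.add_apply, Pi.smul_apply, ket_apply, smul_eq_mul, hinj]
  by_cases h' : u = s <;> simp [h']

end DiagonalBlocks

/-! ## Arithmetic by straight-line programs -/

section Arithmetic

variable {X B : Type} {w : ℕ}

/-- The program `l` can be extended by at most `c` steps to a program with the property `P`. -/
def Extends (l : List (BitFun X)) (c : ℕ) (P : List (BitFun X) → Prop) : Prop :=
  ∃ l', SLP l' ∧ (∀ f, Avail l f → Avail l' f) ∧ l'.length ≤ l.length + c ∧ P l'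

theorem Extends.mono {l : List (BitFun X)} {c c' : ℕ} {P P' : List (BitFun X) → Prop}
    (h : Extends l c P) (hc : c ≤ c')
    (hP : ∀ l', (∀ f, Avail l f → Avail l' f) → P l' → P' l') : Extends l c' P' := by
  obtain ⟨l', h1, h2, h3, h4⟩ := h
  exact ⟨l', h1, h2, by omega, hP l' h2 h4⟩

theorem Extends.refl {l : List (BitFun X)} (hl : SLP l) {P : List (BitFun X) → Prop} (h : P l) :
    Extends l 0 P := ⟨l, hl, fun _ => id, le_rfl, h⟩

theorem Extends.bind {l : List (BitFun X)} {c c' : ℕ} {P P' : List (BitFun X) → Prop}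
    (h : Extends l c P) (h' : ∀ l', SLP l' → (∀ f, Avail l f → Avail l' f) → P l' → Extends l' c' P') :
    Extends l (c + c') P' := by
  obtain ⟨l', h1, h2, h3, h4⟩ := h
  obtain ⟨l'', h5, h6, h7, h8⟩ := h' l' h1 h2 h4
  exact ⟨l'', h5, fun f hf => h6 f (h2 f hf), by omega, h8⟩

theorem Avail.head (f : BitFun X) (l : List (BitFun X)) : Avail (f :: l) f :=
  Or.inr List.mem_cons_self

theorem Avail.tail {f g : BitFun X} {l : List (BitFun X)} (h : Avail l f) : Avail (g :: l) f :=
  h.imp id (List.mem_cons_of_mem _)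

theorem Avail.input (l : List (BitFun X)) (i : X) : Avail l fun x => ofBit (x i) :=
  Or.inl ⟨i, rfl⟩

theorem ext_const {l : List (BitFun X)} (hl : SLP l) (c : Bool) :
    Extends l 1 fun l' => Avail l' fun _ => c :=
  ⟨_, hl.const c, fun _ => Avail.tail, le_rfl, Avail.head _ _⟩

theorem ext_op₂ {l : List (BitFun X)} (hl : SLP l) (φ : Bool → Bool → Bool) {f g : BitFun X}
    (hf : Avail l f) (hg : Avail l g) : Extends l 1 fun l' => Avail l' fun x => φ (f x) (g x) :=
  ⟨_, hl.cons φ hf hg, fun _ => Avail.tail, le_rfl, Avail.head _ _⟩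

theorem ext_op₃ {l : List (BitFun X)} (hl : SLP l) (φ : Bool → Bool → Bool → Bool)
    {f g h : BitFun X} (hf : Avail l f) (hg : Avail l g) (hh : Avail l h) :
    Extends l 5 fun l' => Avail l' fun x => φ (f x) (g x) (h x) := by
  refine ((ext_op₂ hl (fun a b => φ a b true) hf hg).bind fun l₁ h₁ m₁ a₁ =>
    (ext_op₂ h₁ (fun a b => φ a b false) (m₁ _ hf) (m₁ _ hg)).bind fun l₂ h₂ m₂ a₂ =>
    (ext_op₂ h₂ (fun c p => c && p) (m₂ _ (m₁ _ hh)) (m₂ _ a₁)).bind fun l₃ h₃ m₃ a₃ =>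
    (ext_op₂ h₃ (fun c p => !c && p) (m₃ _ (m₂ _ (m₁ _ hh))) (m₃ _ a₂)).bind fun l₄ h₄ m₄ a₄ =>
    ext_op₂ h₄ (fun c p => c || p) (m₄ _ a₃) a₄).mono le_rfl fun l' _ h' => ?_
  convert h' using 1
  ext1 x
  generalize f x = a, g x = b, h x = c
  cases c <;> simp

theorem ext_family {l : List (BitFun X)} (hl : SLP l) {c : ℕ} {f : ℕ → BitFun X} (k : ℕ)
    (h : ∀ i < k, ∀ l', SLP l' → (∀ f, Avail l f → Avail l' f) →
      (∀ j < i, Avail l' (f j)) → Extends l' c fun l'' => Avail l'' (f i)) :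
    Extends l (c * k) fun l' => ∀ i < k, Avail l' (f i) := by
  induction k with
  | zero => exact Extends.refl hl (by simp)
  | succ k ih =>
    refine ((ih fun i hi => h i (by omega)).bind fun l₁ h₁ m₁ a₁ =>
      (h k (by omega) l₁ h₁ m₁ a₁).mono le_rfl (P' := fun l' => ∀ i < k + 1, Avail l' (f i))
        fun l' hm h' i hi => ?_).mono
        (by rw [mul_add]; omega) fun _ _ => id
    rcases Nat.lt_succ_iff_lt_or_eq.1 hi with hi | rfl
    · exact hm _ (a₁ i hi)
    · exact h'

theorem ext_fintype [Fintype B] {l : List (BitFun X)} (hl : SLP l) {c : ℕ} {f : B → BitFun X}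
    (h : ∀ b, ∀ l', SLP l' → (∀ f, Avail l f → Avail l' f) → Extends l' c fun l'' => Avail l'' (f b)) :
    Extends l (c * Fintype.card B) fun l' => ∀ b, Avail l' (f b) := by
  classical
  have key : ∀ S : Finset B, Extends l (c * S.card) fun l' => ∀ b ∈ S, Avail l' (f b) := by
    intro S
    induction S using Finset.induction_on with
    | empty => exact Extends.refl hl (by simp)
    | insert b S hb ih =>
      refine (ih.bind fun l₁ h₁ m₁ a₁ => (h b l₁ h₁ m₁).mono le_rfl
        (P' := fun l' => ∀ i ∈ insert b S, Avail l' (f i)) fun l' hm h' i hi => ?_).mono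
          (by rw [Finset.card_insert_of_notMem hb, mul_add]; omega) fun _ _ => id
      rcases Finset.mem_insert.1 hi with rfl | hi
      · exact h'
      · exact hm _ (a₁ i hi)
  exact (key Finset.univ).mono le_rfl fun l' _ h b => h b (Finset.mem_univ b)

/-- All bits of `F` are available. -/
def BVAvail (l : List (BitFun X)) (F : (X → Fin 2) → BitVec w) : Prop :=
  ∀ i, Avail l fun x => (F x).getLsbD i

theorem BVAvail.mono {l l' : List (BitFun X)} {F : (X → Fin 2) → BitVec w} (h : BVAvail l F)
    (hl : ∀ f, Avail l f → Avail l' f) : BVAvail l' F := fun i => hl _ (h i)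

theorem BVAvail.const_false {l : List (BitFun X)} {F : (X → Fin 2) → BitVec w} (h : BVAvail l F) :
    Avail l fun _ => false := by
  have := h w
  simpa using this

theorem ext_bitVec {l : List (BitFun X)} (hl : SLP l) (h0 : Avail l fun _ => false) {c : ℕ}
    {F : (X → Fin 2) → BitVec w}
    (h : ∀ i < w, ∀ l', SLP l' → (∀ f, Avail l f → Avail l' f) →
      Extends l' c fun l'' => Avail l'' fun x => (F x).getLsbD i) :
    Extends l (c * w) fun l' => BVAvail l' F := by
  refine (ext_family hl (f := fun i x => (F x).getLsbD i) w
    fun i hi l' hl' hm _ => h i hi l' hl' hm).mono le_rfl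
    fun l' hm h i => ?_
  by_cases hi : i < w
  · exact h i hi
  · have : (fun x => (F x).getLsbD i) = fun _ => false := by
      ext1 x; exact BitVec.getLsbD_of_ge _ _ (by omega)
    rw [this]
    exact hm _ h0

theorem ext_carry {l : List (BitFun X)} (hl : SLP l) {F G : (X → Fin 2) → BitVec w}
    (hF : BVAvail l F) (hG : BVAvail l G) (c : Bool) (k : ℕ) :
    Extends l (5 * k) fun l' => ∀ i < k, Avail l' fun x => BitVec.carry i (F x) (G x) c := by
  refine ext_family hl k fun i hi l' hl' hm hj => ?_
  rcases i with _ | i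
  · refine (ext_const hl' c).mono (by omega) fun l'' _ h => ?_
    simpa using h
  · refine (ext_op₃ hl' Bool.atLeastTwo (hm _ (hF i)) (hm _ (hG i)) (hj i (by omega))).mono le_rfl
      fun l'' _ h => ?_
    simpa only [BitVec.carry_succ] using h

theorem ext_add {l : List (BitFun X)} (hl : SLP l) {F G : (X → Fin 2) → BitVec w}
    (hF : BVAvail l F) (hG : BVAvail l G) :
    Extends l (10 * w) fun l' => BVAvail l' fun x => F x + G x := by
  refine ((ext_carry hl hF hG false w).bind fun l₁ h₁ m₁ a₁ =>
    ext_bitVec h₁ (m₁ _ hF.const_false) (c := 5) fun i hi l' hl' hm => ?_).mono (by omega)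
    fun _ _ => id
  refine (ext_op₃ hl' (fun a b c => a ^^ (b ^^ c)) (hm _ (m₁ _ (hF i))) (hm _ (m₁ _ (hG i)))
    (hm _ (a₁ i hi))).mono le_rfl fun l'' _ h => ?_
  simpa only [BitVec.getLsbD_add hi] using h

theorem ext_mulRec {l : List (BitFun X)} (hl : SLP l) {F G : (X → Fin 2) → BitVec w}
    (hF : BVAvail l F) (hG : BVAvail l G) (s : ℕ) :
    Extends l (11 * w * (s + 1)) fun l' => BVAvail l' fun x => BitVec.mulRec (F x) (G x) s := by
  have hrow : ∀ s l', SLP l' → (∀ f, Avail l f → Avail l' f) →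
      Extends l' (1 * w) fun l'' => BVAvail l'' fun x =>
        if (G x).getLsbD s then (F x) <<< s else 0 := by
    intro s l' hl' hm
    refine ext_bitVec hl' (hm _ hF.const_false) fun i hi l₂ h₂ m₂ => ?_
    refine (ext_op₂ h₂ (fun a b => a && (!decide (i < s) && b)) (m₂ _ (hm _ (hG s)))
      (m₂ _ (hm _ (hF (i - s))))).mono le_rfl fun l'' _ h => ?_
    convert h using 1
    ext1 x
    by_cases hg : (G x).getLsbD s
    · simp only [hg, if_true, BitVec.getLsbD_shiftLeft, hi, decide_true, Bool.true_and]
    · simp [hg]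
  induction s with
  | zero =>
    refine (hrow 0 l hl fun _ => id).mono (by nlinarith) fun l' _ h => ?_
    simpa only [BitVec.mulRec_zero_eq, BitVec.shiftLeft_zero] using h
  | succ s ih =>
    refine (ih.bind fun l₁ h₁ m₁ a₁ => (hrow (s + 1) l₁ h₁ m₁).bind fun l₂ h₂ m₂ a₂ =>
      ext_add h₂ (a₁.mono m₂) a₂).mono (by nlinarith) fun l' _ h => ?_
    simpa only [BitVec.mulRec_succ_eq] using h

theorem ext_mul {l : List (BitFun X)} (hl : SLP l) {F G : (X → Fin 2) → BitVec w}
    (hF : BVAvail l F) (hG : BVAvail l G) :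
    Extends l (11 * w * (w + 1)) fun l' => BVAvail l' fun x => F x * G x := by
  refine (ext_mulRec hl hF hG w).mono le_rfl fun l' _ h => ?_
  simpa only [BitVec.mul_eq_mulRec] using h

theorem ext_ult {l : List (BitFun X)} (hl : SLP l) {F G : (X → Fin 2) → BitVec w}
    (hF : BVAvail l F) (hG : BVAvail l G) :
    Extends l (6 * w + 6) fun l' => Avail l' fun x => (F x).ult (G x) := by
  refine ((ext_bitVec hl hF.const_false (c := 1) (F := fun x => ~~~(G x))
    fun i hi l' hl' hm => ?_).bind fun l₁ h₁ m₁ a₁ =>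
    (ext_carry h₁ (hF.mono m₁) a₁ true (w + 1)).bind fun l₂ h₂ m₂ a₂ =>
    ext_op₂ h₂ (fun a _ => !a) (a₂ w (by omega)) (a₂ w (by omega))).mono (by omega)
    fun l' _ h => ?_
  · refine (ext_op₂ hl' (fun a _ => !a) (hm _ (hG i)) (hm _ (hG i))).mono le_rfl fun l'' _ h => ?_
    simpa [BitVec.getLsbD_not, hi] using h
  · simpa only [BitVec.ult_eq_not_carry] using h

/-- The number with binary digits `y`, lowest first. -/
def bitVecOf {k : ℕ} (y : Fin k → Fin 2) : BitVec k := BitVec.ofFnLE fun i => ofBit (y i)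

theorem getLsbD_bitVecOf {k : ℕ} (y : Fin k → Fin 2) (i : ℕ) :
    (bitVecOf y).getLsbD i = if h : i < k then ofBit (y ⟨i, h⟩) else false :=
  BitVec.getLsbD_ofFnLE _ _

theorem avail_bitVecOf {k : ℕ} {l : List (BitFun X)} (h0 : Avail l fun _ => false)
    (e : Fin k → X) : BVAvail l fun x => bitVecOf (x ∘ e) := by
  intro i
  simp only [getLsbD_bitVecOf]
  by_cases h : i < k
  · simp only [h, dif_pos]
    exact Avail.input _ _
  · simpa only [h, dif_neg, not_false_eq_true] using h0

theorem BVAvail.setWidth {l : List (BitFun X)} {F : (X → Fin 2) → BitVec w} (h : BVAvail l F)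
    (w' : ℕ) : BVAvail l fun x => (F x).setWidth w' := by
  intro i
  simp only [BitVec.getLsbD_setWidth]
  by_cases hi : i < w'
  · simpa [hi] using h i
  · simpa [hi] using h.const_false

theorem ext_ite {l : List (BitFun X)} (hl : SLP l) {F G : (X → Fin 2) → BitVec w} {f : BitFun X}
    (hf : Avail l f) (hF : BVAvail l F) (hG : BVAvail l G) :
    Extends l (5 * w) fun l' => BVAvail l' fun x => if f x then F x else G x := by
  refine ext_bitVec hl hF.const_false fun i hi l' hl' hm => ?_
  refine (ext_op₃ hl' (fun a b c => if a then b else c) (hm _ hf) (hm _ (hF i))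
    (hm _ (hG i))).mono le_rfl fun l'' _ h => ?_
  convert h using 1
  ext1 x
  split_ifs <;> rfl

theorem ext_nil_const : Extends ([] : List (BitFun X)) 2 fun l =>
    (Avail l fun _ => false) ∧ Avail l fun _ => true := by
  refine ((ext_const SLP.nil false).bind fun l₁ h₁ m₁ a₁ => (ext_const h₁ true).mono le_rfl
    fun l' m h => ⟨m _ a₁, h⟩)

theorem BVAvail.const {l : List (BitFun X)} (h0 : Avail l fun _ => false)
    (h1 : Avail l fun _ => true) (b : BitVec w) : BVAvail l fun _ => b := by
  intro i
  by_cases h : b.getLsbD i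
  · simpa only [h] using h1
  · simpa only [h] using h0

theorem exists_slp_threshold {k : ℕ} (a : X) (e : Fin k → X) (b b' : BitVec k) :
    ∃ l, SLP l ∧ l.length ≤ 11 * k + 8 ∧
      Avail l fun x => (if ofBit (x a) then b else b').ult (bitVecOf (x ∘ e)) := by
  obtain ⟨l, h1, -, h3, h4⟩ := (ext_nil_const (X := X)).bind fun l₁ h₁ m₁ a₁ =>
    (ext_ite h₁ (Avail.input _ a) (BVAvail.const a₁.1 a₁.2 b) (BVAvail.const a₁.1 a₁.2 b')).bind
      fun l₂ h₂ m₂ a₂ => ext_ult h₂ a₂ (avail_bitVecOf (m₂ _ a₁.1) e)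
  exact ⟨l, h1, by simp at h3; omega, h4⟩

theorem exists_slp_compare {k : ℕ} (a : X) (e e' : Fin k → X) :
    ∃ l, SLP l ∧ l.length ≤ 6 * k + 9 ∧
      Avail l fun x => ofBit (x a) && (bitVecOf (x ∘ e)).ult (bitVecOf (x ∘ e')) := by
  obtain ⟨l, h1, -, h3, h4⟩ := (ext_nil_const (X := X)).bind fun l₁ h₁ m₁ a₁ =>
    (ext_ult h₁ (avail_bitVecOf a₁.1 e) (avail_bitVecOf a₁.1 e')).bind fun l₂ h₂ m₂ a₂ =>
      ext_op₂ h₂ (fun a b => a && b) (Avail.input _ a) a₂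
  exact ⟨l, h1, by simp at h3; omega, h4⟩

theorem exists_slp_square {m : ℕ} (a : X) (z : Fin m → X) (y y' : Fin (2 * m) → X) :
    ∃ l, SLP l ∧ l.length ≤ 44 * m ^ 2 + 44 * m + 9 ∧
      Avail l fun x => !(((bitVecOf (x ∘ z)).setWidth (2 * m) *
        (bitVecOf (x ∘ z)).setWidth (2 * m)).ult
          (if ofBit (x a) then bitVecOf (x ∘ y) else bitVecOf (x ∘ y'))) := by
  obtain ⟨l, h1, -, h3, h4⟩ := (ext_nil_const (X := X)).bind fun l₁ h₁ m₁ a₁ =>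
    (ext_mul h₁ ((avail_bitVecOf a₁.1 z).setWidth (2 * m))
      ((avail_bitVecOf a₁.1 z).setWidth (2 * m))).bind fun l₂ h₂ m₂ a₂ =>
    (ext_ite h₂ (Avail.input _ a) (avail_bitVecOf (m₂ _ a₁.1) y)
      (avail_bitVecOf (m₂ _ a₁.1) y')).bind fun l₃ h₃ m₃ a₃ =>
    (ext_ult h₃ (a₂.mono m₃) a₃).bind fun l₄ h₄ m₄ a₄ =>
      ext_op₂ h₄ (fun a _ => !a) a₄ a₄
  exact ⟨l, h1, by simp at h3; nlinarith, h4⟩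

theorem exists_slp_binary [Fintype B] (φ : Bool → Bool → Bool) (i j : B → X) :
    ∃ l, SLP l ∧ l.length ≤ Fintype.card B ∧
      ∀ b, Avail l fun x => φ (ofBit (x (i b))) (ofBit (x (j b))) := by
  obtain ⟨l, h1, -, h3, h4⟩ := ext_fintype (B := B) (X := X) SLP.nil (c := 1)
    (f := fun b x => φ (ofBit (x (i b))) (ofBit (x (j b))))
    fun b l' hl' hm => ext_op₂ hl' φ (Avail.input _ _) (Avail.input _ _)
  exact ⟨l, h1, by simpa using h3, h4⟩

theorem exists_slp_zero (S : Finset X) (c : Bool) :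
    ∃ l, SLP l ∧ l.length ≤ S.card + 2 ∧
      Avail l fun x => decide (∀ i ∈ S, x i = 0) ^^ c := by
  classical
  have key : Extends ([] : List (BitFun X)) (S.card + 1) fun l =>
      Avail l fun x => decide (∀ i ∈ S, x i = 0) := by
    induction S using Finset.induction_on with
    | empty =>
      refine (ext_const SLP.nil true).mono (by simp) fun l _ h => ?_
      simpa using h
    | insert i S hi ih =>
      refine (ih.bind fun l₁ h₁ m₁ a₁ =>
        ext_op₂ h₁ (fun a b => !a && b) (Avail.input _ i) a₁).mono
        (by rw [Finset.card_insert_of_notMem hi]) fun l' _ h => ?_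
      convert h using 1
      ext1 x
      rw [Bool.eq_iff_iff]
      simp only [Finset.forall_mem_insert, decide_eq_true_eq, Bool.and_eq_true, ofBit,
        Bool.not_eq_true', decide_eq_false_iff_not]
      generalize x i = a
      fin_cases a <;> simp
  obtain ⟨l, h1, -, h3, h4⟩ := key.bind fun l₁ h₁ m₁ a₁ =>
    ext_op₂ h₁ (fun a _ => a ^^ c) a₁ a₁
  exact ⟨l, h1, by simp at h3; omega, h4⟩

end Arithmetic

/-! ## Encodings of numbers -/

section Encoding

theorem ofBit_bits (n j : ℕ) (i : Fin n) : ofBit (bits n j i) = j.testBit i := by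
  rw [Nat.testBit_eq_decide_div_mod_eq, ofBit, bits]
  congr 1
  apply propext
  rw [Fin.ext_iff]
  simp [Fin.ofNat]

theorem toNat_bitVecOf_bits {n j : ℕ} (hj : j < 2 ^ n) : (bitVecOf (bits n j)).toNat = j := by
  rw [bitVecOf, BitVec.toNat_ofFnLE]
  simp only [ofBit_bits]
  rw [Nat.ofBits_testBit, Nat.mod_eq_of_lt hj]

theorem bits_toNat_bitVecOf {n : ℕ} (x : Fin n → Fin 2) : bits n (bitVecOf x).toNat = x := by
  ext1 i
  have h : ofBit (bits n (bitVecOf x).toNat i) = ofBit (x i) := by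
    rw [ofBit_bits, BitVec.testBit_toNat, getLsbD_bitVecOf]
    simp
  rw [← toBit_ofBit (bits n (bitVecOf x).toNat i), h, toBit_ofBit]

theorem bits_inj {n j k : ℕ} (hj : j < 2 ^ n) (hk : k < 2 ^ n) : bits n j = bits n k ↔ j = k := by
  constructor
  · intro h
    rw [← toNat_bitVecOf_bits hj, h, toNat_bitVecOf_bits hk]
  · rintro rfl; rfl

/-- Bit strings as numbers. -/
def bitsEquiv (n : ℕ) : (Fin n → Fin 2) ≃ Fin (2 ^ n) where
  toFun x := ⟨(bitVecOf x).toNat, (bitVecOf x).isLt⟩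
  invFun j := bits n j
  left_inv x := bits_toNat_bitVecOf x
  right_inv j := Fin.ext (toNat_bitVecOf_bits j.2)

theorem bits_zero (n : ℕ) : bits n 0 = fun _ => 0 := by
  ext1 i; simp [bits]

theorem bits_apply_of_lt {k j i : ℕ} (hj : j < 2 ^ k) (hi : k ≤ i) :
    Fin.ofNat 2 (j / 2 ^ i) = 0 := by
  rw [Nat.div_eq_of_lt (hj.trans_le (Nat.pow_le_pow_right (by norm_num) hi))]
  rfl

/-- The number whose binary expansion consists of the first `r` digits `c`, highest first. -/
def leadingDigits (r : ℕ) (c : ℕ → Fin 2) : ℕ := (bitVecOf fun i : Fin r => c (Fin.rev i)).toNat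

theorem leadingDigits_succ (r : ℕ) (c : ℕ → Fin 2) :
    leadingDigits (r + 1) c = 2 * leadingDigits r c + (c r : ℕ) := by
  simp only [leadingDigits, bitVecOf, BitVec.toNat_ofFnLE, Nat.ofBits_succ]
  congr 2
  · congr 1
    ext1 i
    simp only [Function.comp_apply]
    refine congrArg (fun k => ofBit (c k)) ?_
    rw [Fin.val_rev, Fin.val_rev, Fin.val_succ]; omega
  · rw [Fin.val_rev]
    simp only [Fin.val_zero, zero_add, Nat.add_sub_cancel]
    generalize c r = a
    fin_cases a <;> rfl

theorem leadingDigits_lt (r : ℕ) (c : ℕ → Fin 2) : leadingDigits r c < 2 ^ r := BitVec.isLt _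

theorem leadingDigits_div (r : ℕ) (c : ℕ → Fin 2) :
    (leadingDigits r c : ℝ) / 2 ^ r = ∑ i ∈ Finset.range r, Real.ofDigitsTerm c i := by
  induction r with
  | zero =>
    rw [show leadingDigits 0 c = 0 from Nat.lt_one_iff.1 (leadingDigits_lt 0 c)]
    simp
  | succ r ih =>
    rw [Finset.sum_range_succ, ← ih, leadingDigits_succ, Real.ofDigitsTerm]
    push_cast
    field_simp
    ring

theorem leadingDigits_approx (r : ℕ) (c : ℕ → Fin 2) :
    (leadingDigits r c : ℝ) / 2 ^ r ≤ Real.ofDigits c ∧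
      Real.ofDigits c ≤ (leadingDigits r c : ℝ) / 2 ^ r + (2 ^ r)⁻¹ := by
  have h := Real.ofDigits_eq_sum_add_ofDigits c r
  have h0 := Real.ofDigits_nonneg fun i => c (i + r)
  have h1 := Real.ofDigits_le_one fun i => c (i + r)
  rw [← leadingDigits_div] at h
  have hp : (0 : ℝ) < (2 ^ r)⁻¹ := by positivity
  push_cast at h
  constructor <;> rw [h] <;> nlinarith

/-- Whether the square of the number `z` is at least the number `y`. -/
def squareTest {m : ℕ} (z : Fin m → Fin 2) (y : Fin (2 * m) → Fin 2) : Bool :=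
  !(((bitVecOf z).setWidth (2 * m) * (bitVecOf z).setWidth (2 * m)).ult (bitVecOf y))

theorem squareTest_eq_false {m : ℕ} (z : Fin m → Fin 2) (y : Fin (2 * m) → Fin 2) :
    squareTest z y = false ↔ (bitVecOf z).toNat ^ 2 < (bitVecOf y).toNat := by
  have hz := (bitVecOf z).isLt
  have h2 : (2 : ℕ) ^ (2 * m) = 2 ^ m * 2 ^ m := by rw [two_mul, pow_add]
  have h1 : (bitVecOf z).toNat < 2 ^ (2 * m) := by
    rw [h2]; exact hz.trans_le (Nat.le_mul_of_pos_left _ (by positivity))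
  simp only [squareTest, Bool.not_eq_false', BitVec.ult, decide_eq_true_eq, BitVec.toNat_mul,
    BitVec.toNat_setWidth]
  rw [Nat.mod_eq_of_lt h1, Nat.mod_eq_of_lt, sq]
  rw [h2]
  exact Nat.mul_lt_mul'' hz hz

/-- The probability that the square of an `m`-bit number is below the number `y`. -/
def rootProb (m : ℕ) (y : Fin (2 * m) → Fin 2) : ℝ :=
  (Finset.univ.filter fun z : Fin m → Fin 2 => squareTest z y = false).card / 2 ^ m

theorem card_squareTest {m : ℕ} (y : Fin (2 * m) → Fin 2) :
    (Finset.univ.filter fun z : Fin m → Fin 2 => squareTest z y = false).card =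
      ⌈√((bitVecOf y).toNat : ℝ)⌉₊ := by
  have hy := (bitVecOf y).isLt
  have hle : ⌈√((bitVecOf y).toNat : ℝ)⌉₊ ≤ 2 ^ m := by
    rw [Nat.ceil_le, Real.sqrt_le_left (by positivity)]
    have : (((bitVecOf y).toNat : ℕ) : ℝ) ≤ ((2 ^ (2 * m) : ℕ) : ℝ) := by exact_mod_cast hy.le
    refine this.trans (le_of_eq ?_)
    push_cast
    rw [← pow_mul, mul_comm]
  rw [← Finset.card_range ⌈√((bitVecOf y).toNat : ℝ)⌉₊]
  refine Finset.card_bij (fun z _ => (bitVecOf z).toNat) ?_ ?_ ?_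
  · intro z hz
    rw [Finset.mem_filter, squareTest_eq_false] at hz
    rw [Finset.mem_range, Nat.lt_ceil]
    apply Real.lt_sqrt_of_sq_lt
    exact_mod_cast hz.2
  · intro z _ z' _ h
    rw [← bits_toNat_bitVecOf z, h, bits_toNat_bitVecOf]
  · intro j hj
    rw [Finset.mem_range] at hj
    refine ⟨bits m j, ?_, toNat_bitVecOf_bits (hj.trans_le hle)⟩
    rw [Finset.mem_filter, squareTest_eq_false, toNat_bitVecOf_bits (hj.trans_le hle)]
    refine ⟨Finset.mem_univ _, ?_⟩
    rw [Nat.lt_ceil, Real.lt_sqrt (Nat.cast_nonneg _)] at hj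
    exact_mod_cast hj

/-- The approximation to the square root of a number with binary digits `c`. -/
def rootApprox (m : ℕ) (c : ℕ → Fin 2) : ℝ := rootProb m fun i => c (Fin.rev i)

theorem rootApprox_eq (m : ℕ) (c : ℕ → Fin 2) :
    rootApprox m c = ⌈√(leadingDigits (2 * m) c : ℝ)⌉₊ / 2 ^ m := by
  rw [rootApprox, rootProb, card_squareTest, leadingDigits]

theorem sqrt_add_le_add_sqrt {a b : ℝ} (ha : 0 ≤ a) (hb : 0 ≤ b) : √(a + b) ≤ √a + √b := by
  rw [Real.sqrt_le_iff]
  refine ⟨by positivity, ?_⟩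
  have := mul_nonneg (Real.sqrt_nonneg a) (Real.sqrt_nonneg b)
  rw [add_sq, Real.sq_sqrt ha, Real.sq_sqrt hb]
  linarith

theorem abs_rootApprox_sub_sqrt_le (m : ℕ) (c : ℕ → Fin 2) :
    |rootApprox m c - √(Real.ofDigits c)| ≤ 2 * (2 ^ m)⁻¹ := by
  obtain ⟨h1, h2⟩ := leadingDigits_approx (2 * m) c
  have hp : (0 : ℝ) < 2 ^ m := by positivity
  have hpp : (2 : ℝ) ^ (2 * m) = (2 ^ m) ^ 2 := by rw [← pow_mul, mul_comm]
  have h3 : √((leadingDigits (2 * m) c : ℝ) / 2 ^ (2 * m)) =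
      √(leadingDigits (2 * m) c : ℝ) / 2 ^ m := by
    rw [hpp, Real.sqrt_div' _ (by positivity), Real.sqrt_sq hp.le]
  have h4 : √(leadingDigits (2 * m) c : ℝ) / 2 ^ m ≤ rootApprox m c := by
    rw [rootApprox_eq]
    gcongr
    exact Nat.le_ceil _
  have h5 : rootApprox m c ≤ √(leadingDigits (2 * m) c : ℝ) / 2 ^ m + (2 ^ m)⁻¹ := by
    rw [rootApprox_eq, ← one_div, ← add_div]
    gcongr
    exact (Nat.ceil_lt_add_one (Real.sqrt_nonneg _)).le
  have h6 := Real.sqrt_le_sqrt h1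
  have h7 : √(Real.ofDigits c) ≤ √(leadingDigits (2 * m) c : ℝ) / 2 ^ m + (2 ^ m)⁻¹ := by
    refine (Real.sqrt_le_sqrt h2).trans ?_
    refine (sqrt_add_le_add_sqrt (by positivity) (by positivity)).trans (le_of_eq ?_)
    rw [h3, hpp, Real.sqrt_inv, Real.sqrt_sq hp.le]
  rw [h3] at h6
  have hpi : (0 : ℝ) < (2 ^ m)⁻¹ := by positivity
  rw [abs_le]
  constructor <;> linarith

theorem rootApprox_eq_zero {m : ℕ} {c : ℕ → Fin 2} (h : Real.ofDigits c = 0) :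
    rootApprox m c = 0 := by
  have h1 := (leadingDigits_approx (2 * m) c).1
  rw [h] at h1
  have h2 : (leadingDigits (2 * m) c : ℝ) = 0 := by
    refine le_antisymm ?_ (Nat.cast_nonneg _)
    by_contra! h3
    exact absurd h1 (not_le.2 (by positivity))
  rw [rootApprox_eq, h2]
  simp

end Encoding

/-! ## The steps of the preparation -/

section Steps

variable {n : ℕ}

/-- The flag and the two index registers. -/
abbrev Reg (n : ℕ) : Type := Unit ⊕ Fin n ⊕ Fin n

/-- The basis state with flag `f` and indices `j`, `k`. -/
def reg (f : Fin 2) (j k : Fin n → Fin 2) : Reg n → Fin 2 := Sum.elim (fun _ => f) (Sum.elim j k)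

/-- The flag and the first register. -/
def flagFirst : (Unit ⊕ Fin n) ↪ Reg n :=
  ⟨Sum.elim (fun _ => Sum.inl ()) fun i => Sum.inr (Sum.inl i), by
    rintro (i | i) (i' | i') h <;> simp_all⟩

theorem BlockImpl.query {W : Type} [Fintype W] [DecidableEq W] (i : Instr n W)
    (h : i.isGate = false) : BlockImpl 1 0 fun O => i.op O :=
  (Impl.instr i).block.mono (by simp [h]) (by simp [h])

theorem exists_block_prep (a b : ℝ) (hab : a ^ 2 + b ^ 2 = 1) :
    ∃ F : OracleData n → QOp (Reg n), BlockImpl 1 2 F ∧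
      ∀ {N d : ℕ} (S : OscillatorSystem N) (O : OracleData n) (mMax κMax p q : ℝ),
        O.Describes S d mMax κMax → a = p * ‖S.v‖ → b = q * ‖S.x‖ →
        F O *ᵥ ket 0 = ∑ j : Fin N, ((p * S.v j : ℝ) : ℂ) • ket (reg 0 (bits n j) 0) +
          ∑ j : Fin N, (Complex.I * ((q * S.x j : ℝ) : ℂ)) • ket (reg 1 (bits n j) 0) := by
  have hab' : (a : ℂ) * a + b * b = 1 := by exact_mod_cast (by nlinarith : a * a + b * b = 1)
  have hR : !![(a : ℂ), Complex.I * b; Complex.I * b, a] *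
      !![(a : ℂ), Complex.I * b; Complex.I * b, a]ᴴ = 1 := by
    ext i j
    fin_cases i <;> fin_cases j <;> simp [Matrix.mul_apply, Matrix.conjTranspose_apply] <;>
      ring_nf <;> simp <;> linear_combination hab'
  have h1 := BlockImpl.query (Instr.prep (n := n) false flagFirst) rfl
  refine ⟨_, (h1.mul (BlockImpl.on1 (n := n) hR (Sum.inl () : Reg n))).mono le_rfl (by norm_num), ?_⟩
  intro N d S O mMax κMax p q hO ha hb
  have hf : ∀ c, Function.update (0 : Reg n → Fin 2) (Sum.inl ()) c = reg c 0 0 := by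
    intro c
    ext1 i; rcases i with i | i | i <;> simp [reg]
  have hk : ∀ c, reg c (0 : Fin n → Fin 2) 0 ∘ flagFirst = Sum.elim (fun _ => c) fun _ => 0 := by
    intro c
    ext1 i; rcases i with i | i <;> rfl
  have hx : ∀ (c : Fin 2) (j : ℕ), Function.extend (flagFirst (n := n))
      (Sum.elim (fun _ => c) (bits n j)) (reg c 0 0) = reg c (bits n j) 0 := by
    intro c j
    symm
    apply eq_extend flagFirst
    · ext1 i; rcases i with i | i <;> rfl
    · rintro (i | i | i) hi
      · rfl
      · exact absurd ⟨Sum.inr i, rfl⟩ hi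
      · rfl
  have hv := congrArg (insertState flagFirst (reg 0 0 0)) hO.prep_v
  have hw := congrArg (insertState flagFirst (reg 1 0 0)) hO.prep_x
  simp only [map_smul, map_sum, insertState_ket, hx] at hv hw
  simp only [Instr.op, QInstr.orient, Bool.false_eq_true, if_false]
  rw [← Matrix.mulVec_mulVec, on1_mulVec_ket, Fin.sum_univ_two, hf, hf, Matrix.mulVec_add,
    Matrix.mulVec_smul, Matrix.mulVec_smul, onW_mulVec_ket, onW_mulVec_ket, hk, hk]
  simp only [Pi.zero_apply, Matrix.of_apply, Matrix.cons_val_zero, Matrix.cons_val_one]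
  rw [ha, hb]
  push_cast
  rw [mul_smul, hv, ← mul_assoc, mul_smul, hw, Finset.smul_sum, Finset.smul_sum]
  simp only [smul_smul, mul_assoc]

theorem exists_block_superpose {d : ℕ} (hd : 1 ≤ d) (hdn : Nat.clog 2 d ≤ n) :
    ∃ F : QOp (Reg n), BlockImpl (n := n) 0 (231 * n + 170 + n) (fun _ => F) ∧
      (∀ j, F *ᵥ ket (reg 0 j 0) = (((1 / √2 : ℝ) : ℂ) ^ Nat.clog 2 d) • ket (reg 0 j 0)) ∧
      ∀ j, F *ᵥ ket (reg 1 j 0) = (((1 / √2 : ℝ) : ℂ) ^ Nat.clog 2 d) •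
        ∑ l : Fin d, ket (reg 1 j (bits n l)) := by
  have hd2 : d ≤ 2 ^ Nat.clog 2 d := Nat.le_pow_clog (by norm_num) d
  have hdn2 : (2 : ℕ) ^ Nat.clog 2 d ≤ 2 ^ n := Nat.pow_le_pow_right (by norm_num) hdn
  generalize hk : Nat.clog 2 d = k at *
  let e : Fin k ↪ Reg n := (Fin.castLEEmb hdn).trans
    (Function.Embedding.inr.trans Function.Embedding.inr)
  obtain ⟨l, hl, hlen, ha⟩ := exists_slp_threshold (X := Reg n) (Sum.inl ())
    (fun i : Fin n => Sum.inr (Sum.inr i)) (BitVec.ofNat n (d - 1)) (BitVec.ofNat n 0)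
  have hh := (BlockImpl.hadOn (n := n) (Finset.univ : Finset (Fin k))).lift e
  rw [Finset.card_univ, Fintype.card_fin] at hh
  refine ⟨_, ((BlockImpl.reject hl ha).mul hh).mono le_rfl (by omega), ?_⟩
  have hx : ∀ f j (u : ℕ), u < 2 ^ k →
      Function.extend e (bits k u) (reg f j 0) = reg f j (bits n u) := by
    intro f j u hu
    symm
    apply eq_extend e
    · rfl
    · rintro (i | i | i) hi
      · rfl
      · rfl
      · refine bits_apply_of_lt hu ?_
        by_contra! h
        exact hi ⟨⟨i, h⟩, rfl⟩
  have h0 : ∀ f j, onW e (hadOn Finset.univ) *ᵥ ket (reg f j 0) =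
      (((1 / √2 : ℝ) : ℂ) ^ k) • ∑ u : Fin (2 ^ k), ket (reg f j (bits n u)) := by
    intro f j
    have he : reg f j 0 ∘ e = 0 := rfl
    rw [onW_mulVec_ket, he, hadOn_univ_ket_zero, map_sum, Finset.smul_sum, Fintype.card_fin,
      ← Equiv.sum_comp (bitsEquiv k).symm]
    refine Finset.sum_congr rfl fun u _ => ?_
    rw [map_smul, insertState_ket]
    congr 2
    exact hx f j u u.2
  have htest : ∀ (f : Fin 2) (j : Fin n → Fin 2) (u : Fin (2 ^ k)),
      ((if ofBit (reg f j (bits n u) (Sum.inl ())) then BitVec.ofNat n (d - 1)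
        else BitVec.ofNat n 0).ult
        (bitVecOf (reg f j (bits n u) ∘ fun i => Sum.inr (Sum.inr i)))) =
      decide ((if f = 1 then d - 1 else 0) < (u : ℕ)) := by
    intro f j u
    have h1 : (reg f j (bits n u) ∘ fun i => Sum.inr (Sum.inr i)) = bits n u := rfl
    have h2 : reg f j (bits n u) (Sum.inl ()) = f := rfl
    rw [h1, h2, BitVec.ult, toNat_bitVecOf_bits (u.2.trans_le hdn2)]
    congr 2
    fin_cases f
    · simp [ofBit]
    · simp only [ofBit, Fin.mk_one, decide_true, if_true, BitVec.toNat_ofNat]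
      exact Nat.mod_eq_of_lt (by omega)
  constructor
  · intro j
    rw [← Matrix.mulVec_mulVec, h0, Matrix.mulVec_smul, Matrix.mulVec_sum]
    congr 1
    simp only [diagonal_mulVec_ket, htest]
    rw [Finset.sum_eq_single ⟨0, by positivity⟩]
    · simp only [bits_zero]
      simp
      rfl
    · intro u _ hu
      have : 0 < (u : ℕ) := Nat.pos_of_ne_zero fun h => hu (Fin.ext h)
      simp [this]
    · simp
  · intro j
    rw [← Matrix.mulVec_mulVec, h0, Matrix.mulVec_smul, Matrix.mulVec_sum]
    congr 1
    simp only [diagonal_mulVec_ket, htest]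
    symm
    apply Finset.sum_of_injOn (Fin.castLE hd2)
    · exact (Fin.castLE_injective hd2).injOn
    · intro x _; simp
    · intro u _ hu
      have : d - 1 < (u : ℕ) := by
        by_contra! h
        exact hu ⟨⟨u, by omega⟩, by simp, rfl⟩
      simp [this]
    · intro u _
      have : ¬ d - 1 < (u : ℕ) := by omega
      simp [this]

end Steps

section Steps

variable {n : ℕ}

/-- The first register and a fresh register. -/
def firstFresh (A : Type) : (Fin n ⊕ A) ↪ Reg n ⊕ A :=
  ⟨Sum.elim (fun i => Sum.inl (Sum.inr (Sum.inl i))) Sum.inr, by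
    rintro (i | i) (i' | i') h <;> simp_all⟩

/-- The two index registers. -/
def bothIndices (A : Type) : (Fin n ⊕ Fin n) ↪ Reg n ⊕ A :=
  Function.Embedding.inr.trans Function.Embedding.inl

theorem firstFresh_comp {A : Type} (f : Fin 2) (j k : Fin n → Fin 2) (y : A → Fin 2) :
    Sum.elim (reg f j k) y ∘ firstFresh A = Sum.elim j y := by
  ext1 i; rcases i with i | i <;> rfl

theorem bothIndices_comp {A : Type} (f : Fin 2) (j k : Fin n → Fin 2) (y : A → Fin 2) :
    Sum.elim (reg f j k) y ∘ bothIndices A = Sum.elim j k := by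
  ext1 i; rcases i with i | i <;> rfl

theorem onW_firstFresh {V : QOp (Fin n ⊕ Fin n)} {j y j' y' : Fin n → Fin 2}
    (h : V *ᵥ ket (Sum.elim j y) = ket (Sum.elim j' y')) (f : Fin 2) (k : Fin n → Fin 2) :
    onW (firstFresh (Fin n)) V *ᵥ ket (Sum.elim (reg f j k) y) =
      ket (Sum.elim (reg f j' k) y') := by
  refine onW_ket (firstFresh (Fin n)) h (firstFresh_comp _ _ _ _) (firstFresh_comp _ _ _ _) ?_
  rintro ((i | i | i) | i) hi
  · rfl
  · exact absurd ⟨Sum.inl i, rfl⟩ hi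
  · rfl
  · exact absurd ⟨Sum.inr i, rfl⟩ hi

theorem onW_bothIndices {A : Type} [Fintype A] [DecidableEq A] {V : QOp (Fin n ⊕ Fin n)}
    {j k j' k' : Fin n → Fin 2}
    (h : V *ᵥ ket (Sum.elim j k) = ket (Sum.elim j' k')) (f : Fin 2) (y : A → Fin 2) :
    onW (bothIndices A) V *ᵥ ket (Sum.elim (reg f j k) y) =
      ket (Sum.elim (reg f j' k') y) := by
  refine onW_ket (bothIndices A) h (bothIndices_comp _ _ _ _) (bothIndices_comp _ _ _ _) ?_
  rintro ((i | i | i) | i) hi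
  · rfl
  · exact absurd ⟨Sum.inl i, rfl⟩ hi
  · exact absurd ⟨Sum.inr i, rfl⟩ hi
  · rfl

/-- The flag, a fresh register and the second register. -/
def flagFreshSecond : ((Unit ⊕ Fin n) ⊕ Fin n) ↪ Reg n ⊕ Fin n :=
  ⟨Sum.elim (Sum.elim (fun _ => Sum.inl (Sum.inl ())) Sum.inr)
    fun i => Sum.inl (Sum.inr (Sum.inr i)), by
    rintro ((i | i) | i) ((i' | i') | i') h <;> simp_all⟩

/-- The neighbours of `j` are listed in the second register if the flag is set. -/
theorem exists_block_neighbor :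
    ∃ F : OracleData n → QOp (Reg n), BlockImpl 4 (23 * n) F ∧
      ∀ {N d : ℕ} (O : OracleData n) (a : Fin N → Fin d → Fin N), 1 ≤ d →
        (∀ (j : Fin N) (ℓ : Fin d), O.neighbor.1 *ᵥ ket (Sum.elim (bits n j) (bits n ℓ)) =
          ket (Sum.elim (bits n j) (bits n (a j ℓ)))) →
        (∀ j : Fin N, F O *ᵥ ket (reg 0 (bits n j) 0) = ket (reg 0 (bits n j) 0)) ∧
        ∀ (j : Fin N) (ℓ : Fin d), F O *ᵥ ket (reg 1 (bits n j) (bits n ℓ)) =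
          ket (reg 1 (bits n j) (bits n (a j ℓ))) := by
  obtain ⟨l, hl, hlen, ha⟩ := exists_slp_binary (X := Unit ⊕ Fin n) (B := Fin n)
    (fun p q => !p && q) (fun _ => Sum.inl ()) Sum.inr
  have hx := (BlockImpl.xorFun (n := n) hl ha).lift flagFreshSecond
  have h1 := BlockImpl.query (Instr.neighbor (n := n) false (firstFresh (Fin n))) rfl
  have h2 := BlockImpl.query (Instr.neighbor (n := n) false (bothIndices (Fin n))) rfl
  have h3 := BlockImpl.query (Instr.neighbor (n := n) true (firstFresh (Fin n))) rfl
  refine ⟨_, (((h3.mul hx).mul h2).mul h1).contract.mono (by norm_num) ?_, ?_⟩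
  · simp only [Fintype.card_fin] at *; omega
  intro N d O a hd hN
  have key : ∀ (f : Fin 2) (j : Fin N) (ℓ : Fin d),
      blk (Instr.op O (Instr.neighbor true (firstFresh (Fin n))) *
        onW flagFreshSecond (xorFun fun b x =>
          !ofBit (x (Sum.inl ())) && ofBit (x (Sum.inr b))) *
        Instr.op O (Instr.neighbor false (bothIndices (Fin n))) *
        Instr.op O (Instr.neighbor false (firstFresh (Fin n)))) *ᵥ
        ket (reg f (bits n j) (bits n ℓ)) = ket (reg f (bits n j) (fun i => bits n (a j ℓ) i +
          toBit (!ofBit f && ofBit (bits n (a j ⟨0, hd⟩) i)))) := by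
    intro f j ℓ
    apply blk_ket
    have h0 : O.neighbor.1 *ᵥ ket (Sum.elim (bits n j) 0) =
        ket (Sum.elim (bits n j) (bits n (a j ⟨0, hd⟩))) := by
      have := hN j ⟨0, hd⟩
      rwa [bits_zero] at this
    have h0' := conjTranspose_mulVec_of_unitary O.neighbor.2 h0
    simp only [← Matrix.mulVec_mulVec, Instr.op, QInstr.orient, Bool.false_eq_true, if_false,
      if_true]
    rw [onW_firstFresh h0, onW_bothIndices (hN j ℓ)]
    rw [onW_ket flagFreshSecond (xorFun_ket _ (Sum.elim (fun _ => f) (bits n (a j ⟨0, hd⟩))) _)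
      (t := Sum.elim (reg f (bits n j) fun i => bits n (a j ℓ) i +
          toBit (!ofBit f && ofBit (bits n (a j ⟨0, hd⟩) i))) (bits n (a j ⟨0, hd⟩)))]
    · exact onW_firstFresh h0' _ _
    · ext1 i; rcases i with (i | i) | i <;> rfl
    · ext1 i; rcases i with (i | i) | i <;> rfl
    · rintro ((i | i | i) | i) hi
      · rfl
      · rfl
      · exact absurd ⟨Sum.inr i, rfl⟩ hi
      · rfl
  constructor
  · intro j
    have := key 0 j ⟨0, hd⟩
    simp only [bits_zero] at this
    refine this.trans ?_
    congr 2
    ext1 i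
    simp only [ofBit, zero_ne_one, decide_false, Bool.not_false, Bool.true_and]
    generalize bits n (a j ⟨0, hd⟩) i = b
    fin_cases b <;> rfl
  · intro j ℓ
    refine (key 1 j ℓ).trans ?_
    congr 2
    ext1 i
    simp [ofBit, toBit]

/-- A control bit, one of the index registers and the other one. -/
def controlled (swap : Bool) : ((Unit ⊕ Fin n) ⊕ Fin n) ↪ Reg n ⊕ Unit :=
  ⟨Sum.elim (Sum.elim Sum.inr fun i => Sum.inl (Sum.inr (cond swap (Sum.inl i) (Sum.inr i))))
    fun i => Sum.inl (Sum.inr (cond swap (Sum.inr i) (Sum.inl i))), by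
    cases swap <;> rintro ((i | i) | i) ((i' | i') | i') h <;> simp_all⟩

/-- The controlled addition of one index register to the other one. -/
def controlledAdd (swap : Bool) : QOp (Reg n ⊕ Unit) :=
  onW (controlled swap) (xorFun fun b x => ofBit (x (Sum.inl ())) && ofBit (x (Sum.inr b)))

theorem BlockImpl.controlledAdd (swap : Bool) :
    BlockImpl (n := n) 0 (22 * n) fun _ => controlledAdd (n := n) swap := by
  obtain ⟨l, hl, hlen, ha⟩ := exists_slp_binary (X := Unit ⊕ Fin n) (B := Fin n)
    (fun p q => p && q) (fun _ => Sum.inl ()) Sum.inr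
  refine ((BlockImpl.xorFun (n := n) hl ha).lift (controlled swap)).mono le_rfl ?_
  simp only [Fintype.card_fin] at *; omega

theorem controlledAdd_false_ket (f c : Fin 2) (j k : Fin n → Fin 2) :
    controlledAdd false *ᵥ ket (Sum.elim (reg f j k) fun _ => c) =
      ket (Sum.elim (reg f (fun i => j i + toBit (ofBit c && ofBit (k i))) k) fun _ => c) := by
  refine onW_ket (controlled false) (xorFun_ket _ (Sum.elim (fun _ => c) k) j) ?_ ?_ ?_
  · ext1 i; rcases i with (i | i) | i <;> rfl
  · ext1 i; rcases i with (i | i) | i <;> rfl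
  · rintro ((i | i | i) | i) hi
    · rfl
    · exact absurd ⟨Sum.inr i, rfl⟩ hi
    · rfl
    · rfl

theorem controlledAdd_true_ket (f c : Fin 2) (j k : Fin n → Fin 2) :
    controlledAdd true *ᵥ ket (Sum.elim (reg f j k) fun _ => c) =
      ket (Sum.elim (reg f j (fun i => k i + toBit (ofBit c && ofBit (j i)))) fun _ => c) := by
  refine onW_ket (controlled true) (xorFun_ket _ (Sum.elim (fun _ => c) j) k) ?_ ?_ ?_
  · ext1 i; rcases i with (i | i) | i <;> rfl
  · ext1 i; rcases i with (i | i) | i <;> rfl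
  · rintro ((i | i | i) | i) hi
    · rfl
    · rfl
    · exact absurd ⟨Sum.inr i, rfl⟩ hi
    · rfl

theorem controlledAdd_swap (f : Fin 2) (j k : Fin n → Fin 2) (b : Bool) :
    (controlledAdd false * controlledAdd true * controlledAdd false) *ᵥ
      ket (Sum.elim (reg f j k) fun _ => toBit b) =
      ket (Sum.elim (if b then reg f k j else reg f j k) fun _ => toBit b) := by
  rw [← Matrix.mulVec_mulVec, ← Matrix.mulVec_mulVec, controlledAdd_false_ket,
    controlledAdd_true_ket, controlledAdd_false_ket]
  simp only [ofBit_toBit]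
  cases b
  · simp [toBit]
  · simp only [Bool.true_and, toBit_ofBit, if_true]
    congr 3
    · ext1 i
      generalize j i = a, k i = b
      fin_cases a <;> fin_cases b <;> rfl
    · ext1 i
      generalize j i = a, k i = b
      fin_cases a <;> fin_cases b <;> rfl

/-- The superposition of both orders of a pair, sorted. -/
theorem exists_block_sort :
    ∃ F : QOp (Reg n), BlockImpl (n := n) 0 (192 * n + 193) (fun _ => F) ∧
      (∀ j k, F *ᵥ ket (reg 0 j k) = ((1 / √2 : ℝ) : ℂ) • ket (reg 0 j k)) ∧
      ∀ j k, j < 2 ^ n → k < 2 ^ n → F *ᵥ ket (reg 1 (bits n j) (bits n k)) =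
        if k < j then -(((1 / √2 : ℝ) : ℂ) • ket (reg 1 (bits n k) (bits n j)))
          else ((1 / √2 : ℝ) : ℂ) • ket (reg 1 (bits n j) (bits n k)) := by
  obtain ⟨l, hl, hlen, ha⟩ := exists_slp_compare (X := Reg n) (Sum.inl ())
    (fun i : Fin n => Sum.inr (Sum.inr i)) (fun i => Sum.inr (Sum.inl i))
  have hz : (!![1, 0; 0, -1] : Matrix (Fin 2) (Fin 2) ℂ) * !![1, 0; 0, -1]ᴴ = 1 := by
    ext i j
    fin_cases i <;> fin_cases j <;> simp [Matrix.mul_apply, Matrix.conjTranspose_apply]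
  have hR : (hadM * !![1, 0; 0, -1]) * (hadM * !![1, 0; 0, -1])ᴴ = 1 := by
    rw [Matrix.conjTranspose_mul, mul_assoc, ← mul_assoc !![1, 0; 0, -1], hz, one_mul,
      hadM_conjTranspose, hadM_mul_self]
  have h1 := BlockImpl.xorFun (n := n) (B := Unit) hl fun _ => ha
  have h2 := ((BlockImpl.controlledAdd (n := n) false).mul (BlockImpl.controlledAdd true)).mul
    (BlockImpl.controlledAdd false)
  refine ⟨_, (((BlockImpl.on1 (n := n) hR (Sum.inr () : Reg n ⊕ Unit)).mul
    h2).mul h1).contract.mono le_rfl ?_, ?_⟩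
  · simp only [Fintype.card_unit] at *; omega
  have hu : ∀ (s : Reg n → Fin 2) y b, Function.update (Sum.elim s y : Reg n ⊕ Unit → Fin 2)
      (Sum.inr ()) b = Sum.elim s fun _ => b := by
    intro s y b; ext1 i; rcases i with i | i <;> simp
  have hinj : ∀ (u s : Reg n → Fin 2) (y : Fin 2),
      ((Sum.elim u 0 : Reg n ⊕ Unit → Fin 2) = Sum.elim s fun _ => y) ↔ u = s ∧ y = 0 := by
    intro u s y
    constructor
    · intro h
      exact ⟨funext fun i => congrFun h (Sum.inl i), (congrFun h (Sum.inr ())).symm⟩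
    · rintro ⟨rfl, rfl⟩; rfl
  have key : ∀ f j k b, (ofBit f && (bitVecOf k).ult (bitVecOf j)) = b →
      blk (on1 (Sum.inr ()) (hadM * !![1, 0; 0, -1]) *
        (controlledAdd false * controlledAdd true * controlledAdd false) *
        xorFun (B := Unit) fun _ x => ofBit (x (Sum.inl ())) &&
          (bitVecOf (x ∘ fun i : Fin n => Sum.inr (Sum.inr i))).ult
            (bitVecOf (x ∘ fun i => Sum.inr (Sum.inl i)))) *ᵥ ket (reg f j k) =
        if b then -(((1 / √2 : ℝ) : ℂ) • ket (reg f k j))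
          else ((1 / √2 : ℝ) : ℂ) • ket (reg f j k) := by
    intro f j k b hb
    rw [blk_mulVec_ket, ← Matrix.mulVec_mulVec, ← Matrix.mulVec_mulVec, xorFun_ket]
    have hb' : (ofBit (reg f j k (Sum.inl ())) &&
          (bitVecOf (reg f j k ∘ fun i : Fin n => Sum.inr (Sum.inr i))).ult
            (bitVecOf (reg f j k ∘ fun i => Sum.inr (Sum.inl i)))) = b := hb
    simp only [hb', Pi.zero_apply, zero_add]
    rw [controlledAdd_swap, on1_mulVec_ket, Fin.sum_univ_two, hu, hu]
    ext u
    simp only [Pi.add_apply, Pi.smul_apply, ket_apply, hinj]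
    cases b
    · by_cases h : u = reg f j k <;> simp [h, toBit, hadM, ket_apply, Matrix.mul_apply]
    · by_cases h : u = reg f k j <;> simp [h, toBit, hadM, ket_apply, Matrix.mul_apply]
  refine ⟨fun j k => ?_, fun j k hj hk => ?_⟩
  · exact (key 0 j k false rfl).trans (by simp)
  · refine (key 1 (bits n j) (bits n k) (decide (k < j)) ?_).trans ?_
    · rw [BitVec.ult, toNat_bitVecOf_bits hj, toNat_bitVecOf_bits hk]
      rfl
    · by_cases h : k < j <;> simp [h]

end Steps

section Steps

variable {n : ℕ}

/-- The wires of a mass query. -/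
def massWires (r : ℕ) : (Fin n ⊕ Fin r) ↪ Reg n ⊕ (Fin r ⊕ Fin r) :=
  ⟨Sum.elim (fun i => Sum.inl (Sum.inr (Sum.inl i))) fun i => Sum.inr (Sum.inl i), by
    rintro (i | i) (i' | i') h <;> simp_all⟩

/-- The wires of a spring query. -/
def springWires (r : ℕ) : ((Fin n ⊕ Fin n) ⊕ Fin r) ↪ Reg n ⊕ (Fin r ⊕ Fin r) :=
  ⟨Sum.elim (fun i => Sum.inl (Sum.inr i)) fun i => Sum.inr (Sum.inr i), by
    rintro (i | i) (i' | i') h <;> simp_all⟩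

theorem onW_massWires {r : ℕ} {V : QOp (Fin n ⊕ Fin r)} {j : Fin n → Fin 2} {y y' : Fin r → Fin 2}
    (h : V *ᵥ ket (Sum.elim j y) = ket (Sum.elim j y')) (f : Fin 2) (k : Fin n → Fin 2)
    (z : Fin r → Fin 2) :
    onW (massWires r) V *ᵥ ket (Sum.elim (reg f j k) (Sum.elim y z)) =
      ket (Sum.elim (reg f j k) (Sum.elim y' z)) := by
  refine onW_ket (massWires r) h ?_ ?_ ?_
  · ext1 i; rcases i with i | i <;> rfl
  · ext1 i; rcases i with i | i <;> rfl
  · rintro ((i | i | i) | i | i) hi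
    · rfl
    · rfl
    · rfl
    · exact absurd ⟨Sum.inr i, rfl⟩ hi
    · rfl

theorem onW_springWires {r : ℕ} {V : QOp ((Fin n ⊕ Fin n) ⊕ Fin r)} {j k : Fin n → Fin 2}
    {z z' : Fin r → Fin 2}
    (h : V *ᵥ ket (Sum.elim (Sum.elim j k) z) = ket (Sum.elim (Sum.elim j k) z')) (f : Fin 2)
    (y : Fin r → Fin 2) :
    onW (springWires r) V *ᵥ ket (Sum.elim (reg f j k) (Sum.elim y z)) =
      ket (Sum.elim (reg f j k) (Sum.elim y z')) := by
  refine onW_ket (springWires r) h ?_ ?_ ?_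
  · ext1 i; rcases i with (i | i) | i <;> rfl
  · ext1 i; rcases i with (i | i) | i <;> rfl
  · rintro ((i | i | i) | i | i) hi
    · rfl
    · rfl
    · rfl
    · rfl
    · exact absurd ⟨Sum.inr i, rfl⟩ hi

/-- The multiplication of each amplitude by the root of the mass or spring constant. -/
theorem exists_block_weight (m : ℕ) :
    ∃ F : OracleData n → QOp (Reg n), BlockImpl 4 (924 * m ^ 2 + 931 * m + 191) F ∧
      ∀ {N : ℕ} (O : OracleData n) (b : Fin N → ℕ → Fin 2) (c : Fin N → Fin N → ℕ → Fin 2),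
        (∀ (j k : Fin N) (z : Fin (2 * m) → Fin 2),
          (O.spring (2 * m)).1 *ᵥ ket (Sum.elim (Sum.elim (bits n j) (bits n k)) z) =
            ket (Sum.elim (Sum.elim (bits n j) (bits n k)) (z + fun i : Fin (2 * m) => c j k i))) →
        (∀ (j : Fin N) (z : Fin (2 * m) → Fin 2),
          (O.mass (2 * m)).1 *ᵥ ket (Sum.elim (bits n j) z) =
            ket (Sum.elim (bits n j) (z + fun i : Fin (2 * m) => b j i))) →
        (∀ j k : Fin N, F O *ᵥ ket (reg 0 (bits n j) (bits n k)) =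
          (rootApprox m (b j) : ℂ) • ket (reg 0 (bits n j) (bits n k))) ∧
        ∀ j k : Fin N, F O *ᵥ ket (reg 1 (bits n j) (bits n k)) =
          (rootApprox m (c j k) : ℂ) • ket (reg 1 (bits n j) (bits n k)) := by
  let X : Type := Reg n ⊕ (Fin (2 * m) ⊕ Fin (2 * m))
  obtain ⟨l, hl, hlen, ha⟩ := exists_slp_square (X := X ⊕ Fin m)
    (Sum.inl (Sum.inl (Sum.inl ()))) Sum.inr
    (fun i => Sum.inl (Sum.inr (Sum.inr (Fin.rev i))))
    (fun i => Sum.inl (Sum.inr (Sum.inl (Fin.rev i))))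
  have hp := BlockImpl.probability (n := n) hl ha
  have h1 := BlockImpl.query (Instr.mass (n := n) false _ (massWires (2 * m))) rfl
  have h2 := BlockImpl.query (Instr.spring (n := n) false _ (springWires (2 * m))) rfl
  have h3 := h2.mul h1
  refine ⟨_, ((h3.adj.mul hp).mul h3).contract.mono (by norm_num) ?_, ?_⟩
  · simp only [Fintype.card_sum, Fintype.card_fin] at *
    nlinarith
  intro N O b c hc hb
  have key : ∀ (f : Fin 2) (j k : Fin N),
      blk ((Instr.op O (Instr.spring false _ (springWires (2 * m))) *
          Instr.op O (Instr.mass false _ (massWires (2 * m))))ᴴ *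
        (Matrix.diagonal fun x : X → Fin 2 =>
          ((Finset.univ.filter fun z : Fin m → Fin 2 =>
            (!(((bitVecOf (Sum.elim x z ∘ Sum.inr)).setWidth (2 * m) *
              (bitVecOf (Sum.elim x z ∘ Sum.inr)).setWidth (2 * m)).ult
                (if ofBit (Sum.elim x z (Sum.inl (Sum.inl (Sum.inl ())))) then
                  bitVecOf (Sum.elim x z ∘ fun i => Sum.inl (Sum.inr (Sum.inr (Fin.rev i))))
                else bitVecOf
                  (Sum.elim x z ∘ fun i => Sum.inl (Sum.inr (Sum.inl (Fin.rev i))))))) =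
            false).card : ℂ) / 2 ^ Fintype.card (Fin m)) *
        (Instr.op O (Instr.spring false _ (springWires (2 * m))) *
          Instr.op O (Instr.mass false _ (massWires (2 * m))))) *ᵥ
        ket (reg f (bits n j) (bits n k)) =
      (if ofBit f then (rootApprox m (c j k) : ℂ) else rootApprox m (b j)) •
        ket (reg f (bits n j) (bits n k)) := by
    intro f j k
    have hV : (Instr.op O (Instr.spring false _ (springWires (2 * m))) *
          Instr.op O (Instr.mass false _ (massWires (2 * m)))) *ᵥ
        ket (Sum.elim (reg f (bits n j) (bits n k)) 0) =
        ket (Sum.elim (reg f (bits n j) (bits n k))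
          (Sum.elim (fun i : Fin (2 * m) => b j i) fun i : Fin (2 * m) => c j k i)) := by
      have h0 : (0 : Fin (2 * m) ⊕ Fin (2 * m) → Fin 2) = Sum.elim (0 : Fin (2 * m) → Fin 2) (0 : Fin (2 * m) → Fin 2) := by
        ext1 i; rcases i with i | i <;> rfl
      rw [← Matrix.mulVec_mulVec, h0]
      simp only [Instr.op, QInstr.orient, Bool.false_eq_true, if_false]
      have hb' := hb j 0
      have hc' := hc j k 0
      rw [zero_add] at hb' hc'
      rw [onW_massWires hb', onW_springWires hc']
    have hU := conjTranspose_mulVec_of_unitary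
      (mul_mem (Instr.op_mem_unitary O (Instr.spring false _ (springWires (n := n) (2 * m))))
        (Instr.op_mem_unitary O (Instr.mass false _ (massWires (2 * m))))) hV
    rw [blk_mulVec_ket, ← Matrix.mulVec_mulVec, hV, ← Matrix.mulVec_mulVec, diagonal_mulVec_ket,
      Matrix.mulVec_smul, hU]
    ext u
    have hinj := sumElim_injective (M := Reg n) (A := Fin (2 * m) ⊕ Fin (2 * m))
    simp only [Pi.smul_apply, ket_apply, hinj.eq_iff, smul_eq_mul]
    congr 1
    rw [Fintype.card_fin]
    by_cases hf : ofBit f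
    · rw [if_pos hf, rootApprox, rootProb]
      push_cast
      congr 3
      refine Finset.filter_congr fun z _ => ?_
      have hf' : ofBit ((Sum.elim (Sum.elim (reg f (bits n j) (bits n k))
        (Sum.elim (fun i : Fin (2 * m) => b j i) fun i : Fin (2 * m) => c j k i)) z :
          X ⊕ Fin m → Fin 2) (Sum.inl (Sum.inl (Sum.inl ())))) = true := hf
      rw [if_pos hf']
      rfl
    · rw [if_neg hf, rootApprox, rootProb]
      push_cast
      congr 3
      refine Finset.filter_congr fun z _ => ?_
      have hf' : ¬ ofBit ((Sum.elim (Sum.elim (reg f (bits n j) (bits n k))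
        (Sum.elim (fun i : Fin (2 * m) => b j i) fun i : Fin (2 * m) => c j k i)) z :
          X ⊕ Fin m → Fin 2) (Sum.inl (Sum.inl (Sum.inl ())))) = true := hf
      rw [if_neg hf']
      rfl
  exact ⟨fun j k => key 0 j k, fun j k => key 1 j k⟩

end Steps

/-! ## The prepared state -/

section Prepared

variable {n N : ℕ}

theorem sum_sum_eq_diag_add {M : Type} [AddCommMonoid M] (f : Fin N → Fin N → M) :
    ∑ j, ∑ k, f j k = ∑ j, f j j + ∑ j, ∑ k ∈ Finset.Ioi j, (f j k + f k j) := by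
  have h1 : ∀ j, ∑ k, f j k = f j j + (∑ k ∈ Finset.Ioi j, f j k + ∑ k ∈ Finset.Iio j, f j k) := by
    intro j
    have h2 : Finset.univ = insert j (Finset.Ioi j ∪ Finset.Iio j) := by
      ext k
      simp only [Finset.mem_univ, Finset.mem_insert, Finset.mem_union, Finset.mem_Ioi,
        Finset.mem_Iio, true_iff]
      rcases lt_trichotomy k j with h | h | h <;> simp [h]
    rw [h2, Finset.sum_insert (by simp), Finset.sum_union]
    rw [Finset.disjoint_left]
    intro k hk hk'
    exact absurd (Finset.mem_Ioi.1 hk) (Finset.mem_Iio.1 hk').asymm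
  have h3 : ∑ j, ∑ k ∈ Finset.Iio j, f j k = ∑ j, ∑ k ∈ Finset.Ioi j, f k j :=
    Finset.sum_comm' (by simp)
  simp only [h1, Finset.sum_add_distrib, h3]

/-- The state with amplitudes `u` for single indices, `D` for doubled ones and `T` for pairs. -/
def oscState (n : ℕ) (u D : Fin N → ℂ) (T : Fin N → Fin N → ℂ) : QState (Reg n) :=
  ∑ j, u j • ket (reg 0 (bits n j) 0) + ∑ j, D j • ket (reg 1 (bits n j) (bits n j)) +
    ∑ j, ∑ k ∈ Finset.Ioi j, T j k • ket (reg 1 (bits n j) (bits n k))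

theorem oscState_sub (u D u' D' : Fin N → ℂ) (T T' : Fin N → Fin N → ℂ) :
    oscState n u D T - oscState n u' D' T' = oscState n (u - u') (D - D') (T - T') := by
  simp only [oscState, Pi.sub_apply, sub_smul, Finset.sum_sub_distrib]
  abel

theorem smul_oscState (c : ℂ) (u D : Fin N → ℂ) (T : Fin N → Fin N → ℂ) :
    c • oscState n u D T = oscState n (c • u) (c • D) (c • T) := by
  simp only [oscState, Pi.smul_apply, smul_add, Finset.smul_sum, smul_smul, smul_eq_mul]

theorem norm_sq_sum_ket {ι W : Type} [Fintype W] [DecidableEq W] (A : Finset ι) (c : ι → ℂ)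
    (s : ι → W → Fin 2) (hs : Set.InjOn s A) :
    ‖WithLp.toLp 2 (∑ i ∈ A, c i • ket (s i))‖ ^ 2 = ∑ i ∈ A, ‖c i‖ ^ 2 := by
  classical
  rw [EuclideanSpace.norm_sq_eq]
  symm
  apply Finset.sum_of_injOn s hs
  · intro x _; simp
  · intro x _ hx
    simp only [Finset.sum_apply, Pi.smul_apply, ket_apply, smul_eq_mul]
    rw [Finset.sum_eq_zero]
    · simp
    · intro i hi
      rw [if_neg, mul_zero]
      rintro rfl
      exact hx ⟨i, hi, rfl⟩
  · intro i hi
    simp only [Finset.sum_apply, Pi.smul_apply, ket_apply, smul_eq_mul]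
    rw [Finset.sum_eq_single i]
    · simp
    · intro j hj hji
      rw [if_neg, mul_zero]
      intro h
      exact hji (hs hi hj h).symm
    · exact fun h => absurd hi h

theorem reg_inj {f f' : Fin 2} {j k j' k' : Fin n → Fin 2} :
    reg f j k = reg f' j' k' ↔ f = f' ∧ j = j' ∧ k = k' := by
  constructor
  · intro h
    exact ⟨congrFun h (Sum.inl ()), funext fun i => congrFun h (Sum.inr (Sum.inl i)),
      funext fun i => congrFun h (Sum.inr (Sum.inr i))⟩
  · rintro ⟨rfl, rfl, rfl⟩; rfl

theorem norm_sq_oscState (hN : N ≤ 2 ^ n) (u D : Fin N → ℂ) (T : Fin N → Fin N → ℂ) :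
    ‖WithLp.toLp 2 (oscState n u D T)‖ ^ 2 =
      ∑ j, ‖u j‖ ^ 2 + ∑ j, ‖D j‖ ^ 2 + ∑ j, ∑ k ∈ Finset.Ioi j, ‖T j k‖ ^ 2 := by
  let A : Finset (Fin N ⊕ Fin N ⊕ Σ _ : Fin N, Fin N) :=
    Finset.univ.disjSum (Finset.univ.disjSum (Finset.univ.sigma fun j => Finset.Ioi j))
  let c : Fin N ⊕ Fin N ⊕ (Σ _ : Fin N, Fin N) → ℂ :=
    Sum.elim u (Sum.elim D fun p => T p.1 p.2)
  let s : Fin N ⊕ Fin N ⊕ (Σ _ : Fin N, Fin N) → Reg n → Fin 2 :=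
    Sum.elim (fun j => reg 0 (bits n j) 0) (Sum.elim (fun j => reg 1 (bits n j) (bits n j))
      fun p => reg 1 (bits n p.1) (bits n p.2))
  have hb : ∀ j k : Fin N, bits n j = bits n k ↔ j = k := fun j k => by
    rw [bits_inj (j.2.trans_le hN) (k.2.trans_le hN), Fin.ext_iff]
  have hs : Set.InjOn s A := by
    rintro (j | j | ⟨j, j'⟩) hj (k | k | ⟨k, k'⟩) hk h
    all_goals simp [s, reg_inj, hb, A] at h hj hk ⊢
    · exact h
    · exact h
    · rw [← h.1, ← h.2] at hk; exact absurd hk (lt_irrefl _)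
    · rw [h.1, h.2] at hj; exact absurd hj (lt_irrefl _)
    · exact h
  have h := norm_sq_sum_ket A c s hs
  simp only [A, c, s, Finset.sum_disjSum, Finset.sum_sigma, Sum.elim_inl, Sum.elim_inr] at h
  rw [← add_assoc, ← add_assoc] at h
  exact h

theorem initialState_eq (S : OscillatorSystem N) (n : ℕ) :
    S.initialState n = oscState n
      (fun j => ((1 / √(2 * S.energy) * (√(S.m j) * S.v j) : ℝ) : ℂ))
      (fun j => Complex.I * ((1 / √(2 * S.energy) * (√(S.κ j j) * S.x j) : ℝ) : ℂ))
      fun j k => Complex.I * ((1 / √(2 * S.energy) * (√(S.κ j k) * (S.x j - S.x k)) : ℝ) : ℂ) := by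
  have h0 : ∀ j : Fin N, reg 0 (bits n j) 0 =
      Sum.elim (fun _ => 0) (Sum.elim (bits n j) (fun _ => 0)) := fun _ => rfl
  have h1 : ∀ j k : Fin N, reg 1 (bits n j) (bits n k) =
      Sum.elim (fun _ => 1) (Sum.elim (bits n j) (bits n k)) := fun _ _ => rfl
  simp only [OscillatorSystem.initialState, oscState, h0, h1, smul_add, Finset.smul_sum, smul_smul,
    Complex.ofReal_mul, mul_left_comm Complex.I]

theorem norm_initialState (S : OscillatorSystem N) (hN : N ≤ 2 ^ n) (hE : 0 < S.energy) :
    ‖WithLp.toLp 2 (S.initialState n)‖ = 1 := by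
  have h : ‖WithLp.toLp 2 (S.initialState n)‖ ^ 2 = 1 := by
    rw [initialState_eq, norm_sq_oscState hN]
    simp only [norm_mul, Complex.norm_I, one_mul, Complex.norm_real, mul_pow, Real.norm_eq_abs,
      sq_abs, div_pow, one_pow, Real.sq_sqrt (show 0 ≤ 2 * S.energy by positivity),
      Real.sq_sqrt (S.m_pos _).le, Real.sq_sqrt (S.κ_nonneg _ _)]
    simp only [← Finset.mul_sum]
    rw [← mul_add, ← mul_add]
    have : ∑ j, S.m j * S.v j ^ 2 + ∑ j, S.κ j j * S.x j ^ 2 +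
        ∑ j, ∑ k ∈ Finset.Ioi j, S.κ j k * (S.x j - S.x k) ^ 2 = 2 * S.energy := by
      rw [OscillatorSystem.energy]; ring
    rw [this]
    field_simp
  have h0 := norm_nonneg (WithLp.toLp 2 (S.initialState n))
  nlinarith

theorem spring_energy_le (S : OscillatorSystem N) {d : ℕ} {κMax : ℝ}
    (hd : ∀ j, (Finset.univ.filter fun k => S.κ j k ≠ 0).card ≤ d)
    (h0 : 0 ≤ κMax) :
    ∑ j, (if S.κ j j = 0 then 0 else κMax) * S.x j ^ 2 +
      ∑ j, ∑ k ∈ Finset.Ioi j, (if S.κ j k = 0 then 0 else κMax) * (S.x j - S.x k) ^ 2 ≤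
      2 * (d * κMax * ‖S.x‖ ^ 2) := by
  let g : Fin N → Fin N → ℝ := fun j k => if S.κ j k = 0 then 0 else κMax
  have hg : ∀ j k, 0 ≤ g j k := fun j k => by
    simp only [g]; split_ifs <;> simp [h0]
  have hgs : ∀ j k, g k j = g j k := fun j k => by
    simp only [g]; rw [S.κ_symm.apply j k]
  have h1 : ∑ j, ∑ k, g j k * S.x j ^ 2 ≤ d * κMax * ‖S.x‖ ^ 2 := by
    rw [EuclideanSpace.norm_sq_eq, Finset.mul_sum]
    refine Finset.sum_le_sum fun j _ => ?_
    rw [← Finset.sum_mul, Real.norm_eq_abs, sq_abs]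
    refine mul_le_mul_of_nonneg_right ?_ (sq_nonneg _)
    have : ∑ k, g j k = (Finset.univ.filter fun k => S.κ j k ≠ 0).card * κMax := by
      rw [← nsmul_eq_mul, ← Finset.sum_const, Finset.sum_filter]
      refine Finset.sum_congr rfl fun k _ => ?_
      by_cases h : S.κ j k = 0 <;> simp [g, h]
    rw [this]
    exact mul_le_mul_of_nonneg_right (by exact_mod_cast hd j) h0
  refine le_trans ?_ (mul_le_mul_of_nonneg_left h1 (by norm_num))
  rw [sum_sum_eq_diag_add, mul_add]
  refine add_le_add ?_ ?_
  · rw [Finset.mul_sum]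
    refine Finset.sum_le_sum fun j _ => ?_
    have := mul_nonneg (hg j j) (sq_nonneg (S.x j))
    simp only [g] at this ⊢
    linarith
  · rw [Finset.mul_sum]
    refine Finset.sum_le_sum fun j _ => ?_
    rw [Finset.mul_sum]
    refine Finset.sum_le_sum fun k _ => ?_
    rw [hgs j k]
    have := mul_nonneg (hg j k) (sq_nonneg (S.x j + S.x k))
    simp only [g] at this ⊢
    nlinarith

theorem energy_le (S : OscillatorSystem N) {d : ℕ} {mMax κMax α β E : ℝ}
    (h : S.HasParams d mMax κMax α β E) (hd : 1 ≤ d) (hm : 0 ≤ mMax) (hκ : 0 ≤ κMax) :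
    E ≤ 2 * d * maxEnergy mMax κMax α β := by
  have h1 := spring_energy_le S h.sparse hκ
  have h2 : ∑ j, S.m j * S.v j ^ 2 ≤ mMax * ‖S.v‖ ^ 2 := by
    rw [EuclideanSpace.norm_sq_eq, Finset.mul_sum]
    refine Finset.sum_le_sum fun j _ => ?_
    rw [Real.norm_eq_abs, sq_abs]
    exact mul_le_mul_of_nonneg_right (h.m_le j) (sq_nonneg _)
  have h3 : ∑ j, S.κ j j * S.x j ^ 2 + ∑ j, ∑ k ∈ Finset.Ioi j, S.κ j k * (S.x j - S.x k) ^ 2 ≤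
      ∑ j, (if S.κ j j = 0 then 0 else κMax) * S.x j ^ 2 +
      ∑ j, ∑ k ∈ Finset.Ioi j, (if S.κ j k = 0 then 0 else κMax) * (S.x j - S.x k) ^ 2 := by
    have h4 : ∀ j k, S.κ j k ≤ if S.κ j k = 0 then 0 else κMax := by
      intro j k
      split_ifs with h0
      · exact h0.le
      · exact h.κ_le j k
    refine add_le_add (Finset.sum_le_sum fun j _ => ?_) (Finset.sum_le_sum fun j _ =>
      Finset.sum_le_sum fun k _ => ?_)
    · exact mul_le_mul_of_nonneg_right (h4 j j) (sq_nonneg _)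
    · exact mul_le_mul_of_nonneg_right (h4 j k) (sq_nonneg _)
  have hd' : (1 : ℝ) ≤ d := by exact_mod_cast hd
  have h5 : mMax * ‖S.v‖ ^ 2 ≤ d * (mMax * ‖S.v‖ ^ 2) :=
    le_mul_of_one_le_left (by positivity) hd'
  have h6 : 0 ≤ (d : ℝ) * (mMax * ‖S.v‖ ^ 2) := by positivity
  rw [← h.energy_eq, OscillatorSystem.energy, maxEnergy, ← h.norm_v, ← h.norm_x]
  nlinarith

end Prepared

section Prepared

variable {n N : ℕ}

/-- The state prepared from approximate roots of the masses and spring constants. -/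
def approxState (S : OscillatorSystem N) (n m : ℕ) (p q : ℝ) (b : Fin N → ℕ → Fin 2)
    (c : Fin N → Fin N → ℕ → Fin 2) : QState (Reg n) :=
  oscState n (fun j => ((p * (rootApprox m (b j) * S.v j) : ℝ) : ℂ))
    (fun j => Complex.I * ((q * (rootApprox m (c j j) * S.x j) : ℝ) : ℂ))
    fun j k => Complex.I * ((q * (rootApprox m (c j k) * (S.x j - S.x k)) : ℝ) : ℂ)

theorem exists_block_approxState {d m : ℕ} (hN : N ≤ 2 ^ n) (hd : 1 ≤ d)
    (hdn : Nat.clog 2 d ≤ n) {a b μ : ℝ} (hab : a ^ 2 + b ^ 2 = 1) (h0 : 0 ≤ μ) (h1 : μ ≤ 1) :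
    ∃ F : OracleData n → QOp (Reg n),
      BlockImpl 9 (447 * n + 924 * m ^ 2 + 931 * m + 558) F ∧
      ∀ (S : OscillatorSystem N) (O : OracleData n) (mMax κMax p q : ℝ),
        O.Describes S d mMax κMax → a = p * ‖S.v‖ → b = q * ‖S.x‖ → (κMax = 0 → q = 0) →
        ∃ (β : Fin N → ℕ → Fin 2) (c : Fin N → Fin N → ℕ → Fin 2),
          (∀ j, S.m j = mMax * Real.ofDigits (β j)) ∧
          (∀ j k, S.κ j k = κMax * Real.ofDigits (c j k)) ∧
          F O *ᵥ ket 0 = ((μ * (1 / √2) ^ (Nat.clog 2 d + 1) : ℝ) : ℂ) •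
            approxState S n m p q β c := by
  obtain ⟨F₁, hF₁, h₁⟩ := exists_block_prep (n := n) a b hab
  obtain ⟨F₂, hF₂, h₂, h₂'⟩ := exists_block_superpose (n := n) hd hdn
  obtain ⟨F₃, hF₃, h₃⟩ := exists_block_neighbor (n := n)
  obtain ⟨F₄, hF₄, h₄, h₄'⟩ := exists_block_sort (n := n)
  obtain ⟨F₅, hF₅, h₅⟩ := exists_block_weight (n := n) m
  refine ⟨_, ((BlockImpl.scalar h0 h1).mul (hF₅.mul (hF₄.mul (hF₃.mul (hF₂.mul hF₁))))).mono
    (by norm_num) (by omega), ?_⟩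
  intro S O mMax κMax p q hO ha hb hκq
  obtain ⟨nb, hinj, hnb, hn⟩ := hO.neighbor_spec
  obtain ⟨c, hc, hc'⟩ := hO.spring_spec
  obtain ⟨β, hβ, hβ'⟩ := hO.mass_spec
  obtain ⟨h₃, h₃'⟩ := h₃ O nb hd hn
  obtain ⟨h₅, h₅'⟩ := h₅ O β c (hc' (2 * m)) (hβ' (2 * m))
  refine ⟨β, c, hβ, hc, ?_⟩
  have hlt : ∀ j : Fin N, (j : ℕ) < 2 ^ n := fun j => j.2.trans_le hN
  have hz : ∀ j k, S.κ j k = 0 → (q : ℂ) * (rootApprox m (c j k) : ℂ) = 0 := by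
    intro j k h
    rw [hc j k, mul_eq_zero] at h
    rcases h with h | h
    · simp [hκq h]
    · simp [rootApprox_eq_zero h]
  generalize hs : ((1 / √2 : ℝ) : ℂ) = s at h₂ h₂' h₄ h₄'
  let G : Fin N → Fin N → QState (Reg n) := fun j k =>
    (Complex.I * ((q * S.x j : ℝ) : ℂ)) • if k < j
      then -((s * rootApprox m (c k j)) • ket (reg 1 (bits n k) (bits n j)))
      else (s * rootApprox m (c j k)) • ket (reg 1 (bits n j) (bits n k))
  have hG : ∀ j k, S.κ j k = 0 → G j k = 0 := by
    intro j k h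
    have h' : S.κ k j = 0 := by rw [S.κ_symm.apply j k, h]
    have e1 := hz _ _ h
    have e2 := hz _ _ h'
    simp only [G]
    split_ifs
    · rw [smul_neg, smul_smul]
      push_cast
      rw [show Complex.I * ((q : ℂ) * (S.x j : ℂ)) * (s * (rootApprox m (c k j) : ℂ)) =
        Complex.I * S.x j * s * ((q : ℂ) * (rootApprox m (c k j) : ℂ)) by ring, e2]
      simp
    · rw [smul_smul]
      push_cast
      rw [show Complex.I * ((q : ℂ) * (S.x j : ℂ)) * (s * (rootApprox m (c j k) : ℂ)) =
        Complex.I * S.x j * s * ((q : ℂ) * (rootApprox m (c j k) : ℂ)) by ring, e1]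
      simp
  have hstep : ∀ j k : Fin N, (Complex.I * ((q * S.x j : ℝ) : ℂ)) •
      (F₅ O *ᵥ (F₄ *ᵥ ket (reg 1 (bits n j) (bits n k)))) = G j k := by
    intro j k
    rw [h₄' j k (hlt j) (hlt k)]
    simp only [G, Fin.lt_def]
    split_ifs
    · rw [Matrix.mulVec_neg, Matrix.mulVec_smul, h₅', smul_smul]
    · rw [Matrix.mulVec_smul, h₅', smul_smul s]
  have hsum : ∀ j : Fin N, ∑ l : Fin d, G j (nb j l) = ∑ k, G j k := by
    intro j
    refine Finset.sum_of_injOn (nb j) (hinj j).injOn (fun _ _ => by simp) ?_ fun _ _ => rfl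
    intro k _ hk
    apply hG
    by_contra h
    obtain ⟨l, hl⟩ := hnb j k h
    exact hk ⟨l, by simp, hl⟩
  have hzero : ∀ j : Fin N, F₅ O *ᵥ ket (reg 0 (bits n j) 0) =
      (rootApprox m (β j) : ℂ) • ket (reg 0 (bits n j) 0) := by
    intro j
    have := h₅ j ⟨0, j.pos⟩
    rwa [show bits n (⟨0, j.pos⟩ : Fin N) = 0 from bits_zero n] at this
  simp only [← Matrix.mulVec_mulVec, Matrix.smul_mulVec, Matrix.one_mulVec]
  rw [h₁ S O mMax κMax p q hO ha hb]
  simp only [Matrix.mulVec_add, Matrix.mulVec_sum, Matrix.mulVec_smul, h₂, h₂', h₃, h₃', h₄, hzero]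
  simp only [smul_comm _ (s ^ Nat.clog 2 d), Finset.smul_sum (N := QState (Reg n)) (r :=
    (Complex.I * (_ : ℂ))), hstep, hsum, ← Finset.smul_sum]
  rw [sum_sum_eq_diag_add, approxState, oscState]
  have hGd : ∀ j, G j j = s • (Complex.I * ((q * (rootApprox m (c j j) * S.x j) : ℝ) : ℂ)) •
      ket (reg 1 (bits n j) (bits n j)) := by
    intro j
    simp only [G, lt_irrefl, if_false, smul_smul]
    congr 1
    push_cast; ring
  have hGo : ∀ j, ∀ k ∈ Finset.Ioi j, G j k + G k j =
      s • (Complex.I * ((q * (rootApprox m (c j k) * (S.x j - S.x k)) : ℝ) : ℂ)) •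
        ket (reg 1 (bits n j) (bits n k)) := by
    intro j k hk
    rw [Finset.mem_Ioi] at hk
    simp only [G, if_neg hk.asymm, if_pos hk, smul_smul, smul_neg, ← sub_eq_add_neg, ← sub_smul]
    congr 1
    push_cast; ring
  rw [Finset.sum_congr rfl fun j _ => hGd j,
    Finset.sum_congr rfl fun j _ => Finset.sum_congr rfl (hGo j)]
  simp only [← Finset.smul_sum]
  have hpow : ((μ * (1 / √2) ^ (Nat.clog 2 d + 1) : ℝ) : ℂ) = μ * (s ^ Nat.clog 2 d * s) := by
    rw [← hs, ← pow_succ]; push_cast; ring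
  rw [hpow, mul_smul, mul_smul]
  congr 2
  simp only [smul_add, Finset.smul_sum, smul_smul]
  rw [add_assoc]
  congr 2
  ext1 j
  congr 1
  push_cast; ring

theorem norm_approxState_sub_le (S : OscillatorSystem N) {n d m : ℕ} (hN : N ≤ 2 ^ n)
    {mMax κMax α β E : ℝ} (h : S.HasParams d mMax κMax α β E) (hd : 1 ≤ d) (hm : 0 ≤ mMax)
    (hκ : 0 ≤ κMax) (hE : 0 < E) (hM : 0 < maxEnergy mMax κMax α β) {b : Fin N → ℕ → Fin 2}
    {c : Fin N → Fin N → ℕ → Fin 2} (hb : ∀ j, S.m j = mMax * Real.ofDigits (b j))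
    (hc : ∀ j k, S.κ j k = κMax * Real.ofDigits (c j k)) {μ : ℝ} (hμ : 0 ≤ μ) :
    ‖WithLp.toLp 2 ((((μ * (1 / √2) ^ (Nat.clog 2 d + 1) : ℝ) : ℂ) •
        approxState S n m (√mMax / √(2 * maxEnergy mMax κMax α β))
          (√κMax / √(2 * maxEnergy mMax κMax α β)) b c) -
      ((μ * √(E / (2 * 2 ^ Nat.clog 2 d * maxEnergy mMax κMax α β)) : ℝ) : ℂ) •
        S.initialState n)‖ ≤ μ * (2 * (2 ^ m)⁻¹) := by
  set M := maxEnergy mMax κMax α β with hMdef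
  set t : ℝ := 2 * (2 ^ m)⁻¹ with ht
  have ht0 : 0 ≤ t := by positivity
  set lam : ℝ := (1 / √2) ^ (Nat.clog 2 d + 1) with hlam
  have hlam2 : lam ^ 2 = 1 / (2 * 2 ^ Nat.clog 2 d) := by
    rw [hlam, ← pow_mul, mul_comm _ 2, pow_mul, div_pow, Real.sq_sqrt (by norm_num), one_pow,
      div_pow, one_pow, pow_succ, mul_comm]
  have hlam0 : 0 ≤ lam := by positivity
  have hpre : √(E / (2 * 2 ^ Nat.clog 2 d * M)) * (1 / √(2 * S.energy)) = lam / √(2 * M) := by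
    rw [h.energy_eq, ← Real.sqrt_sq (show 0 ≤ lam / √(2 * M) by positivity), div_pow,
      Real.sq_sqrt (by positivity), hlam2, one_div (√(2 * E)), ← Real.sqrt_inv,
      ← Real.sqrt_mul (by positivity)]
    congr 1
    field_simp
  have hmr : ∀ j, √(S.m j) = √mMax * √(Real.ofDigits (b j)) := fun j => by
    rw [hb, Real.sqrt_mul hm]
  have hκr : ∀ j k, √(S.κ j k) = √κMax * √(Real.ofDigits (c j k)) := fun j k => by
    rw [hc, Real.sqrt_mul hκ]
  have hkey : ((μ * lam : ℝ) : ℂ) • approxState S n m (√mMax / √(2 * M)) (√κMax / √(2 * M)) b c -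
      ((μ * √(E / (2 * 2 ^ Nat.clog 2 d * M)) : ℝ) : ℂ) • S.initialState n =
      ((μ * (lam / √(2 * M)) : ℝ) : ℂ) • oscState n
        (fun j => ((√mMax * ((rootApprox m (b j) - √(Real.ofDigits (b j))) * S.v j) : ℝ) : ℂ))
        (fun j => Complex.I *
          ((√κMax * ((rootApprox m (c j j) - √(Real.ofDigits (c j j))) * S.x j) : ℝ) : ℂ))
        fun j k => Complex.I * ((√κMax *
          ((rootApprox m (c j k) - √(Real.ofDigits (c j k))) * (S.x j - S.x k)) : ℝ) : ℂ) := by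
    have hpre' : ((μ * √(E / (2 * 2 ^ Nat.clog 2 d * M)) : ℝ) : ℂ) *
        ((1 / √(2 * S.energy) : ℝ) : ℂ) = ((μ * (lam / √(2 * M)) : ℝ) : ℂ) := by
      rw [← Complex.ofReal_mul, mul_assoc, hpre]
    rw [initialState_eq, approxState, smul_oscState, smul_oscState, smul_oscState, oscState_sub]
    simp only [Complex.ofReal_mul (1 / √(2 * S.energy))]
    congr 1
    · ext1 j
      simp only [Pi.sub_apply, Pi.smul_apply, smul_eq_mul]
      rw [← mul_assoc (((μ * √(E / (2 * 2 ^ Nat.clog 2 d * M)) : ℝ) : ℂ)), hpre', hmr]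
      push_cast; ring
    · ext1 j
      simp only [Pi.sub_apply, Pi.smul_apply, smul_eq_mul]
      rw [mul_left_comm (((μ * √(E / (2 * 2 ^ Nat.clog 2 d * M)) : ℝ) : ℂ)),
        ← mul_assoc (((μ * √(E / (2 * 2 ^ Nat.clog 2 d * M)) : ℝ) : ℂ)), hpre', hκr]
      push_cast; ring
    · ext j k
      simp only [Pi.sub_apply, Pi.smul_apply, smul_eq_mul]
      rw [mul_left_comm (((μ * √(E / (2 * 2 ^ Nat.clog 2 d * M)) : ℝ) : ℂ)),
        ← mul_assoc (((μ * √(E / (2 * 2 ^ Nat.clog 2 d * M)) : ℝ) : ℂ)), hpre', hκr]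
      push_cast; ring
  rw [hkey, WithLp.toLp_smul, norm_smul, Complex.norm_real, Real.norm_eq_abs,
    abs_of_nonneg (by positivity)]
  have hroot : ∀ c : ℕ → Fin 2, (rootApprox m c - √(Real.ofDigits c)) ^ 2 ≤ t ^ 2 := fun c => by
    rw [← sq_abs]
    exact pow_le_pow_left₀ (abs_nonneg _) (abs_rootApprox_sub_sqrt_le m c) 2
  have hspring : ∀ j k, κMax * (rootApprox m (c j k) - √(Real.ofDigits (c j k))) ^ 2 ≤
      t ^ 2 * if S.κ j k = 0 then 0 else κMax := by
    intro j k
    split_ifs with h0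
    · rw [hc, mul_eq_zero] at h0
      rcases h0 with h0 | h0
      · simp [h0]
      · simp [rootApprox_eq_zero h0, h0]
    · rw [mul_comm]
      exact mul_le_mul_of_nonneg_right (hroot _) hκ
  have hnorm : ‖WithLp.toLp 2 (oscState n
        (fun j => ((√mMax * ((rootApprox m (b j) - √(Real.ofDigits (b j))) * S.v j) : ℝ) : ℂ))
        (fun j => Complex.I *
          ((√κMax * ((rootApprox m (c j j) - √(Real.ofDigits (c j j))) * S.x j) : ℝ) : ℂ))
        fun j k => Complex.I * ((√κMax *
          ((rootApprox m (c j k) - √(Real.ofDigits (c j k))) * (S.x j - S.x k)) : ℝ) : ℂ))‖ ^ 2 ≤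
      t ^ 2 * (2 * d * (2 * M)) := by
    rw [norm_sq_oscState hN]
    simp only [norm_mul, Complex.norm_I, one_mul, Complex.norm_real, mul_pow, Real.norm_eq_abs,
      sq_abs, Real.sq_sqrt hm, Real.sq_sqrt hκ]
    have e1 : ∑ j, mMax * ((rootApprox m (b j) - √(Real.ofDigits (b j))) ^ 2 * S.v j ^ 2) ≤
        t ^ 2 * (mMax * ‖S.v‖ ^ 2) := by
      rw [EuclideanSpace.norm_sq_eq, Finset.mul_sum, Finset.mul_sum]
      refine Finset.sum_le_sum fun j _ => ?_
      rw [Real.norm_eq_abs, sq_abs, mul_left_comm]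
      exact mul_le_mul_of_nonneg_right (hroot _) (by positivity)
    have e2 : ∑ j, κMax * ((rootApprox m (c j j) - √(Real.ofDigits (c j j))) ^ 2 * S.x j ^ 2) +
        ∑ j, ∑ k ∈ Finset.Ioi j, κMax *
          ((rootApprox m (c j k) - √(Real.ofDigits (c j k))) ^ 2 * (S.x j - S.x k) ^ 2) ≤
        t ^ 2 * (2 * (d * κMax * ‖S.x‖ ^ 2)) := by
      refine le_trans ?_ (mul_le_mul_of_nonneg_left (spring_energy_le S h.sparse hκ) (sq_nonneg t))
      rw [mul_add, Finset.mul_sum, Finset.mul_sum]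
      refine add_le_add (Finset.sum_le_sum fun j _ => ?_) (Finset.sum_le_sum fun j _ => ?_)
      · rw [← mul_assoc, ← mul_assoc]
        exact mul_le_mul_of_nonneg_right (hspring _ _) (sq_nonneg _)
      · rw [Finset.mul_sum]
        refine Finset.sum_le_sum fun k _ => ?_
        rw [← mul_assoc, ← mul_assoc]
        exact mul_le_mul_of_nonneg_right (hspring _ _) (sq_nonneg _)
    have hd' : (1 : ℝ) ≤ d := by exact_mod_cast hd
    have e3 : mMax * ‖S.v‖ ^ 2 ≤ 2 * d * (mMax * ‖S.v‖ ^ 2) :=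
      le_mul_of_one_le_left (by positivity) (by linarith)
    have e4 := mul_le_mul_of_nonneg_left e3 (sq_nonneg t)
    have e5 : 2 * M = mMax * ‖S.v‖ ^ 2 + κMax * ‖S.x‖ ^ 2 := by
      rw [hMdef, maxEnergy, h.norm_v, h.norm_x]; ring
    rw [e5]
    linarith
  have hd2 : (d : ℝ) ≤ 2 ^ Nat.clog 2 d := by
    exact_mod_cast Nat.le_pow_clog (by norm_num) d
  rw [mul_assoc]
  refine mul_le_mul_of_nonneg_left ?_ hμ
  refine abs_le_of_sq_le_sq' ?_ ht0 |>.2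
  rw [mul_pow, div_pow, hlam2, Real.sq_sqrt (by positivity)]
  calc _ ≤ 1 / (2 * 2 ^ Nat.clog 2 d) / (2 * M) * (t ^ 2 * (2 * d * (2 * M))) :=
        mul_le_mul_of_nonneg_left hnorm (by positivity)
    _ = t ^ 2 * (d / 2 ^ Nat.clog 2 d) := by field_simp
    _ ≤ t ^ 2 * 1 := by
        refine mul_le_mul_of_nonneg_left ?_ (sq_nonneg t)
        rw [div_le_one (by positivity)]; exact hd2
    _ = t ^ 2 := mul_one _

end Prepared

/-! ## Amplitude amplification -/

section Amplification

theorem abs_sub_le_pi_mul_abs_sin_sub {x y : ℝ} (hx : 0 ≤ x) (hx' : x ≤ Real.pi / 2) (hy : 0 ≤ y)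
    (hy' : y ≤ Real.pi / 6) : |x - y| ≤ Real.pi * |Real.sin x - Real.sin y| := by
  have hpi := Real.pi_pos
  rw [Real.sin_sub_sin, abs_mul, abs_mul, abs_of_nonneg (show (0 : ℝ) ≤ 2 by norm_num)]
  have h1 : 2 / Real.pi * |(x - y) / 2| ≤ |Real.sin ((x - y) / 2)| := by
    apply Real.mul_abs_le_abs_sin
    rw [abs_le]; constructor <;> linarith
  have h2 : 1 / 2 ≤ |Real.cos ((x + y) / 2)| := by
    rw [← Real.cos_pi_div_three]
    refine le_trans ?_ (le_abs_self _)
    exact Real.cos_le_cos_of_nonneg_of_le_pi (by linarith) (by linarith) (by linarith)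
  rw [abs_div, abs_of_nonneg (show (0 : ℝ) ≤ 2 by norm_num)] at h1
  have h3 : 2 * (2 / Real.pi * (|x - y| / 2)) * (1 / 2) ≤
      2 * |Real.sin ((x - y) / 2)| * |Real.cos ((x + y) / 2)| := by gcongr
  calc |x - y| = Real.pi * (2 * (2 / Real.pi * (|x - y| / 2)) * (1 / 2)) := by field_simp
    _ ≤ _ := mul_le_mul_of_nonneg_left h3 hpi.le

variable {H : Type*} [NormedAddCommGroup H] [InnerProductSpace ℂ H]

/-- One round of amplitude amplification: the states in the range of `P` change sign, followed by
the reflection about `φ`. -/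
def amplify (P : H →ₗ[ℂ] H) (φ v : H) : H :=
  (2 * inner ℂ φ (v - (2 : ℂ) • P v)) • φ - (v - (2 : ℂ) • P v)

theorem amplify_iterate {P : H →ₗ[ℂ] H} {φ u v : H} {θ : ℝ} (hu : P u = u) (hv : P v = 0)
    (hφ : φ = ((Real.sin θ : ℝ) : ℂ) • u + ((Real.cos θ : ℝ) : ℂ) • v)
    (hφu : inner ℂ φ u = ((Real.sin θ : ℝ) : ℂ)) (hφv : inner ℂ φ v = ((Real.cos θ : ℝ) : ℂ))
    (k : ℕ) : (amplify P φ)^[k] φ = ((Real.sin ((2 * k + 1) * θ) : ℝ) : ℂ) • u +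
      ((Real.cos ((2 * k + 1) * θ) : ℝ) : ℂ) • v := by
  have hstep : ∀ x : ℝ, amplify P φ (((Real.sin x : ℝ) : ℂ) • u + ((Real.cos x : ℝ) : ℂ) • v) =
      ((Real.sin (x + 2 * θ) : ℝ) : ℂ) • u + ((Real.cos (x + 2 * θ) : ℝ) : ℂ) • v := by
    intro x
    have h1 : ((Real.sin x : ℝ) : ℂ) • u + ((Real.cos x : ℝ) : ℂ) • v -
        (2 : ℂ) • P (((Real.sin x : ℝ) : ℂ) • u + ((Real.cos x : ℝ) : ℂ) • v) =
        (-((Real.sin x : ℝ) : ℂ)) • u + ((Real.cos x : ℝ) : ℂ) • v := by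
      rw [map_add, map_smul, map_smul, hu, hv]
      module
    rw [amplify, h1, inner_add_right, inner_smul_right, inner_smul_right, hφu, hφv, hφ]
    have e1 : Real.sin (x + 2 * θ) = 2 * (-Real.sin x * Real.sin θ + Real.cos x * Real.cos θ) *
        Real.sin θ + Real.sin x := by
      rw [Real.sin_add, Real.sin_two_mul, Real.cos_two_mul']
      linear_combination (Real.sin x) * Real.sin_sq_add_cos_sq θ
    have e2 : Real.cos (x + 2 * θ) = 2 * (-Real.sin x * Real.sin θ + Real.cos x * Real.cos θ) *
        Real.cos θ - Real.cos x := by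
      rw [Real.cos_add, Real.sin_two_mul, Real.cos_two_mul]
      ring
    rw [e1, e2]
    push_cast
    module
  induction k with
  | zero => simpa using hφ
  | succ k ih =>
    rw [Function.iterate_succ_apply', ih, hstep]
    congr 3 <;> · push_cast; ring_nf

theorem norm_amplify_sub_le {P : H →ₗ[ℂ] H} (hPP : ∀ v, P (P v) = P v)
    (hPs : ∀ u v, inner ℂ (P u) v = inner ℂ u (P v)) {φ ψ : H} (hφ : ‖φ‖ = 1) (hψ : ‖ψ‖ = 1)
    (hPψ : P ψ = ψ) {k : ℕ} (hk : 1 ≤ k) {η : ℝ}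
    (h : ‖P φ - ((Real.sin (Real.pi / (2 * (2 * k + 1))) : ℝ) : ℂ) • ψ‖ ≤ η) :
    ‖(amplify P φ)^[k] φ - ψ‖ ≤ 9 * (2 * k + 1) * η := by
  have hpi := Real.pi_pos
  have hk' : (1 : ℝ) ≤ k := by exact_mod_cast hk
  set K : ℝ := 2 * k + 1 with hK
  have hK3 : 3 ≤ K := by linarith
  set θ : ℝ := Real.pi / (2 * K) with hθ
  have hθ0 : 0 < θ := by positivity
  have hθ6 : θ ≤ Real.pi / 6 := by
    rw [hθ]; gcongr; linarith
  have hKθ : K * θ = Real.pi / 2 := by rw [hθ]; field_simp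
  set a : ℝ := Real.sin θ with ha
  have haK : 1 / K ≤ a := by
    refine le_trans (le_of_eq ?_) (Real.mul_le_sin hθ0.le (by linarith))
    rw [hθ]; field_simp
  have ha0 : 0 < a := lt_of_lt_of_le (by positivity) haK
  set w := P φ with hw
  set b := φ - w with hb
  have hPb : P b = 0 := by rw [hb, map_sub, hw, hPP, sub_self]
  have hφb : inner ℂ φ b = ((‖b‖ ^ 2 : ℝ) : ℂ) := by
    have : inner ℂ w b = 0 := by rw [hw, hPs, hPb, inner_zero_right]
    have h2 : φ = w + b := by rw [hb]; abel
    conv_lhs => rw [h2]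
    rw [inner_add_left, this, zero_add, inner_self_eq_norm_sq_to_K]
    push_cast; rfl
  have hφw : ∀ v, P v = v → inner ℂ φ v = inner ℂ w v := fun v hv => by
    rw [hw, hPs, hv]
  have hpyth : ‖w‖ ^ 2 + ‖b‖ ^ 2 = 1 := by
    have h1 : (inner ℂ φ φ : ℂ) = ((‖w‖ ^ 2 : ℝ) : ℂ) + ((‖b‖ ^ 2 : ℝ) : ℂ) := by
      have h2 : φ = w + b := by rw [hb]; abel
      calc inner ℂ φ φ = inner ℂ φ (w + b) := congrArg _ h2
        _ = _ := by
          rw [inner_add_right, hφb, hφw w (by rw [hw, hPP]), inner_self_eq_norm_sq_to_K]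
          push_cast; rfl
    rw [inner_self_eq_norm_sq_to_K, hφ] at h1
    simp only [Complex.coe_algebraMap, Complex.ofReal_one, one_pow] at h1
    exact_mod_cast h1.symm
  have hw1 : ‖w‖ ≤ 1 := by nlinarith [norm_nonneg w, sq_nonneg ‖b‖]
  set θ' : ℝ := Real.arcsin ‖w‖ with hθ'
  have hsin : Real.sin θ' = ‖w‖ := Real.sin_arcsin (by linarith [norm_nonneg w]) hw1
  have hcos : Real.cos θ' = ‖b‖ := by
    rw [hθ', Real.cos_arcsin, ← hpyth, add_sub_cancel_left, Real.sqrt_sq (norm_nonneg _)]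
  -- the normalized components
  obtain ⟨u, hu, hwu, huw, hun, huψ⟩ : ∃ u : H, P u = u ∧ w = ((‖w‖ : ℝ) : ℂ) • u ∧
      inner ℂ w u = ((‖w‖ : ℝ) : ℂ) ∧ ‖u‖ = 1 ∧ ‖u - ψ‖ ≤ 2 * η / a := by
    have hη0 : 0 ≤ η := (norm_nonneg _).trans h
    by_cases hw0 : w = 0
    · refine ⟨ψ, hPψ, by simp [hw0], by simp [hw0], hψ, ?_⟩
      rw [sub_self, norm_zero]; positivity
    · have hn : ‖w‖ ≠ 0 := norm_ne_zero_iff.2 hw0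
      have hn' : (((‖w‖ : ℝ)) : ℂ) ≠ 0 := by exact_mod_cast hn
      refine ⟨(((‖w‖ : ℝ)) : ℂ)⁻¹ • w, by rw [map_smul, hw, hPP], by rw [smul_inv_smul₀ hn'], ?_,
        ?_, ?_⟩
      · rw [inner_smul_right, inner_self_eq_norm_sq_to_K]
        simp only [Complex.coe_algebraMap]
        field_simp
      · rw [norm_smul, norm_inv, Complex.norm_real, norm_norm, inv_mul_cancel₀ hn]
      · have h1 : (a : ℂ) • ((((‖w‖ : ℝ)) : ℂ)⁻¹ • w - ψ) =
            ((a - ‖w‖ : ℝ) : ℂ) • ((((‖w‖ : ℝ)) : ℂ)⁻¹ • w) + (w - (a : ℂ) • ψ) := by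
          push_cast
          rw [sub_smul, smul_inv_smul₀ hn', smul_sub]; abel
        have h2 : |a - ‖w‖| ≤ η := by
          have h3 := abs_norm_sub_norm_le w ((a : ℂ) • ψ)
          rw [norm_smul, Complex.norm_real, hψ, mul_one, Real.norm_eq_abs, abs_of_pos ha0,
            abs_sub_comm] at h3
          exact h3.trans h
        have h4 := congrArg norm h1
        rw [norm_smul, Complex.norm_real, Real.norm_eq_abs, abs_of_pos ha0] at h4
        rw [le_div_iff₀ ha0, mul_comm, h4]
        refine (norm_add_le _ _).trans ?_
        rw [norm_smul, norm_smul, norm_inv, Complex.norm_real, Complex.norm_real, norm_norm,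
          inv_mul_cancel₀ hn, mul_one, Real.norm_eq_abs]
        linarith
  obtain ⟨v, hv, hbv, hφv, hvn⟩ : ∃ v : H, P v = 0 ∧ b = ((‖b‖ : ℝ) : ℂ) • v ∧
      inner ℂ φ v = ((‖b‖ : ℝ) : ℂ) ∧ ‖v‖ ≤ 1 := by
    by_cases hb0 : b = 0
    · exact ⟨0, map_zero _, by simp [hb0], by simp [hb0], by simp⟩
    · have hn : ‖b‖ ≠ 0 := norm_ne_zero_iff.2 hb0
      have hn' : (((‖b‖ : ℝ)) : ℂ) ≠ 0 := by exact_mod_cast hn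
      refine ⟨(((‖b‖ : ℝ)) : ℂ)⁻¹ • b, by rw [map_smul, hPb, smul_zero],
        by rw [smul_inv_smul₀ hn'], ?_, ?_⟩
      · rw [inner_smul_right, hφb]
        push_cast
        field_simp
      · rw [norm_smul, norm_inv, Complex.norm_real, norm_norm, inv_mul_cancel₀ hn]
  have hφd : φ = ((Real.sin θ' : ℝ) : ℂ) • u + ((Real.cos θ' : ℝ) : ℂ) • v := by
    rw [hsin, hcos, ← hwu, ← hbv]
    exact (add_sub_cancel w φ).symm
  have hφu : inner ℂ φ u = ((Real.sin θ' : ℝ) : ℂ) := by rw [hφw u hu, huw, hsin]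
  rw [← hcos] at hφv
  have hit := amplify_iterate hu hv hφd hφu hφv k
  rw [hit]
  have hθθ : |θ' - θ| ≤ Real.pi * η := by
    refine (abs_sub_le_pi_mul_abs_sin_sub (Real.arcsin_nonneg.2 (norm_nonneg _))
      (Real.arcsin_le_pi_div_two _) hθ0.le hθ6).trans ?_
    refine mul_le_mul_of_nonneg_left ?_ hpi.le
    rw [hsin, ← ha]
    have h3 := abs_norm_sub_norm_le w ((a : ℂ) • ψ)
    rw [norm_smul, Complex.norm_real, hψ, mul_one, Real.norm_eq_abs, abs_of_pos ha0] at h3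
    exact h3.trans h
  have hang : |K * θ' - K * θ| ≤ K * (Real.pi * η) := by
    rw [← mul_sub, abs_mul, abs_of_nonneg (by linarith)]
    exact mul_le_mul_of_nonneg_left hθθ (by linarith)
  have hs : |Real.sin (K * θ') - 1| ≤ K * (Real.pi * η) := by
    have := Real.abs_sin_sub_sin_le (K * θ') (K * θ)
    rw [hKθ, Real.sin_pi_div_two, ← hKθ] at this
    exact this.trans hang
  have hc : |Real.cos (K * θ')| ≤ K * (Real.pi * η) := by
    have := Real.abs_cos_sub_cos_le (K * θ') (K * θ)
    rw [hKθ, Real.cos_pi_div_two, ← hKθ, sub_zero] at this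
    exact this.trans hang
  have hdec : ((Real.sin (K * θ') : ℝ) : ℂ) • u + ((Real.cos (K * θ') : ℝ) : ℂ) • v - ψ =
      ((Real.sin (K * θ') - 1 : ℝ) : ℂ) • u + ((Real.cos (K * θ') : ℝ) : ℂ) • v + (u - ψ) := by
    push_cast
    rw [sub_smul, one_smul]; abel
  rw [hdec]
  have hη0 : 0 ≤ η := (norm_nonneg _).trans h
  have n1 : ‖((Real.sin (K * θ') - 1 : ℝ) : ℂ) • u‖ ≤ K * (Real.pi * η) := by
    rw [norm_smul, Complex.norm_real, hun, mul_one]; exact hs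
  have n2 : ‖((Real.cos (K * θ') : ℝ) : ℂ) • v‖ ≤ K * (Real.pi * η) := by
    rw [norm_smul, Complex.norm_real]
    exact (mul_le_of_le_one_right (norm_nonneg _) hvn).trans hc
  have n3 : 2 * η / a ≤ 2 * K * η := by
    rw [div_le_iff₀ ha0]
    rw [div_le_iff₀ (by linarith)] at haK
    nlinarith
  have hpi4 : Real.pi < 3.15 := Real.pi_lt_d2
  have n4 := norm_add₃_le (a := ((Real.sin (K * θ') - 1 : ℝ) : ℂ) • u)
    (b := ((Real.cos (K * θ') : ℝ) : ℂ) • v) (c := u - ψ)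
  have hKη : 0 ≤ K * η := mul_nonneg (by linarith) hη0
  nlinarith

end Amplification

/-! ## Circuits for amplitude amplification -/

section PadZero

variable {n : ℕ} {ι κ M A W : Type} [Fintype ι] [DecidableEq ι] [Fintype κ] [DecidableEq κ]
  [Fintype M] [DecidableEq M] [Fintype A] [DecidableEq A] [Fintype W] [DecidableEq W]

theorem padZero_eq_insertState {w : ℕ} (e : ι ↪ Fin w) (φ : QState ι) :
    padZero e φ = insertState e 0 φ := by
  funext u
  by_cases h : ∀ i, i ∉ Set.range e → u i = (0 : Fin w → Fin 2) i
  · rw [insertState_apply _ _ _ _ h]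
    simp only [padZero]
    exact if_pos h
  · rw [insertState_apply_zero _ _ _ _ h]
    simp only [padZero]
    exact if_neg h

theorem insertState_zero_trans (e : ι ↪ W) (f : κ ↪ ι) (φ : QState κ) :
    insertState e 0 (insertState f 0 φ) = insertState (f.trans e) 0 φ := by
  rw [state_eq_sum φ]
  simp only [map_sum, map_smul, insertState_ket]
  refine Finset.sum_congr rfl fun u _ => ?_
  congr 2
  apply eq_extend (f.trans e)
  · funext k
    simp [e.injective.extend_apply, f.injective.extend_apply]
  · intro i hi
    by_cases h : i ∈ Set.range e
    · obtain ⟨j, rfl⟩ := h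
      rw [e.injective.extend_apply, extend_off]
      · rfl
      · rintro ⟨k, rfl⟩; exact hi ⟨k, rfl⟩
    · rw [extend_off _ _ _ _ h]

theorem norm_insertState (e : ι ↪ W) (φ : QState ι) :
    ‖WithLp.toLp 2 (insertState e 0 φ)‖ = ‖WithLp.toLp 2 φ‖ := by
  rw [EuclideanSpace.norm_eq, EuclideanSpace.norm_eq]
  congr 1
  symm
  apply Finset.sum_of_injOn (fun u => Function.extend e u 0)
  · intro u _ v _ h
    have := congrArg (fun s => s ∘ e) h
    simpa only [extend_comp] using this
  · intro x _; simp
  · intro u _ hu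
    simp only
    rw [insertState_apply_zero, norm_zero, zero_pow two_ne_zero]
    intro h
    exact hu ⟨u ∘ e, by simp, (eq_extend e rfl h).symm⟩
  · intro u _
    simp only
    rw [insertState_apply _ _ _ _ (extend_off e u 0), extend_comp]

theorem norm_mulVec_of_unitary {U : QOp W} (hU : U ∈ Matrix.unitaryGroup (W → Fin 2) ℂ)
    (φ : QState W) : ‖WithLp.toLp 2 (U *ᵥ φ)‖ = ‖WithLp.toLp 2 φ‖ := by
  rw [Matrix.mem_unitaryGroup_iff', Matrix.star_eq_conjTranspose] at hU
  have key : ∀ ψ : QState W, ((‖WithLp.toLp 2 ψ‖ : ℝ) : ℂ) ^ 2 = star ψ ⬝ᵥ ψ := by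
    intro ψ
    have := inner_self_eq_norm_sq_to_K (𝕜 := ℂ) (WithLp.toLp 2 ψ)
    rw [EuclideanSpace.inner_eq_star_dotProduct] at this
    rw [dotProduct_comm]
    exact this.symm
  have h1 := key (U *ᵥ φ)
  rw [Matrix.star_mulVec, Matrix.dotProduct_mulVec, Matrix.vecMul_vecMul, hU, Matrix.vecMul_one,
    ← key φ] at h1
  have h2 : ‖WithLp.toLp 2 (U *ᵥ φ)‖ ^ 2 = ‖WithLp.toLp 2 φ‖ ^ 2 := by exact_mod_cast h1
  exact (pow_left_inj₀ (norm_nonneg _) (norm_nonneg _) two_ne_zero).1 h2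

theorem norm_ket (s : W → Fin 2) : ‖WithLp.toLp 2 (ket s)‖ = 1 := by
  simp [ket]

/-- A unitary operator whose block is unitary maps the ancillas from zero to zero. -/
theorem mulVec_ket_eq_insertState {U : QOp (M ⊕ A)}
    (hU : U ∈ Matrix.unitaryGroup (M ⊕ A → Fin 2) ℂ)
    (hB : blk U ∈ Matrix.unitaryGroup (M → Fin 2) ℂ) :
    U *ᵥ ket 0 = insertState Function.Embedding.inl 0 (blk U *ᵥ ket 0) := by
  have h0 : (0 : M ⊕ A → Fin 2) = Sum.elim (0 : M → Fin 2) (0 : A → Fin 2) := by ext i; rcases i with i | i <;> rfl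
  have hent : ∀ v : M → Fin 2, (blk U *ᵥ ket 0) v = (U *ᵥ ket 0) (Sum.elim v 0) := by
    intro v; rw [blk_mulVec_ket, h0]
  have h1 : ∑ u, ‖(U *ᵥ ket 0) u‖ ^ 2 = 1 := by
    have := norm_mulVec_of_unitary hU (ket 0)
    rw [norm_ket, EuclideanSpace.norm_eq, Real.sqrt_eq_one] at this
    exact this
  have h2 : ∑ v, ‖(U *ᵥ ket 0) (Sum.elim v 0)‖ ^ 2 = 1 := by
    have := norm_mulVec_of_unitary hB (ket 0)
    rw [norm_ket, EuclideanSpace.norm_eq, Real.sqrt_eq_one] at this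
    rw [← this]
    exact Finset.sum_congr rfl fun v _ => by rw [← hent]
  funext u
  by_cases hu : ∀ i, i ∉ Set.range (Function.Embedding.inl : M ↪ M ⊕ A) →
      u i = (0 : M ⊕ A → Fin 2) i
  · rw [insertState_apply _ _ _ _ hu, hent]
    congr 1
    ext i
    rcases i with i | i
    · rfl
    · rw [hu (Sum.inr i) (by simp)]; rfl
  · rw [insertState_apply_zero _ _ _ _ hu]
    by_contra hne
    have h3 : ∑ x ∈ Finset.univ.image (fun v : M → Fin 2 => (Sum.elim v 0 : M ⊕ A → Fin 2)),
        ‖(U *ᵥ ket 0) x‖ ^ 2 < ∑ u, ‖(U *ᵥ ket 0) u‖ ^ 2 := by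
      refine Finset.sum_lt_sum_of_subset (Finset.subset_univ _) (Finset.mem_univ u) ?_ ?_ ?_
      · intro hmem
        obtain ⟨v, -, rfl⟩ := Finset.mem_image.1 hmem
        apply hu
        rintro (i | i) hi
        · exact absurd ⟨i, rfl⟩ hi
        · rfl
      · exact pow_pos (norm_pos_iff.2 hne) 2
      · intro _ _ _; positivity
    rw [Finset.sum_image (fun a _ b _ h => sumElim_injective h), h1, h2] at h3
    exact lt_irrefl _ h3

theorem BlockImpl.exists_circuit {q g : ℕ} {T : OracleData n → QOp W} (h : BlockImpl q g T)
    (hT : ∀ O, T O ∈ Matrix.unitaryGroup (W → Fin 2) ℂ) :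
    ∃ (w : ℕ) (c : QCircuit n w) (e : W ↪ Fin w), c.queries ≤ q ∧ c.gates ≤ g ∧
      ∀ O, c.output O = insertState e 0 (T O *ᵥ ket 0) := by
  obtain ⟨A, _, _, G, -, hG, hGT⟩ := h
  obtain ⟨c, hq, hg, hc⟩ := (hG.lift (Fintype.equivFin (W ⊕ A)).toEmbedding).exists_circuit
  refine ⟨_, c, Function.Embedding.inl.trans (Fintype.equivFin (W ⊕ A)).toEmbedding, hq, hg,
    fun O => ?_⟩
  rw [hc, onW_mulVec_ket, ← insertState_zero_trans, ← hGT]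
  congr 1
  exact mulVec_ket_eq_insertState (hG.mem_unitary O) (by rw [hGT]; exact hT O)

end PadZero

section Rounds

variable {n : ℕ} {M A W : Type} [Fintype M] [DecidableEq M] [Fintype A] [DecidableEq A]
  [Fintype W] [DecidableEq W]

/-- The sign flip of the inputs that vanish on `S`, or of the others if `c` is `true`. -/
def zeroFlip (S : Finset W) (c : Bool) : QOp W :=
  Matrix.diagonal fun x => if decide (∀ i ∈ S, x i = 0) ^^ c then -1 else 1

theorem BlockImpl.flipZero (S : Finset W) (c : Bool) :
    BlockImpl (n := n) 0 (42 * (Fintype.card W + 2) + 4) fun _ => zeroFlip S c := by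
  obtain ⟨l, hl, hlen, hf⟩ := exists_slp_zero S c
  have := S.card_le_univ
  refine ((BlockImpl.phaseFlip hl hf).mono (g' := 42 * (Fintype.card W + 2) + 4) le_rfl
    (by omega)).congr fun _ => ?_
  unfold zeroFlip
  congr!

theorem zeroFlip_mem_unitary (S : Finset W) (c : Bool) :
    zeroFlip S c ∈ Matrix.unitaryGroup (W → Fin 2) ℂ := by
  rw [Matrix.mem_unitaryGroup_iff, Matrix.star_eq_conjTranspose, zeroFlip,
    Matrix.diagonal_conjTranspose, Matrix.diagonal_mul_diagonal, ← Matrix.diagonal_one]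
  congr 1
  ext x
  simp only [Pi.star_apply]
  split_ifs <;> simp

theorem zeroFlip_univ_mulVec (v : QState W) :
    zeroFlip Finset.univ true *ᵥ v = (2 * v 0) • ket 0 - v := by
  ext x
  rw [zeroFlip, Matrix.mulVec_diagonal]
  simp only [Pi.sub_apply, Pi.smul_apply, ket_apply, smul_eq_mul]
  by_cases hx : x = 0
  · subst hx; simp; ring
  · have : ¬ ∀ i ∈ Finset.univ, x i = 0 := fun h => hx (funext fun i => h i (Finset.mem_univ i))
    rw [if_neg hx, decide_eq_false this]
    simp

/-- The projection onto the states that are zero on the wires `S`. -/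
def zeroProj (S : Finset W) : EuclideanSpace ℂ (W → Fin 2) →ₗ[ℂ] EuclideanSpace ℂ (W → Fin 2) :=
  Matrix.toLpLin 2 2 (Matrix.diagonal fun x => if ∀ i ∈ S, x i = 0 then 1 else 0)

theorem zeroProj_apply (S : Finset W) (v : EuclideanSpace ℂ (W → Fin 2)) (x : W → Fin 2) :
    zeroProj S v x = if ∀ i ∈ S, x i = 0 then v x else 0 := by
  rw [zeroProj, Matrix.toLpLin_apply]
  simp only [Matrix.mulVec_diagonal]
  split_ifs <;> simp

theorem toLp_zeroFlip_mulVec (S : Finset W) (v : QState W) :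
    WithLp.toLp 2 (zeroFlip S false *ᵥ v) =
      WithLp.toLp 2 v - (2 : ℂ) • zeroProj S (WithLp.toLp 2 v) := by
  ext x
  simp only [PiLp.sub_apply, PiLp.smul_apply, zeroProj_apply]
  rw [zeroFlip, Matrix.mulVec_diagonal]
  by_cases h : ∀ i ∈ S, x i = 0
  · rw [if_pos h, decide_eq_true h]; simp; ring
  · rw [if_neg h, decide_eq_false h]; simp

theorem toLp_round_mulVec {U : QOp W} (hU : U ∈ Matrix.unitaryGroup (W → Fin 2) ℂ) (S : Finset W)
    (v : QState W) :
    WithLp.toLp 2 ((U * zeroFlip Finset.univ true * Uᴴ * zeroFlip S false) *ᵥ v) =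
      amplify (zeroProj S) (WithLp.toLp 2 (U *ᵥ ket 0)) (WithLp.toLp 2 v) := by
  rw [amplify, ← toLp_zeroFlip_mulVec, ← Matrix.mulVec_mulVec]
  generalize zeroFlip S false *ᵥ v = y
  rw [mul_assoc, ← Matrix.mulVec_mulVec, ← Matrix.mulVec_mulVec, zeroFlip_univ_mulVec,
    Matrix.mulVec_sub, Matrix.mulVec_smul, Matrix.mulVec_mulVec _ U Uᴴ,
    ← Matrix.star_eq_conjTranspose, Matrix.mem_unitaryGroup_iff.1 hU, Matrix.one_mulVec,
    EuclideanSpace.inner_eq_star_dotProduct]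
  have : (star U *ᵥ y) 0 = y ⬝ᵥ star (U *ᵥ ket 0) := by
    rw [Matrix.mulVec, dotProduct_comm]
    congr 1
    funext x
    rw [Pi.star_apply, mulVec_ket_apply]; rfl
  rw [this]
  rfl

theorem BlockImpl.amplified {q g : ℕ} {F : OracleData n → QOp M} (h : BlockImpl q g F) {k : ℕ}
    (hk : 1 ≤ k) :
    ∃ (W : Type) (_ : Fintype W) (_ : DecidableEq W) (f : M ↪ W) (T : OracleData n → QOp W),
      BlockImpl (k * (2 * q) + q)
        (k * (2 * g + 2 * (42 * (Fintype.card M + g + 2) + 4)) + g) T ∧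
      (∀ O, T O ∈ Matrix.unitaryGroup (W → Fin 2) ℂ) ∧
      ∀ O ψ η, ‖WithLp.toLp 2 ψ‖ = 1 →
        ‖WithLp.toLp 2 (F O *ᵥ ket 0 -
          ((Real.sin (Real.pi / (2 * (2 * k + 1))) : ℝ) : ℂ) • ψ)‖ ≤ η →
        ‖WithLp.toLp 2 (T O *ᵥ ket 0 - insertState f 0 ψ)‖ ≤ 9 * (2 * k + 1) * η := by
  obtain ⟨A, _, _, G, hA, hG, hF⟩ := h
  set S : Finset (M ⊕ A) := Finset.univ.map Function.Embedding.inr with hS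
  have hround : BlockImpl (2 * q) (2 * g + 2 * (42 * (Fintype.card M + g + 2) + 4))
      fun O => G O * zeroFlip Finset.univ true * (G O)ᴴ * zeroFlip S false := by
    refine (((hG.block.mul (BlockImpl.flipZero Finset.univ true)).mul hG.adj.block).mul
      (BlockImpl.flipZero S false)).mono (by omega) ?_
    rw [Fintype.card_sum]
    omega
  have hpow : ∀ j : ℕ, BlockImpl (j * (2 * q))
      (j * (2 * g + 2 * (42 * (Fintype.card M + g + 2) + 4)))
      fun O => (G O * zeroFlip Finset.univ true * (G O)ᴴ * zeroFlip S false) ^ j := by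
    intro j
    induction j with
    | zero => simpa using BlockImpl.one (n := n) (M := M ⊕ A)
    | succ j ih =>
      refine ((ih.mul hround).mono (Nat.succ_mul _ _).ge (Nat.succ_mul _ _).ge).congr
        fun O => (pow_succ _ _).symm
  have hiter : ∀ O (j : ℕ), WithLp.toLp 2 (((G O * zeroFlip Finset.univ true * (G O)ᴴ * zeroFlip S false) ^ j
      * G O) *ᵥ ket 0) = (amplify (zeroProj S) (WithLp.toLp 2 (G O *ᵥ ket 0)))^[j]
        (WithLp.toLp 2 (G O *ᵥ ket 0)) := by
    intro O j
    induction j with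
    | zero => simp
    | succ j ih =>
      rw [Function.iterate_succ_apply', ← ih, ← toLp_round_mulVec (hG.mem_unitary O),
        Matrix.mulVec_mulVec, pow_succ']
      simp only [mul_assoc]
  have hzero : ∀ (x : M ⊕ A → Fin 2), (∀ i ∈ S, x i = 0) ↔
      ∀ i, i ∉ Set.range (Function.Embedding.inl : M ↪ M ⊕ A) →
        x i = (0 : M ⊕ A → Fin 2) i := by
    intro x
    constructor
    · rintro hx (i | i) hi
      · exact absurd ⟨i, rfl⟩ hi
      · exact hx _ (by simp [hS])
    · intro hx i hi
      obtain ⟨j, -, rfl⟩ := Finset.mem_map.1 hi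
      exact hx _ (by simp)
  refine ⟨M ⊕ A, inferInstance, inferInstance, Function.Embedding.inl, _,
    (hpow k).mul hG.block, fun O => ?_, fun O ψ η hψ hη => ?_⟩
  · refine mul_mem (pow_mem ?_ k) (hG.mem_unitary O)
    refine mul_mem (mul_mem (mul_mem (hG.mem_unitary O) (zeroFlip_mem_unitary _ _))
      (hG.adj.mem_unitary O)) (zeroFlip_mem_unitary _ _)
  · have hproj : zeroProj S (WithLp.toLp 2 (G O *ᵥ ket 0)) =
        WithLp.toLp 2 (insertState Function.Embedding.inl 0 (F O *ᵥ ket 0)) := by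
      ext x
      rw [zeroProj_apply]
      by_cases hx : ∀ i ∈ S, x i = 0
      · rw [if_pos hx]
        simp only
        rw [insertState_apply _ _ _ _ ((hzero x).1 hx), ← hF, blk_mulVec_ket]
        simp only
        congr 1
        · congr 2
          ext i; rcases i with i | i <;> rfl
        · ext i
          rcases i with i | i
          · rfl
          · rw [hx (Sum.inr i) (by simp [hS])]; rfl
      · rw [if_neg hx]
        simp only
        rw [insertState_apply_zero _ _ _ _ fun h' => hx ((hzero x).2 h')]
    rw [WithLp.toLp_sub, hiter]
    refine norm_amplify_sub_le ?_ ?_ ?_ ?_ ?_ hk ?_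
    · intro v
      ext x
      simp only [zeroProj_apply]
      split_ifs <;> rfl
    · intro u v
      simp only [PiLp.inner_apply, zeroProj_apply]
      refine Finset.sum_congr rfl fun x _ => ?_
      split_ifs <;> simp
    · rw [norm_mulVec_of_unitary (hG.mem_unitary O), norm_ket]
    · rw [norm_insertState, hψ]
    · ext x
      rw [zeroProj_apply]
      by_cases hx : ∀ i ∈ S, x i = 0
      · rw [if_pos hx]
      · rw [if_neg hx]
        simp only
        rw [insertState_apply_zero _ _ _ _ fun h' => hx ((hzero x).2 h')]
    · rw [hproj, ← WithLp.toLp_smul, ← WithLp.toLp_sub, ← map_smul, ← map_sub, norm_insertState]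
      exact hη

end Rounds

/-! ## Choice of parameters -/

section Parameters

theorem natCast_clog_le {N : ℕ} (hN : 1 ≤ N) : (Nat.clog 2 N : ℝ) ≤ 3 * Real.log N := by
  rcases Nat.eq_or_lt_of_le hN with rfl | hN
  · simp
  have hl := Real.log_two_gt_d9
  have h1 : ((2 : ℝ)) ^ (Nat.clog 2 N - 1) ≤ N := by
    exact_mod_cast (Nat.pow_pred_clog_lt_self one_lt_two hN).le
  have h2 := Real.log_le_log (by positivity) h1
  rw [Real.log_pow] at h2
  have hc : 1 ≤ Nat.clog 2 N := Nat.clog_pos one_lt_two hN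
  rw [Nat.cast_sub hc, Nat.cast_one] at h2
  have h3 : Real.log 2 ≤ Real.log N := Real.log_le_log (by norm_num) (by exact_mod_cast hN)
  have hc' : (1 : ℝ) ≤ Nat.clog 2 N := by exact_mod_cast hc
  nlinarith

theorem two_pow_clog_le {d : ℕ} (hd : 1 ≤ d) : 2 ^ Nat.clog 2 d ≤ 2 * d := by
  rcases Nat.eq_or_lt_of_le hd with rfl | hd
  · simp
  have h1 := Nat.pow_pred_clog_lt_self one_lt_two hd
  have hc : 1 ≤ Nat.clog 2 d := Nat.clog_pos one_lt_two hd
  obtain ⟨c, hc⟩ := Nat.exists_eq_add_of_le' hc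
  rw [hc] at h1 ⊢
  rw [pow_succ]
  simp only [Nat.pred_succ] at h1
  omega

theorem exists_two_pow_near {B : ℝ} (hB : 0 ≤ B) :
    ∃ m : ℕ, 1 ≤ m ∧ 128 * (2 + B) ≤ 2 ^ m ∧ (m : ℝ) ≤ 14 * Real.log (2 + B) := by
  obtain ⟨m, h1, h2⟩ := exists_nat_pow_near (x := 128 * (2 + B)) (y := 2) (by linarith) one_lt_two
  refine ⟨m + 1, by omega, h2.le, ?_⟩
  have hl := Real.log_two_gt_d9
  have h3 := Real.log_le_log (by positivity) h1
  rw [Real.log_pow, Real.log_mul (by norm_num) (by positivity),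
    show (128 : ℝ) = 2 ^ 7 by norm_num, Real.log_pow] at h3
  have h4 : Real.log 2 ≤ Real.log (2 + B) := Real.log_le_log (by norm_num) (by linarith)
  push_cast at h3 ⊢
  have hm : (0 : ℝ) ≤ m := Nat.cast_nonneg m
  nlinarith

theorem exists_amplification_parameters {N d : ℕ} {M E ε : ℝ} (hd : 1 ≤ d) (hdN : d ≤ N)
    (hM : 0 < M) (hE : 0 < E) (hε : 0 < ε) (hEM : E ≤ 2 * d * M) :
    ∃ k m : ℕ, 1 ≤ k ∧ 1 ≤ m ∧
      Real.sin (Real.pi / (2 * (2 * k + 1))) ≤ √(E / (2 * 2 ^ Nat.clog 2 d * M)) ∧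
      0 < √(E / (2 * 2 ^ Nat.clog 2 d * M)) ∧
      (2 * k + 1 : ℝ) ≤ 10 * √(M * d / E) ∧
      9 * (2 * k + 1) * (Real.sin (Real.pi / (2 * (2 * k + 1))) /
        √(E / (2 * 2 ^ Nat.clog 2 d * M)) * (2 * (2 ^ m)⁻¹)) ≤ ε ∧
      (m : ℝ) ≤ 14 * Real.log (2 + N * M / (E * ε)) := by
  have hd0 : (1 : ℝ) ≤ d := by exact_mod_cast hd
  have hdN' : (d : ℝ) ≤ N := by exact_mod_cast hdN
  have hpi := Real.pi_pos
  have hpi4 := Real.pi_lt_d2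
  obtain ⟨m, hm1, hm, hmle⟩ := exists_two_pow_near (B := N * M / (E * ε)) (by positivity)
  have hc1 : (d : ℝ) ≤ 2 ^ Nat.clog 2 d := by exact_mod_cast Nat.le_pow_clog one_lt_two d
  have hc2 : (2 : ℝ) ^ Nat.clog 2 d ≤ 2 * d := by exact_mod_cast two_pow_clog_le hd
  set D : ℝ := 2 ^ Nat.clog 2 d with hD
  have hD0 : 0 < D := by positivity
  set a : ℝ := √(E / (2 * D * M)) with ha
  have ha0 : 0 < a := Real.sqrt_pos.2 (by positivity)
  have ha1 : a ≤ 1 := by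
    rw [ha, Real.sqrt_le_one, div_le_one (by positivity)]
    refine hEM.trans ?_
    gcongr
  set Q : ℝ := √(M * d / E) with hQ
  have hQ2 : Q ^ 2 = M * d / E := Real.sq_sqrt (by positivity)
  have hQ0 : 0 < Q := Real.sqrt_pos.2 (by positivity)
  have haQ : 1 / a ≤ 2 * Q := by
    rw [div_le_iff₀ ha0]
    have h1 : 1 ^ 2 ≤ (2 * Q * a) ^ 2 := by
      rw [mul_pow, mul_pow, hQ2, ha, Real.sq_sqrt (by positivity)]
      have : (2 : ℝ) ^ 2 * (M * d / E) * (E / (2 * D * M)) = 2 * d / D := by field_simp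
      rw [this, one_pow, le_div_iff₀ hD0]
      linarith
    exact (pow_le_pow_iff_left₀ zero_le_one (by positivity) two_ne_zero).1 h1
  set k : ℕ := ⌈1 / a⌉₊ with hk
  have hk1 : 1 / a ≤ k := Nat.le_ceil _
  have hk2 : (k : ℝ) < 1 / a + 1 := Nat.ceil_lt_add_one (by positivity)
  have ha1' : 1 ≤ 1 / a := by rw [le_div_iff₀ ha0]; linarith
  have hk0 : (0 : ℝ) < k := by linarith
  have hθ : Real.sin (Real.pi / (2 * (2 * k + 1))) ≤ Real.pi / (2 * (2 * k + 1)) :=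
    Real.sin_le (by positivity)
  refine ⟨k, m, by exact_mod_cast (show (1 : ℝ) ≤ k by linarith), hm1, ?_, ha0, by linarith, ?_,
    hmle⟩
  · refine hθ.trans ?_
    rw [div_le_iff₀ (by positivity)]
    rw [div_le_iff₀ ha0] at hk1
    nlinarith
  · have h1 : 9 * (2 * (k : ℝ) + 1) * (Real.sin (Real.pi / (2 * (2 * k + 1))) / a *
        (2 * (2 ^ m)⁻¹)) ≤ 9 * (2 * (k : ℝ) + 1) * (Real.pi / (2 * (2 * k + 1)) / a *
        (2 * (2 ^ m)⁻¹)) := by gcongr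
    have h2 : 9 * (2 * (k : ℝ) + 1) * (Real.pi / (2 * (2 * k + 1)) / a * (2 * (2 ^ m)⁻¹)) =
        9 * Real.pi * (1 / a) / 2 ^ m := by field_simp
    rw [h2] at h1
    refine h1.trans ?_
    rw [div_le_iff₀ (by positivity)]
    have h3 : Q ≤ 2 * (N * M / E) := by
      have h4 : 1 / 2 ≤ Q ^ 2 := by
        rw [hQ2, div_le_div_iff₀ two_pos hE]; linarith
      have h5 : Q ^ 2 ≤ N * M / E := by
        rw [hQ2, mul_comm M]; gcongr
      nlinarith
    have h6 : 128 * (N * M / E) ≤ ε * 2 ^ m := by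
      have : 128 * (N * M / E) = ε * (128 * (N * M / (E * ε))) := by field_simp
      rw [this]
      refine mul_le_mul_of_nonneg_left (le_trans ?_ hm) hε.le
      linarith
    have h7 : 9 * Real.pi * (1 / a) ≤ 9 * 3.15 * (2 * Q) := by gcongr
    have h8 : 0 ≤ N * M / E := by positivity
    linarith

end Parameters

theorem exists_circuit_initialState {N d k m : ℕ} {mMax κMax α β E ε : ℝ} (hd : 1 ≤ d)
    (hdN : d ≤ N) (hE : 0 < E) (hm : 0 ≤ mMax) (hκ : 0 ≤ κMax)
    (hM : 0 < maxEnergy mMax κMax α β) (hk : 1 ≤ k)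
    (hs : Real.sin (Real.pi / (2 * (2 * k + 1))) ≤
      √(E / (2 * 2 ^ Nat.clog 2 d * maxEnergy mMax κMax α β)))
    (ha : 0 < √(E / (2 * 2 ^ Nat.clog 2 d * maxEnergy mMax κMax α β)))
    (hε : 9 * (2 * k + 1) * (Real.sin (Real.pi / (2 * (2 * k + 1))) /
      √(E / (2 * 2 ^ Nat.clog 2 d * maxEnergy mMax κMax α β)) * (2 * (2 ^ m)⁻¹)) ≤ ε) :
    ∃ (w : ℕ) (c : QCircuit (Nat.clog 2 N) w)
      (out : (Unit ⊕ Fin (Nat.clog 2 N) ⊕ Fin (Nat.clog 2 N)) ↪ Fin w),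
      c.queries ≤ 9 * (2 * k + 1) ∧
      c.gates ≤ (2 * k + 1) * (43 * (447 * Nat.clog 2 N + 924 * m ^ 2 + 931 * m + 558) +
        84 * Nat.clog 2 N + 130) ∧
      ∀ (S : OscillatorSystem N) (O : OracleData (Nat.clog 2 N)),
        S.HasParams d mMax κMax α β E → O.Describes S d mMax κMax →
        ‖WithLp.toLp 2 (c.output O - padZero out (S.initialState (Nat.clog 2 N)))‖ ≤ ε := by
  have hN : N ≤ 2 ^ Nat.clog 2 N := Nat.le_pow_clog one_lt_two N
  set n := Nat.clog 2 N with hn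
  set M := maxEnergy mMax κMax α β with hMdef
  set a := √(E / (2 * 2 ^ Nat.clog 2 d * M)) with hadef
  set s := Real.sin (Real.pi / (2 * (2 * k + 1))) with hsdef
  have hs0 : 0 ≤ s := by
    apply Real.sin_nonneg_of_nonneg_of_le_pi (by positivity)
    refine div_le_self Real.pi_pos.le ?_
    have : (0 : ℝ) ≤ k := Nat.cast_nonneg k
    linarith
  have hμ0 : 0 ≤ s / a := by positivity
  have hμ1 : s / a ≤ 1 := (div_le_one ha).2 hs
  have hμa : s / a * a = s := div_mul_cancel₀ _ ha.ne'
  have hab : (√mMax / √(2 * M) * α) ^ 2 + (√κMax / √(2 * M) * β) ^ 2 = 1 := by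
    rw [mul_pow, mul_pow, div_pow, div_pow, Real.sq_sqrt hm, Real.sq_sqrt hκ,
      Real.sq_sqrt (by positivity)]
    have : mMax / (2 * M) * α ^ 2 + κMax / (2 * M) * β ^ 2 =
        (mMax / 2 * α ^ 2 + κMax / 2 * β ^ 2) / M := by field_simp
    rw [this]
    exact div_self hM.ne'
  obtain ⟨F, hF, hFspec⟩ := exists_block_approxState (m := m) hN hd (Nat.clog_mono_right 2 hdN)
    hab hμ0 hμ1
  obtain ⟨W, _, _, f, T, hT, hTu, hTspec⟩ := hF.amplified hk
  obtain ⟨w, c, e, hq, hg, hout⟩ := hT.exists_circuit hTu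
  refine ⟨w, c, f.trans e, hq.trans (by linarith), hg.trans ?_, fun S O hS hO => ?_⟩
  · have hcard : Fintype.card (Reg n) = 1 + (n + n) := by simp [Reg]
    rw [hcard]
    nlinarith
  · have hSE : 0 < S.energy := by rw [hS.energy_eq]; exact hE
    obtain ⟨b, c', hb, hc', hval⟩ := hFspec S O mMax κMax _ _ hO (by rw [hS.norm_v])
      (by rw [hS.norm_x]) fun h => by simp [h]
    have happ := norm_approxState_sub_le S (m := m) hN hS hd hm hκ hE hM hb hc' hμ0
    rw [hμa, ← hval] at happ
    rw [hout, padZero_eq_insertState, ← insertState_zero_trans, ← map_sub, norm_insertState]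
    exact (hTspec O _ _ (norm_initialState S hN hSE) happ).trans hε

theorem mainTheorem8 :
    ∃ C : ℝ, 0 < C ∧
      ∀ (N d : ℕ) (mMax κMax α β E ε : ℝ), 1 ≤ d → d ≤ N → 0 < E → 0 < ε →
        ∃ (w : ℕ) (c : QCircuit (Nat.clog 2 N) w)
          (out : (Unit ⊕ Fin (Nat.clog 2 N) ⊕ Fin (Nat.clog 2 N)) ↪ Fin w),
          (c.queries : ℝ) ≤ C * √(maxEnergy mMax κMax α β * d / E) ∧
          (c.gates : ℝ) ≤ C * √(maxEnergy mMax κMax α β * d / E) *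
            (Real.log (2 + N * maxEnergy mMax κMax α β / (E * ε)) ^ 2 + Real.log N) ∧
          ∀ (S : OscillatorSystem N) (O : OracleData (Nat.clog 2 N)),
            S.HasParams d mMax κMax α β E → O.Describes S d mMax κMax →
            ‖WithLp.toLp 2 (c.output O - padZero out (S.initialState (Nat.clog 2 N)))‖ ≤ ε := by
  refine ⟨300000000, by norm_num, ?_⟩
  intro N d mMax κMax α β E ε hd hdN hE hε
  have hN1 : 1 ≤ N := hd.trans hdN
  have hlogN : 0 ≤ Real.log N := Real.log_nonneg (by exact_mod_cast hN1)
  by_cases hfeas : ∃ S : OscillatorSystem N, S.HasParams d mMax κMax α β E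
  · obtain ⟨S, hS⟩ := hfeas
    have hm : 0 ≤ mMax := (S.m_pos ⟨0, hN1⟩).le.trans (hS.m_le _)
    have hκ : 0 ≤ κMax := (S.κ_nonneg ⟨0, hN1⟩ ⟨0, hN1⟩).trans (hS.κ_le _ _)
    have hEM := energy_le S hS hd hm hκ
    have hM : 0 < maxEnergy mMax κMax α β := by
      have hd0 : (0 : ℝ) < 2 * d := by
        have : (1 : ℝ) ≤ d := by exact_mod_cast hd
        linarith
      exact pos_of_mul_pos_right (lt_of_lt_of_le hE hEM) hd0.le
    obtain ⟨k, m, hk, hm1, hs, ha, hkQ, herr, hmL⟩ :=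
      exists_amplification_parameters hd hdN hM hE hε hEM
    obtain ⟨w, c, out, hq, hg, hc⟩ :=
      exists_circuit_initialState hd hdN hE hm hκ hM hk hs ha herr
    refine ⟨w, c, out, ?_, ?_, hc⟩
    · have hq' : (c.queries : ℝ) ≤ 9 * (2 * k + 1) := by exact_mod_cast hq
      have := Real.sqrt_nonneg (maxEnergy mMax κMax α β * d / E)
      linarith
    · set Q := √(maxEnergy mMax κMax α β * d / E)
      set L := Real.log (2 + N * maxEnergy mMax κMax α β / (E * ε))
      have hQ0 : 0 ≤ Q := Real.sqrt_nonneg _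
      have hg' : (c.gates : ℝ) ≤ (2 * k + 1) * (43 * (447 * Nat.clog 2 N + 924 * m ^ 2 + 931 * m +
        558) + 84 * Nat.clog 2 N + 130) := by exact_mod_cast hg
      have hn := natCast_clog_le hN1
      have hm1' : (1 : ℝ) ≤ m := by exact_mod_cast hm1
      have hmsq : (m : ℝ) ≤ m ^ 2 := by nlinarith
      have hmL2 : (m : ℝ) ^ 2 ≤ 196 * L ^ 2 := by nlinarith
      have hinner : 43 * (447 * (Nat.clog 2 N : ℝ) + 924 * m ^ 2 + 931 * m + 558) +
          84 * Nat.clog 2 N + 130 ≤ 30000000 * (L ^ 2 + Real.log N) := by nlinarith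
      have h0 : 0 ≤ L ^ 2 + Real.log N := by positivity
      calc (c.gates : ℝ) ≤ _ := hg'
        _ ≤ (10 * Q) * (30000000 * (L ^ 2 + Real.log N)) := by gcongr
        _ = _ := by ring
  · refine ⟨_, [], (Fintype.equivFin _).toEmbedding, ?_, ?_, fun S _ hS _ =>
      absurd ⟨S, hS⟩ hfeas⟩
    · simp only [QCircuit.queries, List.countP_nil, Nat.cast_zero]
      positivity
    · simp only [QCircuit.gates, List.countP_nil, Nat.cast_zero]
      positivity

end
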